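/- Let $k$ be an algebraically closed field of characteristic $p>0$. Let $X,Y,H$ be the standard basis of $\mathfrak{sl}_2(\mathbb{C})$ (so $[X,Y]=H$, $[H,X]=2X$, $[H,Y]=-2Y$), let $\mathcal{U}_{\mathbb{Z}}$ be the subring of the universal enveloping algebra of $\mathfrak{sl}_2(\mathbb{C})$ generated by all $X^{(m)}=X^m/m!$ and $Y^{(m)}=Y^m/m!$ with $m\ge 0$, and let $\mathcal{U}=\mathcal{U}_{\mathbb{Z}}\otimes_{\mathbb{Z}}k$ be the hyperalgebra of $\mathrm{SL}_2(k)$. With $\binom{H+c}{m}=(H+c)(H+c-1)\cdots(H+c-m+1)/m!$, the elements $Y^{(m)}\binom{H}{n}X^{(m')}$ form a $k$-basis of $\mathcal{U}$; let $\mathrm{Fr}':\mathcal{U}\to\mathcal{U}$ be the $k$-linear map with $Y^{(m)}\binom{H}{n}X^{(m')}\mapsto Y^{(mp)}\binom{H}{np}X^{(m'p)}$. For $a\in\mathbb{Z}$ put $\mu_a=\binom{H-a-1}{p-1}\in\mathcal{U}$. *One pair, $p$ odd.* Let $\mathcal{P}=\{0,\dots,p-1\}\times\{0,1,\dots,(p-1)/2\}$.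 Over $\mathbb{F}_p$ put $\varphi_{a,m}(x)=\prod_{i=0}^{m-1}(x-i(i+a+1))$, $\psi(x)=\prod_{i\in\mathbb{F}_p}(x-i^2)$, $\psi^{(1)}_j(x)=\psi(x)/(x-j^2)$, $\psi^{(0)}_0(x)=\prod_{i\in\mathbb{F}_p^\times}(x-i^2)$ and, for $j\ne0$, $\psi^{(0)}_j(x)=2x(x+j^2)\prod_{i\in\mathbb{F}_p^\times\setminus\{j,-j\}}(x-i^2)$. For $(a,j)\in\mathcal{P}$ and $\varepsilon\in\{0,1\}$ let $$B^{(\varepsilon)}(a,j)=\psi^{(\varepsilon)}_j\Big(\mu_aYX+\big(\tfrac{a+1}{2}\big)^2\Big)\,\mu_a ,$$ and let $n^{(\varepsilon)}(a,j)$ be the largest $n\ge0$ such that $\varphi_{a,n}(x)$ divides $\psi^{(\varepsilon)}_j\big(x+(\frac{a+1}{2})^2\big)$. *One pair, $p=2$.* Let $\mathcal{P}=\{(0,\frac12),(1,0),(1,1)\}$, $B^{(0)}(0,\frac12)=\mu_0$, $B^{(1)}(0,\frac12)=\mu_0YX$, $B^{(0)}(1,0)=B^{(1)}(1,0)=\mu_1YX$,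 $B^{(0)}(1,1)=B^{(1)}(1,1)=\mu_1YX+\mu_1$, and $n^{(0)}(0,\frac12)=0$, $n^{(1)}(0,\frac12)=1$, $n^{(0)}(1,0)=n^{(1)}(1,0)=1$, $n^{(0)}(1,1)=n^{(1)}(1,1)=0$. *The maps $Z$.* For every prime $p$ and $(a,j)\in\mathcal{P}$ there are unique $c^{(\varepsilon)}_m\in\mathbb{F}_p$ with $B^{(\varepsilon)}(a,j)=\mu_a\sum_{m=n^{(\varepsilon)}(a,j)}^{p-1}c^{(\varepsilon)}_mY^mX^m$. Consider the conditions (A) $a$ is even and $(p-a+1)/2\le j\le(p-1)/2$; (C) $a$ is odd and $0\le j\le(a-1)/2$. If (A) or (C) holds, put $s(a,j)=1$ if $p=2$, $s(a,j)=(p-a+1)/2$ if $p$ is odd and $a$ is even, and $s(a,j)=(p-a)/2$ if $p$ and $a$ are odd. For $z\in\mathcal{U}$ let $$Z^{(\varepsilon)}(z;(a,j))=\mu_a\sum_{m=n^{(\varepsilon)}(a,j)}^{p-1}c^{(\varepsilon)}_mY^mX^{m-s(a,j)}\,\mathrm{Fr}'(z)\,X^{s(a,j)}$$ if (A) or (C)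 holds, and $Z^{(\varepsilon)}(z;(a,j))=\mathrm{Fr}'(z)\,B^{(\varepsilon)}(a,j)$ otherwise. *Tuples.* Let $r\ge1$, $(\boldsymbol a,\boldsymbol j)=((a_i,j_i))_{i=0}^{r-1}\in\mathcal{P}^r$ and $\boldsymbol\varepsilon=(\varepsilon_0,\dots,\varepsilon_{r-1})\in\{0,1\}^r$. Put $B^{(\boldsymbol\varepsilon)}(\boldsymbol a,\boldsymbol j)=B^{(\varepsilon_0)}(a_0,j_0)$ if $r=1$, and $$B^{(\boldsymbol\varepsilon)}(\boldsymbol a,\boldsymbol j)=Z^{(\varepsilon_0)}\Big(B^{(\varepsilon_1,\dots,\varepsilon_{r-1})}\big((a_1,\dots,a_{r-1}),(j_1,\dots,j_{r-1})\big);(a_0,j_0)\Big)$$ if $r\ge2$. Let $\mathcal{X}_r(\boldsymbol a,\boldsymbol j)$ be the set of all $\boldsymbol\varepsilon\in\{0,1\}^r$ such that $\varepsilon_i=0$ whenever $j_i=0$ (if $p$ is odd), respectively such that $\varepsilon_i=0$ whenever $a_i=1$ (if $p=2$). **Lemma.** Let $\boldsymbol\varepsilon,\tilde{\boldsymbol\varepsilon}\in\mathcal{X}_r(\boldsymbol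 a,\boldsymbol j)$. If there is an $s$ with $0\le s\le r-1$ and $\varepsilon_s=\tilde\varepsilon_s=1$, then $$B^{(\boldsymbol\varepsilon)}(\boldsymbol a,\boldsymbol j)\,B^{(\tilde{\boldsymbol\varepsilon})}(\boldsymbol a,\boldsymbol j)=0 .$$ Otherwise $$B^{(\boldsymbol\varepsilon)}(\boldsymbol a,\boldsymbol j)\,B^{(\tilde{\boldsymbol\varepsilon})}(\boldsymbol a,\boldsymbol j)=B^{(\boldsymbol\varepsilon+\tilde{\boldsymbol\varepsilon})}(\boldsymbol a,\boldsymbol j),$$ and $\boldsymbol\varepsilon+\tilde{\boldsymbol\varepsilon}$ also lies in $\mathcal{X}_r(\boldsymbol a,\boldsymbol j)$. -/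

import Mathlib

open Polynomial TensorProduct

noncomputable section

namespace Hyperalgebra

/-! ### Integer-valued polynomials -/

/-- The polynomial `(T + c)(T + c - 1) ⋯ (T + c - m + 1) / m!`. -/
def binomPoly (c : ℤ) (m : ℕ) : ℂ[X] :=
  C ((m.factorial : ℂ)⁻¹) * ∏ i ∈ Finset.range m, (X + C ((c : ℂ) - (i : ℂ)))

/-- A complex polynomial taking integer values at the integers. -/
def IntValued (f : ℂ[X]) : Prop := ∀ z : ℤ, ∃ w : ℤ, f.eval (z : ℂ) = (w : ℂ)

theorem binomPoly_eval (c : ℤ) (m : ℕ) (t : ℂ) :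
    (binomPoly c m).eval t =
      ((m.factorial : ℂ)⁻¹) * ∏ i ∈ Finset.range m, (t + ((c : ℂ) - (i : ℂ))) := by
  simp [binomPoly, eval_prod]

theorem binomPoly_eval_int (c : ℤ) (m : ℕ) (z : ℤ) :
    (binomPoly c m).eval (z : ℂ) = (Ring.choose (z + c) m : ℤ) := by
  rw [binomPoly_eval, inv_mul_eq_iff_eq_mul₀ (by exact_mod_cast m.factorial_ne_zero)]
  have h := Ring.descPochhammer_eq_factorial_smul_choose (z + c) m
  rw [← Polynomial.eval_eq_smeval, descPochhammer_eval_eq_prod_range, nsmul_eq_mul] at h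
  have h2 := congrArg (Int.cast : ℤ → ℂ) h
  push_cast at h2
  rw [← h2]
  exact Finset.prod_congr rfl fun i _ => by ring

theorem intValued_binomPoly (c : ℤ) (m : ℕ) : IntValued (binomPoly c m) :=
  fun z => ⟨_, binomPoly_eval_int c m z⟩

theorem IntValued.mul {f g : ℂ[X]} (hf : IntValued f) (hg : IntValued g) :
    IntValued (f * g) := fun z => by
  obtain ⟨u, hu⟩ := hf z
  obtain ⟨v, hv⟩ := hg z
  exact ⟨u * v, by simp [hu, hv]⟩

theorem IntValued.shift {f : ℂ[X]} (hf : IntValued f) (c : ℤ) :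
    IntValued (f.comp (X + C (c : ℂ))) := fun z => by
  obtain ⟨u, hu⟩ := hf (z + c)
  exact ⟨u, by rw [← hu]; simp⟩

theorem binomPoly_natDegree_le (c : ℤ) (m : ℕ) : (binomPoly c m).natDegree ≤ m := by
  refine (natDegree_C_mul_le _ _).trans ((natDegree_prod_le _ _).trans ?_)
  simp only [natDegree_X_add_C]
  simp

/-- An integer-valued polynomial of degree at most `d` is an integral combination of the binomial
polynomials of degree at most `d`. -/
theorem IntValued.exists_sum {f : ℂ[X]} (hf : IntValued f) {d : ℕ} (hd : f.natDegree ≤ d) :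
    ∃ c : ℕ → ℤ, f = ∑ n ∈ Finset.range (d + 1), C (c n : ℂ) * binomPoly 0 n := by
  choose φ hφ using fun n : ℕ => hf n
  refine ⟨fun n => (fwdDiff 1)^[n] φ 0, ?_⟩
  have key : ∀ n : ℕ, n ≤ d → f.eval (n : ℂ) =
      (∑ n ∈ Finset.range (d + 1), C (((fwdDiff 1)^[n] φ 0 : ℤ) : ℂ) * binomPoly 0 n).eval
        (n : ℂ) := by
    intro n hn
    have h1 := shift_eq_sum_fwdDiff_iter 1 φ n 0
    have h2 : f.eval (n : ℂ) = (φ n : ℂ) := by simpa using hφ n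
    rw [h2]
    simp only [smul_eq_mul, mul_one, zero_add] at h1
    rw [h1, eval_finsetSum]
    push_cast
    have h3 : ∀ i : ℕ, (binomPoly 0 i).eval (n : ℂ) = (n.choose i : ℂ) := fun i => by
      have := binomPoly_eval_int 0 i n
      rw [add_zero, Ring.choose_natCast] at this
      simpa using this
    rw [← Finset.sum_subset (Finset.range_mono (Nat.succ_le_succ hn))]
    · exact Finset.sum_congr rfl fun i _ => by simp [h3, mul_comm]
    · intro i _ hi
      have : n < i := by simpa using hi
      simp [h3, Nat.choose_eq_zero_of_lt this]
  refine Polynomial.eq_of_degree_sub_lt_of_eval_finset_eq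
    ((Finset.range (d + 1)).image (Nat.cast : ℕ → ℂ)) ?_ ?_
  · rw [Finset.card_image_of_injective _ Nat.cast_injective, Finset.card_range]
    refine (Polynomial.degree_lt_iff_coeff_zero _ _).2 fun m hm => ?_
    refine coeff_eq_zero_of_natDegree_lt (lt_of_le_of_lt ?_ (Nat.lt_of_succ_le hm))
    refine (natDegree_sub_le _ _).trans (max_le hd (natDegree_sum_le_of_forall_le _ _ ?_))
    intro i hi
    exact (natDegree_C_mul_le _ _).trans ((binomPoly_natDegree_le 0 i).trans
      (by simpa [Nat.lt_succ_iff] using hi))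
  · intro t ht
    obtain ⟨n, hn, rfl⟩ := Finset.mem_image.1 ht
    exact key n (by simpa [Nat.lt_succ_iff] using hn)

theorem binomPoly_zero (c : ℤ) : binomPoly c 0 = 1 := by simp [binomPoly]

theorem binomPoly_succ (c : ℤ) (m : ℕ) :
    C ((m : ℂ) + 1) * binomPoly c (m + 1) = (X + C ((c : ℂ) - m)) * binomPoly c m := by
  have h : ((m : ℂ) + 1) * ((m + 1).factorial : ℂ)⁻¹ = (m.factorial : ℂ)⁻¹ := by
    rw [Nat.factorial_succ]; push_cast
    have : (m : ℂ) + 1 ≠ 0 := by exact_mod_cast m.succ_ne_zero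
    have : (m.factorial : ℂ) ≠ 0 := by exact_mod_cast m.factorial_ne_zero
    field_simp
  rw [binomPoly, binomPoly, Finset.prod_range_succ, ← mul_assoc, ← C_mul, h]
  ring

theorem binomPoly_pascal (c : ℤ) (m : ℕ) :
    binomPoly (c + 1) (m + 1) = binomPoly c (m + 1) + binomPoly c m := by
  refine Polynomial.eq_of_infinite_eval_eq _ _ (Set.infinite_of_injective_forall_mem
    (f := fun n : ℕ => (((n : ℤ) : ℂ))) (fun a b h => by simpa using h) fun n => ?_)
  simp only [Set.mem_ofPred_eq, eval_add, binomPoly_eval_int]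
  rw [← add_assoc, Ring.choose_succ_succ]
  push_cast; ring

/-! ### Commutation formulas for an `sl₂`-triple in an associative algebra -/

section Triple

variable {A : Type*} [Ring A] [Algebra ℂ A]

/-- The divided power `u ^ m / m!`. -/
def divPow (u : A) (m : ℕ) : A := ((m.factorial : ℂ)⁻¹) • u ^ m

/-- The divided power with an integral exponent, which is zero if the exponent is negative. -/
def divPowInt (u : A) (n : ℤ) : A := if 0 ≤ n then divPow u n.toNat else 0

theorem divPow_zero (u : A) : divPow u 0 = 1 := by simp [divPow]

theorem divPow_one (u : A) : divPow u 1 = u := by simp [divPow]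

theorem divPowInt_natCast (u : A) (n : ℕ) : divPowInt u n = divPow u n := by
  simp [divPowInt]

theorem divPowInt_of_neg (u : A) {n : ℤ} (h : n < 0) : divPowInt u n = 0 := by
  simp [divPowInt, not_le.2 h]

theorem inv_factorial_succ (n : ℕ) :
    ((n : ℂ) + 1) * ((n + 1).factorial : ℂ)⁻¹ = (n.factorial : ℂ)⁻¹ := by
  rw [Nat.factorial_succ]; push_cast
  have : (n : ℂ) + 1 ≠ 0 := by exact_mod_cast n.succ_ne_zero
  have : (n.factorial : ℂ) ≠ 0 := by exact_mod_cast n.factorial_ne_zero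
  field_simp

theorem mul_divPow (u : A) (n : ℕ) : u * divPow u n = ((n : ℂ) + 1) • divPow u (n + 1) := by
  rw [divPow, divPow, smul_smul, inv_factorial_succ, pow_succ', mul_smul_comm]

theorem mul_divPowInt (u : A) (n : ℤ) :
    u * divPowInt u n = ((n : ℂ) + 1) • divPowInt u (n + 1) := by
  rcases lt_or_ge n 0 with h | h
  · rw [divPowInt_of_neg u h, mul_zero]
    rcases (show n + 1 < 0 ∨ n = -1 by omega) with h1 | rfl
    · rw [divPowInt_of_neg u h1, smul_zero]
    · simp
  · lift n to ℕ using h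
    rw [show ((n : ℤ) + 1) = ((n + 1 : ℕ) : ℤ) by push_cast; ring, divPowInt_natCast,
      divPowInt_natCast]
    exact_mod_cast mul_divPow u n

theorem divPow_mul (u : A) (m n : ℕ) :
    divPow u m * divPow u n = ((m + n).choose m : ℤ) • divPow u (m + n) := by
  rw [divPow, divPow, divPow, smul_mul_smul_comm, ← pow_add, ← Int.cast_smul_eq_zsmul ℂ, smul_smul]
  congr 1
  have h := Nat.choose_mul_factorial_mul_factorial (Nat.le_add_right m n)
  rw [Nat.add_sub_cancel_left] at h
  have h1 : (((m + n).choose m * m.factorial * n.factorial : ℕ) : ℂ) = ((m + n).factorial : ℕ) := by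
    rw [h]
  push_cast at h1 ⊢
  have : (m.factorial : ℂ) ≠ 0 := by exact_mod_cast m.factorial_ne_zero
  have : (n.factorial : ℂ) ≠ 0 := by exact_mod_cast n.factorial_ne_zero
  have : ((m + n).factorial : ℂ) ≠ 0 := by exact_mod_cast (m + n).factorial_ne_zero
  field_simp
  linear_combination -h1

theorem semiconj_aeval {R S : Type*} [CommRing R] [Ring S] [Algebra R S] {u a b : S}
    (h : SemiconjBy u a b) (f : R[X]) :
    SemiconjBy u (aeval a f) (aeval b f) := by
  induction f using Polynomial.induction_on' with
  | add f g hf hg => simpa using hf.add_right hg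
  | monomial n c =>
    simp only [aeval_monomial]
    exact SemiconjBy.mul_right (Algebra.commutes c u).symm (h.pow_right n)

variable {x y h : A}

theorem aeval_shift (f : ℂ[X]) (c : ℂ) :
    aeval (h + algebraMap ℂ A c) f = aeval h (f.comp (X + C c)) := by
  rw [aeval_comp]; simp

theorem semiconj_pow {u : A} {c : ℂ} (hu : u * h = (h + algebraMap ℂ A c) * u) (n : ℕ) :
    SemiconjBy (u ^ n) h (h + algebraMap ℂ A (c * n)) := by
  induction n with
  | zero => simp
  | succ n ih =>
    have h1 : SemiconjBy u h (h + algebraMap ℂ A c) := hu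
    have h2 := (h1.add_right (Algebra.commutes (c * (n : ℂ)) u).symm).mul_left ih
    have h3 : h + algebraMap ℂ A (c * ((n + 1 : ℕ) : ℂ)) =
        h + algebraMap ℂ A c + algebraMap ℂ A (c * (n : ℂ)) := by
      rw [add_assoc, ← map_add]
      congr 2
      push_cast; ring
    rw [pow_succ', h3]
    exact h2

theorem divPowInt_mul_aeval {u : A} {c : ℂ} (hu : u * h = (h + algebraMap ℂ A c) * u) (n : ℤ)
    (f : ℂ[X]) :
    divPowInt u n * aeval h f = aeval h (f.comp (X + C (c * n))) * divPowInt u n := by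
  rcases lt_or_ge n 0 with h0 | h0
  · simp [divPowInt_of_neg u h0]
  · lift n to ℕ using h0
    rw [divPowInt_natCast, divPow, smul_mul_assoc, mul_smul_comm, ← aeval_shift]
    congr 1
    exact_mod_cast semiconj_aeval (semiconj_pow hu n) f

theorem aeval_mul_divPowInt {u : A} {c : ℂ} (hu : u * h = (h + algebraMap ℂ A c) * u) (n : ℤ)
    (f : ℂ[X]) :
    aeval h f * divPowInt u n = divPowInt u n * aeval h (f.comp (X + C (-(c * n)))) := by
  rw [divPowInt_mul_aeval hu, comp_assoc]
  simp

theorem binomPoly_comp (c d : ℤ) (m : ℕ) :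
    (binomPoly c m).comp (X + C (d : ℂ)) = binomPoly (c + d) m := by
  simp only [binomPoly, mul_comp, C_comp, prod_comp, add_comp, X_comp]
  congr 1
  refine Finset.prod_congr rfl fun i _ => ?_
  rw [add_assoc, ← C_add]
  congr 2
  push_cast; ring

theorem mul_divPowInt_of_triple (hy : y * h = (h + algebraMap ℂ A 2) * y)
    (hxy : x * y = y * x + h) (n : ℤ) :
    x * divPowInt y n =
      divPowInt y n * x + divPowInt y (n - 1) * aeval h (X + C (-(n : ℂ) + 1)) := by
  rcases lt_or_ge n 0 with h0 | h0
  · simp [divPowInt_of_neg y h0, divPowInt_of_neg y (show n - 1 < 0 by omega)]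
  · lift n to ℕ using h0
    induction n with
    | zero => simp [divPowInt, divPow]
    | succ n ih =>
      have e1 : divPowInt y ((n + 1 : ℕ) : ℤ) = ((n : ℂ) + 1)⁻¹ • (y * divPowInt y n) := by
        rw [mul_divPowInt, smul_smul, Int.cast_natCast, inv_mul_cancel₀, one_smul]
        · push_cast; rfl
        · exact_mod_cast n.succ_ne_zero
      have e2 : y * divPowInt y ((n : ℤ) - 1) = (n : ℂ) • divPowInt y n := by
        rw [mul_divPowInt]; simp
      have e3 : h * divPowInt y n = divPowInt y n * aeval h (X + C (-(2 * (n : ℂ)))) := by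
        have := aeval_mul_divPowInt hy n X
        simpa using this
      have e4 : x * (y * divPowInt y n) = (y * divPowInt y n) * x +
          ((n : ℂ) + 1) • (divPowInt y n * aeval h (X + C (-(n : ℂ)))) := by
        rw [← mul_assoc, hxy, add_mul, e3, mul_assoc, ih, mul_add, ← mul_assoc, ← mul_assoc, e2,
          smul_mul_assoc, add_assoc, ← mul_smul_comm, ← mul_add, ← mul_smul_comm]
        congr 2
        rw [← map_smul, ← map_smul, ← map_add]
        congr 1
        simp only [smul_eq_C_mul, C_neg, C_add, C_mul, Int.cast_natCast]
        simp only [C_1, C_ofNat]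
        ring
      rw [e1, mul_smul_comm, e4, smul_add, smul_smul, inv_mul_cancel₀, one_smul, smul_mul_assoc]
      · push_cast; simp
      · exact_mod_cast n.succ_ne_zero

/-- Kostant's formula for `x ^ (r) * y ^ (s)`. -/
theorem divPow_mul_divPow (hx : x * h = (h + algebraMap ℂ A (-2)) * x)
    (hy : y * h = (h + algebraMap ℂ A 2) * y) (hxy : x * y = y * x + h) (r : ℕ) (s : ℤ) :
    divPowInt x r * divPowInt y s = ∑ k ∈ Finset.range (r + 1),
      divPowInt y (s - k) * aeval h (binomPoly (2 * k - r - s) k) * divPowInt x (r - k) := by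
  induction r with
  | zero => simp [divPowInt, divPow, binomPoly_zero]
  | succ r ih =>
    have hr : ((r : ℂ) + 1) ≠ 0 := by exact_mod_cast r.succ_ne_zero
    have e1 : divPowInt x ((r + 1 : ℕ) : ℤ) = ((r : ℂ) + 1)⁻¹ • (x * divPowInt x r) := by
      rw [mul_divPowInt, smul_smul, Int.cast_natCast, inv_mul_cancel₀ hr, one_smul]
      push_cast; rfl
    let P : ℕ → A := fun k => divPowInt y (s - k) *
      aeval h (C ((r : ℂ) - k + 1) * binomPoly (2 * k - r - s - 2) k) * divPowInt x (r + 1 - k)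
    let Q : ℕ → A := fun k => divPowInt y (s - k - 1) *
      aeval h ((X + C ((k : ℂ) + 1 - s)) * binomPoly (2 * k - r - s) k) * divPowInt x (r - k)
    have e2 : ∀ k : ℕ, x * (divPowInt y (s - k) * aeval h (binomPoly (2 * k - r - s) k) *
        divPowInt x (r - k)) = P k + Q k := by
      intro k
      have f1 : x * aeval h (binomPoly (2 * k - r - s) k) =
          aeval h (binomPoly (2 * k - r - s - 2) k) * x := by
        have := divPowInt_mul_aeval hx 1 (binomPoly (2 * k - r - s) k)
        have h1 : divPowInt x 1 = x := by simp [divPowInt, divPow]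
        rw [h1] at this
        rw [this, sub_eq_add_neg _ (2 : ℤ), ← binomPoly_comp]
        simp
      have f2 : x * divPowInt x (r - k) = ((r : ℂ) - k + 1) • divPowInt x (r + 1 - k) := by
        rw [mul_divPowInt]; push_cast
        rw [show (r : ℤ) - k + 1 = r + 1 - k by ring]
      rw [← mul_assoc, ← mul_assoc, mul_divPowInt_of_triple hy hxy, add_mul, add_mul]
      congr 1
      · simp only [P]
        rw [mul_assoc _ x, f1, mul_assoc, mul_assoc _ x, f2, map_mul, aeval_C, mul_smul_comm,
          mul_smul_comm, mul_assoc, mul_assoc (algebraMap ℂ A _), ← Algebra.smul_def,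
          mul_smul_comm]
      · simp only [Q, map_mul]
        rw [mul_assoc (divPowInt y _)]
        push_cast
        rw [show -((s : ℂ) - k) + 1 = (k : ℂ) + 1 - s by ring]
    have e3 : P (r + 1) = 0 := by simp [P]
    rw [e1, smul_mul_assoc, mul_assoc, ih, Finset.mul_sum, Finset.sum_congr rfl fun k _ => e2 k,
      Finset.sum_add_distrib, ← add_zero (∑ k ∈ _, P k), ← e3, ← Finset.sum_range_succ,
      inv_smul_eq_iff₀ hr, Finset.sum_range_succ' P,
      Finset.sum_range_succ' _ (r + 1), smul_add,
      add_right_comm, ← Finset.sum_add_distrib, Finset.smul_sum]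
    congr 1
    · refine Finset.sum_congr rfl fun m _ => ?_
      simp only [P, Q]
      push_cast
      rw [show s - ((m : ℤ) + 1) = s - m - 1 by ring,
        show (r : ℤ) + 1 - ((m : ℤ) + 1) = r - m by ring,
        show (2 * ((m : ℤ) + 1) - r - s - 2) = 2 * m - r - s by ring,
        show (2 * ((m : ℤ) + 1) - (r + 1) - s) = (2 * m - r - s) + 1 by ring,
        ← add_mul, ← mul_add, ← map_add, ← smul_mul_assoc, ← mul_smul_comm, ← map_smul]
      congr 3
      have g1 := binomPoly_succ (2 * m - r - s) m
      rw [binomPoly_pascal, smul_eq_C_mul]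
      push_cast at g1 ⊢
      simp only [map_sub, map_add, map_mul, map_natCast, map_intCast, map_one, map_ofNat] at g1 ⊢
      linear_combination -g1
    · simp only [P]
      simp only [Nat.cast_zero, sub_zero, binomPoly_zero, map_one, mul_one, aeval_C,
        Algebra.smul_def]
      rw [← mul_assoc, Algebra.commutes]
      push_cast; rfl

end Triple

/-! ### The Kostant form -/

/-- The Lie algebra `sl₂(ℂ)`. -/
abbrev SL2 : Type := LieAlgebra.SpecialLinear.sl (Fin 2) ℂ

/-- The matrix `X` with rows `(0, 1)` and `(0, 0)`. -/
def matX : SL2 := ⟨!![0, 1; 0, 0], by simp [LieAlgebra.SpecialLinear.sl]⟩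

/-- The matrix `Y` with rows `(0, 0)` and `(1, 0)`. -/
def matY : SL2 := ⟨!![0, 0; 1, 0], by simp [LieAlgebra.SpecialLinear.sl]⟩

/-- The matrix `H` with rows `(1, 0)` and `(0, -1)`. -/
def matH : SL2 := ⟨!![1, 0; 0, -1], by simp [LieAlgebra.SpecialLinear.sl]⟩

/-- The universal enveloping algebra of `sl₂(ℂ)`. -/
abbrev UC : Type := UniversalEnvelopingAlgebra ℂ SL2

/-- `X` in the universal enveloping algebra. -/
def genX : UC := UniversalEnvelopingAlgebra.ι ℂ matX

/-- `Y` in the universal enveloping algebra. -/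
def genY : UC := UniversalEnvelopingAlgebra.ι ℂ matY

/-- `H` in the universal enveloping algebra. -/
def genH : UC := UniversalEnvelopingAlgebra.ι ℂ matH

section
attribute [local instance 100] LieRing.ofAssociativeRing

theorem lie_matX_matY : ⁅matX, matY⁆ = matH := by
  apply Subtype.ext
  rw [LieAlgebra.SpecialLinear.sl_bracket]
  ext i j
  fin_cases i <;> fin_cases j <;> simp [matX, matY, matH]

theorem lie_matH_matX : ⁅matH, matX⁆ = (2 : ℂ) • matX := by
  apply Subtype.ext
  rw [LieAlgebra.SpecialLinear.sl_bracket]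
  ext i j
  fin_cases i <;> fin_cases j <;> simp [matX, matH]
  norm_num

theorem lie_matH_matY : ⁅matH, matY⁆ = (-2 : ℂ) • matY := by
  apply Subtype.ext
  rw [LieAlgebra.SpecialLinear.sl_bracket]
  ext i j
  fin_cases i <;> fin_cases j <;> simp [matY, matH]
  norm_num

theorem genX_mul_genY : genX * genY = genY * genX + genH := by
  have h := LieHom.map_lie (UniversalEnvelopingAlgebra.ι ℂ) matX matY
  rw [lie_matX_matY, LieRing.of_associative_ring_bracket] at h
  exact (add_eq_of_eq_sub' h).symm

theorem genX_mul_genH : genX * genH = (genH + algebraMap ℂ UC (-2)) * genX := by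
  have h := LieHom.map_lie (UniversalEnvelopingAlgebra.ι ℂ) matH matX
  rw [lie_matH_matX, LieRing.of_associative_ring_bracket, map_smul] at h
  have h' : (2 : ℂ) • genX = genH * genX - genX * genH := h
  rw [add_mul, ← Algebra.smul_def, neg_smul, h']
  abel

theorem genY_mul_genH : genY * genH = (genH + algebraMap ℂ UC 2) * genY := by
  have h := LieHom.map_lie (UniversalEnvelopingAlgebra.ι ℂ) matH matY
  rw [lie_matH_matY, LieRing.of_associative_ring_bracket, map_smul] at h
  have h' : (-2 : ℂ) • genY = genH * genY - genY * genH := h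
  rw [add_mul, ← Algebra.smul_def, ← neg_neg ((2 : ℂ) • genY), ← neg_smul, h']
  abel

end

/-- The element `(H + c)(H + c - 1) ⋯ (H + c - m + 1) / m!`. -/
def binomH (c : ℤ) (m : ℕ) : UC := aeval genH (binomPoly c m)

/-- The subring of the enveloping algebra generated by all `X ^ m / m!` and `Y ^ m / m!`. -/
def UZ : Subring UC := Subring.closure (Set.range (divPow genX) ∪ Set.range (divPow genY))

theorem divPow_genX_mem (m : ℕ) : divPow genX m ∈ UZ :=
  Subring.subset_closure (Or.inl ⟨m, rfl⟩)

theorem divPow_genY_mem (m : ℕ) : divPow genY m ∈ UZ :=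
  Subring.subset_closure (Or.inr ⟨m, rfl⟩)

theorem divPowInt_mem {u : UC} (hu : ∀ m, divPow u m ∈ UZ) (n : ℤ) : divPowInt u n ∈ UZ := by
  unfold divPowInt
  split_ifs
  · exact hu _
  · exact UZ.zero_mem

theorem aeval_genH_eq_sum (d : ℕ) (c : ℕ → ℤ) :
    aeval genH (∑ n ∈ Finset.range (d + 1), C (c n : ℂ) * binomPoly 0 n) =
      ∑ n ∈ Finset.range (d + 1), c n • binomH 0 n := by
  rw [map_sum]
  refine Finset.sum_congr rfl fun n _ => ?_
  rw [map_mul, aeval_C, ← Algebra.smul_def, Int.cast_smul_eq_zsmul, binomH]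

theorem binomH_zero_mem (n : ℕ) : binomH 0 n ∈ UZ := by
  induction n using Nat.strong_induction_on with
  | _ n ih =>
    have h := divPow_mul_divPow genX_mul_genH genY_mul_genH genX_mul_genY n n
    rw [Finset.sum_range_succ] at h
    have h1 : divPowInt genY ((n : ℤ) - n) * aeval genH (binomPoly (2 * n - n - n) n) *
        divPowInt genX ((n : ℤ) - n) = binomH 0 n := by
      rw [sub_self, show (2 * (n : ℤ) - n - n) = 0 by ring]
      simp [divPowInt, divPow, binomH]
    rw [h1] at h
    rw [← sub_eq_iff_eq_add'.2 h]
    refine UZ.sub_mem (UZ.mul_mem (divPowInt_mem divPow_genX_mem _)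
      (divPowInt_mem divPow_genY_mem _)) (UZ.sum_mem fun k hk => ?_)
    refine UZ.mul_mem (UZ.mul_mem (divPowInt_mem divPow_genY_mem _) ?_)
      (divPowInt_mem divPow_genX_mem _)
    obtain ⟨c, hc⟩ := (intValued_binomPoly (2 * k - n - n) k).exists_sum
      (binomPoly_natDegree_le _ _)
    rw [hc, aeval_genH_eq_sum]
    refine UZ.sum_mem fun i hi => UZ.zsmul_mem (ih i ?_) _
    simp only [Finset.mem_range] at hi hk
    omega

theorem aeval_genH_mem {f : ℂ[X]} (hf : IntValued f) : aeval genH f ∈ UZ := by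
  obtain ⟨c, hc⟩ := hf.exists_sum le_rfl
  rw [hc, aeval_genH_eq_sum]
  exact UZ.sum_mem fun i _ => UZ.zsmul_mem (binomH_zero_mem i) _

theorem binomH_mem (c : ℤ) (n : ℕ) : binomH c n ∈ UZ :=
  aeval_genH_mem (intValued_binomPoly c n)

/-- `X ^ (m)` in the integral form. -/
def intX (m : ℕ) : UZ := ⟨divPow genX m, divPow_genX_mem m⟩

/-- `Y ^ (m)` in the integral form. -/
def intY (m : ℕ) : UZ := ⟨divPow genY m, divPow_genY_mem m⟩

/-- `binom(H + c, m)` in the integral form. -/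
def intH (c : ℤ) (m : ℕ) : UZ := ⟨binomH c m, binomH_mem c m⟩

/-- The element `Y ^ (m) * binom(H, n) * X ^ (l)` of the integral form, for `i = (m, n, l)`. -/
def intMono (i : ℕ × ℕ × ℕ) : UZ := intY i.1 * intH 0 i.2.1 * intX i.2.2

/-- The `ℤ`-span of the elements `Y ^ (m) * binom(H, n) * X ^ (l)`. -/
def monoSpan : Submodule ℤ UC := Submodule.span ℤ (Set.range fun i => (intMono i : UC))

theorem mem_monoSpan_aux {f : ℂ[X]} (hf : IntValued f) (m l : ℕ) :
    divPow genY m * aeval genH f * divPow genX l ∈ monoSpan := by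
  obtain ⟨c, hc⟩ := hf.exists_sum le_rfl
  rw [hc, aeval_genH_eq_sum, Finset.mul_sum, Finset.sum_mul]
  refine Submodule.sum_mem _ fun n _ => ?_
  rw [mul_smul_comm, smul_mul_assoc]
  exact Submodule.smul_mem _ _ (Submodule.subset_span ⟨(m, n, l), rfl⟩)

theorem mul_mem_monoSpan {u : UC} (hu : ∀ i, u * (intMono i : UC) ∈ monoSpan) {w : UC}
    (hw : w ∈ monoSpan) : u * w ∈ monoSpan := by
  induction hw using Submodule.span_induction with
  | mem w h => obtain ⟨i, rfl⟩ := h; exact hu i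
  | zero => simp
  | add a b _ _ ha hb => rw [mul_add]; exact Submodule.add_mem _ ha hb
  | smul c a _ ha => rw [mul_smul_comm]; exact Submodule.smul_mem _ _ ha

theorem divPow_genY_mul_mem (r : ℕ) (i : ℕ × ℕ × ℕ) :
    divPow genY r * (intMono i : UC) ∈ monoSpan := by
  change divPow genY r * (divPow genY i.1 * binomH 0 i.2.1 * divPow genX i.2.2) ∈ monoSpan
  rw [← mul_assoc, ← mul_assoc, divPow_mul, smul_mul_assoc, smul_mul_assoc]
  exact Submodule.smul_mem _ _ (mem_monoSpan_aux (intValued_binomPoly 0 i.2.1) _ _)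

theorem divPow_genX_mul_mem (r : ℕ) (i : ℕ × ℕ × ℕ) :
    divPow genX r * (intMono i : UC) ∈ monoSpan := by
  obtain ⟨s, n, l⟩ := i
  change divPow genX r * (divPow genY s * binomH 0 n * divPow genX l) ∈ monoSpan
  rw [← mul_assoc, ← mul_assoc, ← divPowInt_natCast genX r, ← divPowInt_natCast genY s,
    divPow_mul_divPow genX_mul_genH genY_mul_genH genX_mul_genY, Finset.sum_mul, Finset.sum_mul]
  refine Submodule.sum_mem _ fun k hk => ?_
  rw [mul_assoc _ _ (binomH 0 n), binomH, divPowInt_mul_aeval genX_mul_genH,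
    ← mul_assoc, mul_assoc _ (aeval genH _) (aeval genH _), ← map_mul]
  have hk' : k ≤ r := by simpa [Nat.lt_succ_iff] using hk
  rw [show (r : ℤ) - k = ((r - k : ℕ) : ℤ) by omega, divPowInt_natCast, mul_assoc _ _ (divPow _ l),
    divPow_mul, mul_smul_comm]
  refine Submodule.smul_mem _ _ ?_
  rcases lt_or_ge ((s : ℤ) - k) 0 with h0 | h0
  · simp [divPowInt_of_neg _ h0]
  · rw [show (s : ℤ) - k = ((s - k : ℕ) : ℤ) by omega, divPowInt_natCast]
    refine mem_monoSpan_aux ((intValued_binomPoly _ _).mul ?_) _ _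
    have := (intValued_binomPoly 0 n).shift (-2 * ((r - k : ℕ) : ℤ))
    push_cast at this ⊢
    exact this

theorem mem_monoSpan_of_mem_UZ {u : UC} (hu : u ∈ UZ) : u ∈ monoSpan := by
  have key : ∀ w ∈ monoSpan, u * w ∈ monoSpan := by
    induction hu using Subring.closure_induction with
    | mem u h =>
      rcases h with ⟨m, rfl⟩ | ⟨m, rfl⟩
      · exact fun w hw => mul_mem_monoSpan (divPow_genX_mul_mem m) hw
      · exact fun w hw => mul_mem_monoSpan (divPow_genY_mul_mem m) hw
    | zero => simp
    | one => simp
    | add a b _ _ ha hb =>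
      exact fun w hw => by rw [add_mul]; exact Submodule.add_mem _ (ha w hw) (hb w hw)
    | neg a _ ha => exact fun w hw => by rw [neg_mul]; exact Submodule.neg_mem _ (ha w hw)
    | mul a b _ _ ha hb => exact fun w hw => by rw [mul_assoc]; exact ha _ (hb w hw)
  have h1 : (1 : UC) ∈ monoSpan := by
    have := mem_monoSpan_aux (intValued_binomPoly 0 0) 0 0
    simpa [divPow_zero, binomPoly_zero] using this
  simpa using key 1 h1

theorem span_intMono : ⊤ ≤ Submodule.span ℤ (Set.range intMono) := by
  rintro ⟨u, hu⟩ -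
  have h := mem_monoSpan_of_mem_UZ hu
  have h2 : monoSpan = (Submodule.span ℤ (Set.range intMono)).map
      (UZ.subtype.toAddMonoidHom.toIntLinearMap) := by
    rw [Submodule.map_span, ← Set.range_comp]; rfl
  rw [h2] at h
  obtain ⟨v, hv, hvu⟩ := h
  have : v = ⟨u, hu⟩ := Subtype.ext hvu
  exact this ▸ hv


/-! ### Linear independence, by means of the generic Verma module -/

/-- The underlying module of the generic Verma module. -/
abbrev Verma : Type := ℕ →₀ ℂ[X]

/-- The action of `X` on the generic Verma module. -/
def opX : Module.End ℂ[X] Verma :=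
  Finsupp.linearCombination ℂ[X] fun i => Finsupp.single (i - 1) ((i : ℂ[X]) * (X - (i : ℂ[X]) + 1))

/-- The action of `Y` on the generic Verma module. -/
def opY : Module.End ℂ[X] Verma :=
  Finsupp.linearCombination ℂ[X] fun i => Finsupp.single (i + 1) 1

/-- The action of `H` on the generic Verma module. -/
def opH : Module.End ℂ[X] Verma :=
  Finsupp.linearCombination ℂ[X] fun i => Finsupp.single i (X - 2 * (i : ℂ[X]))

theorem opX_single (i : ℕ) (g : ℂ[X]) : opX (Finsupp.single i g) =
    Finsupp.single (i - 1) (g * ((i : ℂ[X]) * (X - (i : ℂ[X]) + 1))) := by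
  rw [opX, Finsupp.linearCombination_single, Finsupp.smul_single, smul_eq_mul]

theorem opY_single (i : ℕ) (g : ℂ[X]) : opY (Finsupp.single i g) = Finsupp.single (i + 1) g := by
  simp [opY, Finsupp.linearCombination_single]

theorem opH_single (i : ℕ) (g : ℂ[X]) : opH (Finsupp.single i g) =
    Finsupp.single i (g * (X - 2 * (i : ℂ[X]))) := by
  rw [opH, Finsupp.linearCombination_single, Finsupp.smul_single, smul_eq_mul]

theorem opX_opY : opX * opY - opY * opX = opH := by
  refine Finsupp.lhom_ext fun i g => ?_
  simp only [LinearMap.sub_apply, Module.End.mul_apply, opX_single, opY_single, opH_single]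
  rcases i with _ | i
  · simp
  · simp only [Nat.add_sub_cancel, ← Finsupp.single_sub]
    congr 1
    push_cast; ring

theorem opH_opX : opH * opX - opX * opH = (2 : ℂ) • opX := by
  refine Finsupp.lhom_ext fun i g => ?_
  simp only [LinearMap.sub_apply, Module.End.mul_apply, opX_single, opH_single,
    LinearMap.smul_apply, Finsupp.smul_single]
  rcases i with _ | i
  · simp
  · simp only [Nat.add_sub_cancel, ← Finsupp.single_sub, smul_eq_C_mul, C_ofNat]
    congr 1
    push_cast; ring

theorem opH_opY : opH * opY - opY * opH = (-2 : ℂ) • opY := by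
  refine Finsupp.lhom_ext fun i g => ?_
  simp only [LinearMap.sub_apply, Module.End.mul_apply, opY_single, opH_single,
    LinearMap.smul_apply, Finsupp.smul_single, ← Finsupp.single_sub, smul_eq_C_mul, C_neg, C_ofNat]
  congr 1
  push_cast; ring

section
attribute [local instance 100] LieRing.ofAssociativeRing

theorem sl_apply_one_one (M : SL2) : M.val 1 1 = -M.val 0 0 := by
  have h : Matrix.trace M.val = 0 := M.2
  rw [Matrix.trace_fin_two] at h
  linear_combination h

/-- The generic Verma module as a representation of `sl₂(ℂ)`. -/
def vermaLie : SL2 →ₗ⁅ℂ⁆ Module.End ℂ[X] Verma where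
  toFun M := M.val 0 1 • opX + M.val 1 0 • opY + M.val 0 0 • opH
  map_add' M N := by simp [add_smul]; abel
  map_smul' c M := by simp [mul_smul, smul_add]
  map_lie' {M N} := by
    rw [LieRing.of_associative_ring_bracket, LieAlgebra.SpecialLinear.sl_bracket]
    simp only [Matrix.sub_apply, Matrix.mul_apply, Fin.sum_univ_two, sl_apply_one_one]
    have e1 : opX * opY = opH + opY * opX := by rw [← opX_opY]; abel
    have e2 : opH * opX = (2 : ℂ) • opX + opX * opH := by rw [← opH_opX]; abel
    have e3 : opH * opY = (-2 : ℂ) • opY + opY * opH := by rw [← opH_opY]; abel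
    simp only [mul_add, add_mul, smul_mul_smul_comm, e1, e2, e3, smul_add, smul_smul]
    module

/-- The generic Verma module as a representation of the enveloping algebra. -/
def vermaRep : UC →ₐ[ℂ] Module.End ℂ[X] Verma := UniversalEnvelopingAlgebra.lift ℂ vermaLie

theorem vermaRep_genX : vermaRep genX = opX := by
  rw [vermaRep, genX, UniversalEnvelopingAlgebra.lift_ι_apply]
  simp [vermaLie, matX]

theorem vermaRep_genY : vermaRep genY = opY := by
  rw [vermaRep, genY, UniversalEnvelopingAlgebra.lift_ι_apply]
  simp [vermaLie, matY]

theorem vermaRep_genH : vermaRep genH = opH := by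
  rw [vermaRep, genH, UniversalEnvelopingAlgebra.lift_ι_apply]
  simp [vermaLie, matH]

end

theorem opX_pow_single_of_lt (l : ℕ) : ∀ (i : ℕ) (g : ℂ[X]), i < l →
    (opX ^ l) (Finsupp.single i g) = 0 := by
  induction l with
  | zero => intro i g h; omega
  | succ l ih =>
    intro i g h
    rw [pow_succ, Module.End.mul_apply, opX_single]
    rcases i with _ | i
    · simp
    · exact ih _ _ (by omega)

theorem opX_pow_single_self (l : ℕ) : ∀ g : ℂ[X], g ≠ 0 →
    ∃ D : ℂ[X], D ≠ 0 ∧ (opX ^ l) (Finsupp.single l g) = Finsupp.single 0 D := by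
  induction l with
  | zero => exact fun g hg => ⟨g, hg, by simp⟩
  | succ l ih =>
    intro g hg
    rw [pow_succ, Module.End.mul_apply, opX_single]
    refine ih _ (mul_ne_zero hg (mul_ne_zero (by exact_mod_cast l.succ_ne_zero) ?_))
    have : (X - ((l + 1 : ℕ) : ℂ[X]) + 1) = X + C (-(l : ℂ)) := by
      push_cast; simp; ring
    rw [this]
    exact X_add_C_ne_zero _

theorem opY_pow_single (m : ℕ) (g : ℂ[X]) :
    (opY ^ m) (Finsupp.single 0 g) = Finsupp.single m g := by
  induction m with
  | zero => simp
  | succ m ih => rw [pow_succ', Module.End.mul_apply, ih, opY_single]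

theorem aeval_opH_single (f g : ℂ[X]) :
    (aeval opH f) (Finsupp.single 0 g) = Finsupp.single 0 (f * g) := by
  induction f using Polynomial.induction_on' generalizing g with
  | add f f' hf hf' => simp [hf, hf', add_mul]
  | monomial n c =>
    have h : ∀ n : ℕ, (opH ^ n) (Finsupp.single 0 g) = Finsupp.single 0 (X ^ n * g) := by
      intro n
      induction n with
      | zero => simp
      | succ n ih =>
        rw [pow_succ', Module.End.mul_apply, ih, opH_single]
        congr 1
        push_cast; ring
    rw [aeval_monomial, ← Algebra.smul_def, LinearMap.smul_apply, h, Finsupp.smul_single,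
      smul_eq_C_mul, ← C_mul_X_pow_eq_monomial, mul_assoc]

theorem vermaRep_divPow (u : UC) (m : ℕ) :
    vermaRep (divPow u m) = ((m.factorial : ℂ)⁻¹) • vermaRep u ^ m := by
  simp [divPow]

theorem vermaRep_intMono_of_lt {i : ℕ × ℕ × ℕ} {l : ℕ} (h : l < i.2.2) :
    vermaRep (intMono i : UC) (Finsupp.single l 1) = 0 := by
  change vermaRep (divPow genY i.1 * binomH 0 i.2.1 * divPow genX i.2.2) _ = 0
  rw [map_mul, Module.End.mul_apply, vermaRep_divPow, LinearMap.smul_apply, vermaRep_genX,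
    opX_pow_single_of_lt _ _ _ h]
  simp

theorem exists_vermaRep_intMono (l : ℕ) : ∃ D : ℂ[X], D ≠ 0 ∧ ∀ m n : ℕ,
    vermaRep (intMono (m, n, l) : UC) (Finsupp.single l 1) =
      Finsupp.single m (C ((m.factorial : ℂ)⁻¹) * (binomPoly 0 n * D)) := by
  obtain ⟨D, hD, h⟩ := opX_pow_single_self l 1 one_ne_zero
  refine ⟨C ((l.factorial : ℂ)⁻¹) * D, mul_ne_zero ?_ hD, fun m n => ?_⟩
  · rw [Ne, C_eq_zero]
    exact inv_ne_zero (by exact_mod_cast l.factorial_ne_zero)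
  · change vermaRep (divPow genY m * binomH 0 n * divPow genX l) _ = _
    rw [map_mul, map_mul, Module.End.mul_apply, Module.End.mul_apply, vermaRep_divPow,
      vermaRep_divPow, LinearMap.smul_apply, LinearMap.smul_apply, vermaRep_genX, vermaRep_genY, h,
      binomH,
      ← aeval_algHom_apply, vermaRep_genH, Finsupp.smul_single, aeval_opH_single,
      opY_pow_single, Finsupp.smul_single, smul_eq_C_mul, smul_eq_C_mul]

theorem binomPoly_sum_eq_zero {s : Finset ℕ} {g : ℕ → ℤ}
    (h : ∑ n ∈ s, C (g n : ℂ) * binomPoly 0 n = 0) : ∀ n ∈ s, g n = 0 := by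
  intro n
  induction n using Nat.strong_induction_on with
  | _ n ih =>
    intro hn
    have h1 := congrArg (fun f : ℂ[X] => f.eval (((n : ℤ)) : ℂ)) h
    simp only [eval_finsetSum, eval_mul, eval_C, binomPoly_eval_int, eval_zero, add_zero,
      Ring.choose_natCast] at h1
    rw [Finset.sum_eq_single_of_mem n hn] at h1
    · simpa using h1
    · intro k hk hkn
      rcases lt_or_gt_of_ne hkn with h2 | h2
      · simp [ih k h2 hk]
      · simp [Nat.choose_eq_zero_of_lt h2]

theorem linearIndependent_intMono : LinearIndependent ℤ intMono := by
  rw [linearIndependent_iff]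
  intro g hg
  have hg' : ∑ i ∈ g.support, (g i : ℂ) • (intMono i : UC) = 0 := by
    have := congrArg (fun u : UZ => (u : UC)) hg
    rw [Finsupp.linearCombination_apply, Finsupp.sum] at this
    simpa [Int.cast_smul_eq_zsmul] using this
  have key : ∀ l m n : ℕ, g (m, n, l) = 0 := by
    intro l
    induction l using Nat.strong_induction_on with
    | _ l ih =>
      intro m n
      obtain ⟨D, hD, h⟩ := exists_vermaRep_intMono l
      have h1 := congrArg (fun u : UC => vermaRep u (Finsupp.single l 1) m) hg'
      simp only [map_sum, map_smul, LinearMap.sum_apply, LinearMap.smul_apply, map_zero,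
        LinearMap.zero_apply, Finsupp.coe_zero, Pi.zero_apply, Finsupp.finsetSum_apply,
        Finsupp.smul_apply] at h1
      by_contra hne
      let t : Finset (ℕ × ℕ × ℕ) := g.support.filter fun i => i.1 = m ∧ i.2.2 = l
      let s : Finset ℕ := t.image fun i => i.2.1
      have hs : ∀ k ∈ s, (m, k, l) ∈ g.support := by
        intro k hk
        obtain ⟨i, hi, rfl⟩ := Finset.mem_image.1 hk
        obtain ⟨hi1, rfl, rfl⟩ := Finset.mem_filter.1 hi
        exact hi1
      have h3 : C ((m.factorial : ℂ)⁻¹) * D *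
          ∑ k ∈ s, C (g (m, k, l) : ℂ) * binomPoly 0 k = 0 := by
        rw [← h1, Finset.mul_sum]
        refine Finset.sum_of_injOn (fun k => (m, k, l)) (by intro a _ b _ hab; simpa using hab)
          (fun k hk => hs k hk) ?_ ?_
        · rintro ⟨m', n', l'⟩ hi hni
          rcases lt_trichotomy l' l with hl | rfl | hl
          · simp [ih l' hl m' n']
          · have hm : m' ≠ m := by
              rintro rfl
              exact hni ⟨n', Finset.mem_coe.2 (Finset.mem_image.2
                ⟨_, Finset.mem_filter.2 ⟨hi, rfl, rfl⟩, rfl⟩), rfl⟩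
            rw [h, Finsupp.single_eq_of_ne hm.symm, smul_zero]
          · rw [vermaRep_intMono_of_lt hl]; simp
        · intro k _
          rw [h, Finsupp.single_eq_same, smul_eq_C_mul]
          ring
      have h2 : ∑ k ∈ s, C (g (m, k, l) : ℂ) * binomPoly 0 k = 0 := by
        refine (mul_eq_zero.1 h3).resolve_left (mul_ne_zero ?_ hD)
        rw [Ne, C_eq_zero]
        exact inv_ne_zero (by exact_mod_cast m.factorial_ne_zero)
      exact hne (binomPoly_sum_eq_zero h2 n
        (Finset.mem_image.2 ⟨(m, n, l), Finset.mem_filter.2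
          ⟨Finsupp.mem_support_iff.2 hne, rfl, rfl⟩, rfl⟩))
  ext ⟨m, n, l⟩
  exact key l m n

/-- The basis of the integral form that consists of all `Y ^ (m) * binom(H, n) * X ^ (l)`. -/
def intBasis : Module.Basis (ℕ × ℕ × ℕ) ℤ UZ :=
  Module.Basis.mk linearIndependent_intMono span_intMono

theorem intBasis_apply (i : ℕ × ℕ × ℕ) : intBasis i = intMono i := by
  simp [intBasis]


/-! ### The hyperalgebra of `SL₂` -/

/-- The hyperalgebra of `SL₂` over `k`: the base change to `k` of the integral form. -/
abbrev U (k : Type*) [Field k] : Type _ := k ⊗[ℤ] UZ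

section Hyper

variable (k : Type*) [Field k]

/-- The natural map from the integral form to the hyperalgebra. -/
def toU : UZ →ₐ[ℤ] U k := Algebra.TensorProduct.includeRight

/-- `X ^ (m)` in the hyperalgebra. -/
def hypX (m : ℕ) : U k := toU k (intX m)

/-- `Y ^ (m)` in the hyperalgebra. -/
def hypY (m : ℕ) : U k := toU k (intY m)

/-- `binom(H + c, m)` in the hyperalgebra. -/
def hypH (c : ℤ) (m : ℕ) : U k := toU k (intH c m)

/-- The element `Y ^ (m) * binom(H, n) * X ^ (l)` of the hyperalgebra, for `i = (m, n, l)`. -/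
def hypMono (i : ℕ × ℕ × ℕ) : U k := hypY k i.1 * hypH k 0 i.2.1 * hypX k i.2.2

/-- The `k`-basis of the hyperalgebra that consists of all `Y ^ (m) * binom(H, n) * X ^ (l)`. -/
def hypBasis : Module.Basis (ℕ × ℕ × ℕ) k (U k) := intBasis.baseChange k

theorem hypBasis_apply (i : ℕ × ℕ × ℕ) : hypBasis k i = hypMono k i := by
  rw [hypBasis, Module.Basis.baseChange_apply, intBasis_apply, intMono, hypMono, hypY, hypH, hypX,
    ← map_mul, ← map_mul]
  rfl

/-- The `k`-linear map `Fr'`, which maps `Y ^ (m) * binom(H, n) * X ^ (l)` to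
`Y ^ (m p) * binom(H, n p) * X ^ (l p)`. -/
def frobSplit (p : ℕ) : U k →ₗ[k] U k :=
  (hypBasis k).constr k fun i => hypMono k (i.1 * p, i.2.1 * p, i.2.2 * p)

theorem frobSplit_hypMono (p m n l : ℕ) :
    frobSplit k p (hypMono k (m, n, l)) = hypMono k (m * p, n * p, l * p) := by
  rw [frobSplit, ← hypBasis_apply, Module.Basis.constr_basis]

/-- `μ_a = binom(H - a - 1, p - 1)`. -/
def mu (p : ℕ) (a : ℤ) : U k := hypH k (-a - 1) (p - 1)

end Hyper

/-! ### The elements `B` for one pair -/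

section Poly

variable (p : ℕ) [Fact p.Prime]

/-- The polynomial `φ_{a,m}(x) = ∏_{i < m} (x - i (i + a + 1))` over `𝔽_p`. -/
def phi (a : ℤ) (m : ℕ) : (ZMod p)[X] :=
  ∏ i ∈ Finset.range m, (X - C ((i : ZMod p) * ((i : ZMod p) + (a : ZMod p) + 1)))

/-- The polynomial `ψ(x) = ∏_{i ∈ 𝔽_p} (x - i²)` over `𝔽_p`. -/
def psiFull : (ZMod p)[X] := ∏ i : ZMod p, (X - C (i ^ 2))

/-- The polynomials `ψ_s^{(0)}` (for `ε = 0`) and `ψ_s^{(1)}` (for `ε = 1`) over `𝔽_p`. -/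
def psi (ε : ℕ) (s : ZMod p) : (ZMod p)[X] :=
  if ε = 0 then
    if s = 0 then ∏ i ∈ Finset.univ.erase (0 : ZMod p), (X - C (i ^ 2))
    else 2 * X * (X + C (s ^ 2)) *
      ∏ i ∈ Finset.univ \ ({0, s, -s} : Finset (ZMod p)), (X - C (i ^ 2))
  else psiFull p /ₘ (X - C (s ^ 2))

/-- The set `𝒫` of pairs `(a, j)`. -/
def labels : Set (ℕ × ℚ) :=
  if p = 2 then {(0, 1 / 2), (1, 0), (1, 1)}
  else {l | l.1 < p ∧ ∃ i : ℕ, i ≤ (p - 1) / 2 ∧ l.2 = (i : ℚ)}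

/-- The number `n^{(ε)}(a, j)`: for odd `p`, the largest `n` such that `φ_{a,n}(x)` divides
`ψ_j^{(ε)}(x + ((a + 1) / 2)²)`. -/
def lowIdx (ε a : ℕ) (j : ℚ) : ℕ :=
  if p = 2 then
    if a = 0 then (if ε = 0 then 0 else 1) else (if j = 0 then 1 else 0)
  else sSup {n : ℕ | phi p a n ∣
    (psi p ε (j : ZMod p)).comp (X + C ((((a : ZMod p) + 1) / 2) ^ 2))}

variable (k : Type*) [Field k] [CharP k p]

/-- The inclusion of the prime field. -/
def ofPrime : ZMod p →+* k := ZMod.castHom (dvd_refl p) k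

/-- The element `B^{(ε)}(a, j)` for a single pair `(a, j)` in `𝒫`. -/
def B₁ (ε a : ℕ) (j : ℚ) : U k :=
  if p = 2 then
    if a = 0 then (if ε = 0 then mu k p a else mu k p a * hypY k 1 * hypX k 1)
    else
      (if j = 0 then mu k p a * hypY k 1 * hypX k 1
        else mu k p a * hypY k 1 * hypX k 1 + mu k p a)
  else
    aeval (mu k p a * hypY k 1 * hypX k 1 + algebraMap k (U k) ((((a : k) + 1) / 2) ^ 2))
      ((psi p ε (j : ZMod p)).map (ofPrime p k)) * mu k p a

end Poly

/-! ### The expansion of `B^{(ε)}(a, j)` in the elements `μ_a Y ^ m X ^ m` -/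

theorem genY_mul_genX_pow (m : ℕ) : genY * genX ^ (m + 1) =
    genX ^ m * (genY * genX - (m : UC) * (genH + (m : UC) + 1)) := by
  have e1 : genH * genX = genX * (genH + 2) := by
    have := genX_mul_genH
    rw [map_neg, map_ofNat, add_mul] at this
    rw [mul_add, this, mul_two]
    noncomm_ring
  have e2 : genY * genX = genX * genY - genH := by rw [genX_mul_genY]; abel
  have e3 : genY * genX * genX = genX * (genY * genX - genH - 2) := by
    nth_rw 1 [e2]
    rw [sub_mul, e1]
    noncomm_ring
  induction m with
  | zero => simp
  | succ m ih =>
    have hc : (m : UC) * genX = genX * m := Nat.cast_commute m genX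
    have e4 : (m : UC) * (genH + (m : UC) + 1) * genX = genX * ((m : UC) * (genH + m + 3)) := by
      rw [mul_assoc, add_mul, add_mul, e1, hc, one_mul,
        show genX * (genH + 2) + genX * (m : UC) + genX = genX * (genH + m + 3) by noncomm_ring,
        ← mul_assoc, hc, mul_assoc]
    rw [pow_succ, ← mul_assoc, ih, mul_assoc, sub_mul, e3, e4, ← mul_sub, ← mul_assoc, ← pow_succ]
    congr 1
    push_cast
    simp only [show (3 : UC) = 1 + 1 + 1 by norm_num, show (2 : UC) = 1 + 1 by norm_num]
    noncomm_ring

theorem commute_binomH (c : ℤ) (n m : ℕ) :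
    Commute (binomH c n) (genY ^ m * genX ^ m) := by
  have h1 := semiconj_pow genX_mul_genH m
  have h2 := (semiconj_pow genY_mul_genH m).add_right
    (Algebra.commutes (-2 * (m : ℂ)) (genY ^ m)).symm
  have h3 := h2.mul_left h1
  rw [add_assoc, ← map_add, ← add_mul, add_neg_cancel, zero_mul, map_zero, add_zero] at h3
  exact (semiconj_aeval h3 (binomPoly c n)).symm

theorem sub_mul_binomPoly (a : ℤ) (n : ℕ) :
    (X - C (a : ℂ)) * binomPoly (-a - 1) n = C ((n : ℂ) + 1) * binomPoly (-a) (n + 1) := by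
  rw [binomPoly, binomPoly, Finset.prod_range_succ', ← mul_assoc (C ((n : ℂ) + 1)), ← C_mul,
    inv_factorial_succ]
  have : ∀ i : ℕ, ((-a : ℤ) : ℂ) - ((i + 1 : ℕ) : ℂ) = ((-a - 1 : ℤ) : ℂ) - i := fun i => by
    push_cast; ring
  simp only [this]
  push_cast
  simp only [C_neg, sub_zero]
  ring

/-- `H` in the integral form. -/
def intGenH : UZ := ⟨genH, by
  have := aeval_genH_mem (f := X) fun z => ⟨z, by simp⟩
  simpa using this⟩

theorem intGenH_sub_mul (a : ℤ) (n : ℕ) :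
    (intGenH - (a : UZ)) * intH (-a - 1) n = ((n + 1 : ℕ) : UZ) * intH (-a) (n + 1) := by
  apply Subtype.ext
  have h := congrArg (aeval genH) (sub_mul_binomPoly a n)
  simp only [map_mul, map_sub, aeval_X, map_add, map_natCast, map_one, map_intCast] at h
  push_cast
  exact h

theorem factorial_mul_intH (c : ℤ) (n : ℕ) : (n.factorial : UZ) * intH c n =
    aeval intGenH (∏ i ∈ Finset.range n, (X + C (c - (i : ℤ))) : ℤ[X]) := by
  induction n with
  | zero =>
    apply Subtype.ext
    simp [intH, binomH, binomPoly_zero]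
  | succ n ih =>
    have h : (((n + 1 : ℕ) : UZ)) * intH c (n + 1) =
        (intGenH + ((c - (n : ℤ) : ℤ) : UZ)) * intH c n := by
      apply Subtype.ext
      have h := congrArg (aeval genH) (binomPoly_succ c n)
      simp only [map_mul, map_sub, aeval_X, map_add, map_natCast, map_one, map_intCast] at h
      push_cast
      exact h
    rw [Nat.factorial_succ, Nat.mul_comm, Nat.cast_mul, mul_assoc, h, Finset.prod_range_succ,
      mul_comm (∏ i ∈ _, _), map_mul, ← ih, ← mul_assoc, ← mul_assoc, (Nat.cast_commute _ _).eq]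
    simp

section Expansion

theorem natCast_U_eq_zero (p : ℕ) (k : Type*) [Field k] [CharP k p] : ((p : ℕ) : U k) = 0 := by
  rw [← map_natCast (algebraMap k (U k)), CharP.cast_eq_zero, map_zero]

/-- `Y X` in the hyperalgebra. -/
def hypYX (k : Type*) [Field k] : U k := hypY k 1 * hypX k 1

theorem hypYX_eq (k : Type*) [Field k] : hypYX k = toU k (intY 1 * intX 1) := by
  rw [hypYX, hypY, hypX, map_mul]

theorem commute_mu_pow (p : ℕ) (k : Type*) [Field k] (a : ℤ) (m : ℕ) :
    Commute (mu k p a) (hypY k 1 ^ m * hypX k 1 ^ m) := by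
  rw [hypY, hypX, ← map_pow, ← map_pow, ← map_mul, mu, hypH]
  refine Commute.map (f := toU k) (Subtype.ext ?_)
  have := commute_binomH (-a - 1) (p - 1) m
  simpa [intY, intX, intH, divPow_one] using this.eq

theorem commute_mu_hypYX (p : ℕ) (k : Type*) [Field k] (a : ℤ) :
    Commute (mu k p a) (hypYX k) := by
  have := commute_mu_pow p k a 1
  rwa [pow_one, pow_one] at this

variable (p : ℕ) [hp : Fact p.Prime] (k : Type*) [Field k] [CharP k p]

theorem toU_H_mul_mu (a : ℤ) : toU k intGenH * mu k p a = (a : k) • mu k p a := by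
  have h := congrArg (toU k) (intGenH_sub_mul a (p - 1))
  rw [Nat.sub_add_cancel hp.out.one_le, map_mul, map_mul, map_natCast, natCast_U_eq_zero p k,
    zero_mul, map_sub, sub_mul, map_intCast, sub_eq_zero] at h
  rw [Int.cast_smul_eq_zsmul, zsmul_eq_mul]
  exact h

theorem aeval_H_mul_mu (a : ℤ) (f : ℤ[X]) :
    aeval (toU k intGenH) f * mu k p a = ((f.eval a : ℤ) : k) • mu k p a := by
  induction f using Polynomial.induction_on' with
  | add f g hf hg => simp [add_mul, hf, hg, add_smul]
  | monomial n c =>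
    have h : ∀ n : ℕ, toU k intGenH ^ n * mu k p a = ((a : k) ^ n) • mu k p a := by
      intro n
      induction n with
      | zero => simp
      | succ n ih => rw [pow_succ', mul_assoc, ih, mul_smul_comm, toU_H_mul_mu, smul_smul, pow_succ]
    rw [aeval_monomial, mul_assoc, h, eval_monomial, ← Algebra.smul_def, Int.cast_mul, mul_smul,
      Int.cast_smul_eq_zsmul, Int.cast_pow]

theorem mu_mul_mu (hp2 : p ≠ 2) (a : ℤ) : mu k p a * mu k p a = mu k p a := by
  have hpp := hp.out
  have h := congrArg (toU k) (factorial_mul_intH (-a - 1) (p - 1))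
  rw [map_mul, map_natCast, ← aeval_algHom_apply] at h
  have h1 := aeval_H_mul_mu p k a (∏ i ∈ Finset.range (p - 1), (X + C (-a - 1 - (i : ℤ))))
  rw [← h, eval_prod] at h1
  have h2 : ∏ i ∈ Finset.range (p - 1), eval a (X + C (-a - 1 - (i : ℤ))) =
      (((p - 1).factorial : ℕ) : ℤ) := by
    have h3 : ∀ i : ℕ, eval a (X + C (-a - 1 - (i : ℤ))) = (-1) * ((i + 1 : ℕ) : ℤ) := by
      intro i; simp; ring
    simp only [h3, Finset.prod_mul_distrib, Finset.prod_const, Finset.card_range]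
    rw [(hpp.even_sub_one hp2).neg_one_pow, one_mul, ← Nat.cast_prod,
      Finset.prod_range_add_one_eq_factorial]
  rw [h2, Int.cast_natCast, mul_assoc, ← nsmul_eq_mul, ← Nat.cast_smul_eq_nsmul k] at h1
  have h4 : (((p - 1).factorial : ℕ) : k) ≠ 0 := by
    rw [Ne, CharP.cast_eq_zero_iff k p, hpp.dvd_factorial]
    have := hpp.pos
    omega
  have h5 := congrArg (fun u => (((p - 1).factorial : ℕ) : k)⁻¹ • u) h1
  simp only [smul_smul, inv_mul_cancel₀ h4, one_smul] at h5
  exact h5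

theorem hypY_pow_mul_hypX_pow_mul_mu (a : ℤ) (m : ℕ) :
    hypY k 1 ^ m * hypX k 1 ^ m * mu k p a =
      aeval (hypYX k) ((phi p a m).map (ofPrime p k)) * mu k p a := by
  induction m with
  | zero => simp [phi]
  | succ m ih =>
    have h0 : intY 1 ^ (m + 1) * intX 1 ^ (m + 1) = intY 1 ^ m * (intX 1 ^ m *
        (intY 1 * intX 1 - (m : UZ) * (intGenH + (m : UZ) + 1))) := by
      apply Subtype.ext
      have := genY_mul_genX_pow m
      push_cast
      simp only [intY, intX, intGenH, divPow_one]
      rw [← this, pow_succ, mul_assoc]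
    have h1 := congrArg (toU k) h0
    simp only [map_mul, map_pow, map_sub, map_natCast, map_add, map_one] at h1
    have h2 : (hypYX k - (m : U k) * (toU k intGenH + (m : U k) + 1)) * mu k p a =
        mu k p a * (hypYX k - algebraMap k (U k) ((m : k) * ((m : k) + (a : k) + 1))) := by
      rw [sub_mul, mul_sub, (commute_mu_hypYX p k a).eq, mul_assoc, add_mul, add_mul,
        toU_H_mul_mu, ← Algebra.commutes, ← Algebra.smul_def, mul_smul, add_smul, add_smul,
        one_smul, one_mul, Nat.cast_smul_eq_nsmul, Nat.cast_smul_eq_nsmul, nsmul_eq_mul,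
        nsmul_eq_mul]
      congr 2
      abel
    have h3 : hypY k 1 ^ (m + 1) * hypX k 1 ^ (m + 1) = hypY k 1 ^ m * (hypX k 1 ^ m *
        (hypYX k - (m : U k) * (toU k intGenH + (m : U k) + 1))) := h1
    have h5 : phi p a (m + 1) =
        phi p a m * (X - C ((m : ZMod p) * ((m : ZMod p) + (a : ZMod p) + 1))) := by
      rw [phi, phi, Finset.prod_range_succ]
    rw [h3, mul_assoc, mul_assoc, h2, ← mul_assoc, ← mul_assoc, ih, h5, Polynomial.map_mul,
      map_mul (aeval (hypYX k)), mul_assoc, mul_assoc]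
    congr 1
    have h4 : aeval (hypYX k) ((X - C ((m : ZMod p) * ((m : ZMod p) + (a : ZMod p) + 1))).map
        (ofPrime p k)) = hypYX k - algebraMap k (U k) ((m : k) * ((m : k) + (a : k) + 1)) := by
      rw [Polynomial.map_sub, map_X, map_C, map_sub, aeval_X, aeval_C]
      simp only [ofPrime, map_mul, map_add, map_natCast, map_intCast, map_one]
    rw [h4, mul_sub, sub_mul, (commute_mu_hypYX p k a).eq, Algebra.commutes]

theorem aeval_mul_mu (hp2 : p ≠ 2) (a : ℤ) (c : k) (f : k[X]) :
    aeval (mu k p a * hypY k 1 * hypX k 1 + algebraMap k (U k) c) f * mu k p a =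
      aeval (hypYX k) (f.comp (X + C c)) * mu k p a := by
  have h1 : Commute (mu k p a) (hypYX k + algebraMap k (U k) c) :=
    (commute_mu_hypYX p k a).add_right (Algebra.commutes c _).symm
  have h2 : (mu k p a * hypY k 1 * hypX k 1 + algebraMap k (U k) c) * mu k p a =
      (hypYX k + algebraMap k (U k) c) * mu k p a := by
    rw [add_mul, add_mul, mul_assoc (mu k p a)]
    change mu k p a * hypYX k * _ + _ = _
    rw [mul_assoc, ← (commute_mu_hypYX p k a).eq, ← mul_assoc, mu_mul_mu p k hp2]
  rw [aeval_comp]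
  simp only [map_add, aeval_X, aeval_C]
  induction f using Polynomial.induction_on' with
  | add f g hf hg => rw [map_add, map_add, add_mul, add_mul, hf, hg]
  | monomial n d =>
    rw [aeval_monomial, aeval_monomial, mul_assoc (algebraMap k (U k) d),
      mul_assoc (algebraMap k (U k) d)]
    refine congrArg (fun u => algebraMap k (U k) d * u) ?_
    induction n with
    | zero => simp
    | succ n ih => rw [pow_succ, mul_assoc, h2, ← h1.eq, ← mul_assoc, ih, mul_assoc, h1.eq,
        ← mul_assoc, ← pow_succ]

end Expansion

section Newton

variable (p : ℕ) [hp : Fact p.Prime]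

theorem monic_phi (a : ℤ) (m : ℕ) : (phi p a m).Monic :=
  monic_prod_of_monic _ _ fun _ _ => monic_X_sub_C _

theorem natDegree_phi (a : ℤ) (m : ℕ) : (phi p a m).natDegree = m := by
  rw [phi, natDegree_prod_of_monic _ _ fun _ _ => monic_X_sub_C _]
  simp only [natDegree_X_sub_C, Finset.sum_const, Finset.card_range, smul_eq_mul, mul_one]

theorem exists_newton (a : ℤ) (d n : ℕ) (f : (ZMod p)[X]) (hd : p ≤ n + d)
    (hf : f.natDegree < p) (hn : phi p a n ∣ f) :
    ∃ c : ℕ → ZMod p, f = ∑ m ∈ Finset.Ico n p, C (c m) * phi p a m := by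
  induction d generalizing n f with
  | zero =>
    refine ⟨0, ?_⟩
    rw [Finset.Ico_eq_empty (by omega), Finset.sum_empty]
    by_contra h0
    have := natDegree_le_of_dvd hn h0
    rw [natDegree_phi] at this
    omega
  | succ d ih =>
    rcases le_or_gt p n with hpn | hpn
    · refine ⟨0, ?_⟩
      rw [Finset.Ico_eq_empty (by omega), Finset.sum_empty]
      by_contra h0
      have := natDegree_le_of_dvd hn h0
      rw [natDegree_phi] at this
      omega
    · obtain ⟨g, hg⟩ := hn
      let t : ZMod p := (n : ZMod p) * ((n : ZMod p) + (a : ZMod p) + 1)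
      obtain ⟨q, hq⟩ : X - C t ∣ g - C (g.eval t) := by
        rw [dvd_iff_isRoot]; simp [IsRoot]
      obtain ⟨c, hc⟩ := ih (n + 1) (f - C (g.eval t) * phi p a n) (by omega) (by
          refine lt_of_le_of_lt (natDegree_sub_le _ _) (max_lt hf ?_)
          exact lt_of_le_of_lt (natDegree_C_mul_le _ _) (by rwa [natDegree_phi])) ⟨q, by
          have h5 : phi p a (n + 1) = phi p a n * (X - C t) := by
            rw [phi, phi, Finset.prod_range_succ]
          rw [h5, mul_assoc, ← hq, hg]
          ring⟩
      refine ⟨Function.update c n (g.eval t), ?_⟩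
      rw [Finset.sum_eq_sum_Ico_succ_bot hpn, Function.update_self, ← sub_eq_iff_eq_add', hc]
      refine Finset.sum_congr rfl fun m hm => ?_
      rw [Function.update_of_ne]
      have := (Finset.mem_Ico.1 hm).1
      omega

theorem psi_ne_zero_and_natDegree_lt (hp2 : p ≠ 2) (ε : ℕ) (s : ZMod p) :
    psi p ε s ≠ 0 ∧ (psi p ε s).natDegree < p := by
  have hpp := hp.out
  have hpos := hpp.pos
  have hdeg : ∀ S : Finset (ZMod p), (∏ i ∈ S, (X - C (i ^ 2))).natDegree = S.card := fun S => by
    rw [natDegree_prod_of_monic _ _ fun _ _ => monic_X_sub_C _]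
    simp only [natDegree_X_sub_C, Finset.sum_const, smul_eq_mul, mul_one]
  have hne : ∀ S : Finset (ZMod p), (∏ i ∈ S, (X - C (i ^ 2))) ≠ 0 := fun S =>
    (monic_prod_of_monic _ _ fun _ _ => monic_X_sub_C _).ne_zero
  have h2 : (2 : ZMod p) ≠ 0 := by
    intro h
    have : ((2 : ℕ) : ZMod p) = 0 := by exact_mod_cast h
    rw [ZMod.natCast_eq_zero_iff] at this
    exact hp2 ((Nat.prime_dvd_prime_iff_eq hpp Nat.prime_two).1 this)
  unfold psi
  split_ifs with h0 hs
  · refine ⟨hne _, ?_⟩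
    rw [hdeg, Finset.card_erase_of_mem (Finset.mem_univ _), Finset.card_univ, ZMod.card]
    omega
  · have h3 : (2 * X * (X + C (s ^ 2)) : (ZMod p)[X]) ≠ 0 := by
      refine mul_ne_zero (mul_ne_zero ?_ X_ne_zero) (X_add_C_ne_zero _)
      rw [← C_ofNat, Ne, C_eq_zero]
      exact h2
    refine ⟨mul_ne_zero h3 (hne _), ?_⟩
    have h4 : (2 * X * (X + C (s ^ 2)) : (ZMod p)[X]).natDegree ≤ 2 := by
      rw [← C_ofNat]
      compute_degree
    have h5 : ({0, s, -s} : Finset (ZMod p)).card = 3 := by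
      rw [Finset.card_eq_three]
      refine ⟨0, s, -s, Ne.symm hs, ?_, ?_, rfl⟩
      · simpa [eq_comm] using hs
      · intro h
        have : (2 : ZMod p) * s = 0 := by linear_combination h
        exact (mul_ne_zero h2 hs) this
    have h6 := Finset.card_le_univ ({0, s, -s} : Finset (ZMod p))
    rw [ZMod.card] at h6
    refine lt_of_le_of_lt natDegree_mul_le ?_
    rw [hdeg, Finset.card_sdiff_of_subset (Finset.subset_univ _), Finset.card_univ, ZMod.card, h5]
    omega
  · have h3 : (X - C (s ^ 2)) ∣ psiFull p := Finset.dvd_prod_of_mem _ (Finset.mem_univ s)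
    have h4 : (X - C (s ^ 2)) * (psiFull p /ₘ (X - C (s ^ 2))) = psiFull p := by
      rw [mul_divByMonic_eq_iff_isRoot, ← dvd_iff_isRoot]
      exact h3
    refine ⟨fun h => hne Finset.univ ?_, ?_⟩
    · rw [h, mul_zero] at h4; exact h4.symm
    · rw [natDegree_divByMonic _ (monic_X_sub_C _), psiFull, hdeg, natDegree_X_sub_C,
        Finset.card_univ, ZMod.card]
      omega

variable (k : Type*) [Field k] [CharP k p]

/-- `B^{(ε)}(a, j)` is `μ_a` times a combination of the `Y ^ m X ^ m` with
`n^{(ε)}(a, j) ≤ m ≤ p - 1`, with coefficients in the prime field. -/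
theorem exists_expansion (ε a : ℕ) (j : ℚ) : ∃ c : ℕ → ZMod p,
    B₁ p k ε a j = mu k p a * ∑ m ∈ Finset.Icc (lowIdx p ε a j) (p - 1),
      ofPrime p k (c m) • (hypY k 1 ^ m * hypX k 1 ^ m) := by
  have hpos := hp.out.pos
  by_cases hp2 : p = 2
  · have h2 : Finset.Icc 0 (p - 1) = {0, 1} := by subst hp2; rfl
    have h3 : Finset.Icc 1 (p - 1) = {1} := by subst hp2; rfl
    unfold B₁ lowIdx
    rw [if_pos hp2, if_pos hp2]
    split_ifs
    · exact ⟨fun m => if m = 0 then 1 else 0, by rw [h2]; simp⟩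
    · exact ⟨1, by rw [h3]; simp [mul_assoc]⟩
    · exact ⟨1, by rw [h3]; simp [mul_assoc]⟩
    · exact ⟨1, by rw [h2]; simp [mul_assoc, mul_add, add_comm]⟩
  · obtain ⟨hne, hdeg⟩ := psi_ne_zero_and_natDegree_lt p hp2 ε (j : ZMod p)
    let t : ZMod p := (((a : ZMod p) + 1) / 2) ^ 2
    let f : (ZMod p)[X] := (psi p ε (j : ZMod p)).comp (X + C t)
    have hf : f.natDegree < p := by
      rw [natDegree_comp, natDegree_X_add_C, mul_one]; exact hdeg
    have hf0 : f ≠ 0 := by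
      intro h
      refine hne ?_
      have : (f.comp (X - C t)) = psi p ε (j : ZMod p) := by
        simp [f, comp_assoc]
      rw [← this, h, zero_comp]
    have hmem : phi p a (lowIdx p ε a j) ∣ f := by
      have h1 : lowIdx p ε a j = sSup {n : ℕ | phi p a n ∣ f} := by
        rw [lowIdx, if_neg hp2]
      rw [h1]
      refine Nat.sSup_mem (s := {n : ℕ | phi p a n ∣ f}) ⟨0, by simp [phi]⟩ ⟨p, fun n hn => ?_⟩
      have := natDegree_le_of_dvd hn hf0
      rw [natDegree_phi] at this
      omega
    obtain ⟨c, hc⟩ := exists_newton p a p _ f (Nat.le_add_left _ _) hf hmem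
    refine ⟨c, ?_⟩
    have h2 : f.map (ofPrime p k) = ((psi p ε (j : ZMod p)).map (ofPrime p k)).comp
        (X + C ((((a : k) + 1) / 2) ^ 2)) := by
      have h0 : ofPrime p k 2 = 2 := map_ofNat (ofPrime p k) 2
      have ht : ofPrime p k t = (((a : k) + 1) / 2) ^ 2 := by simp [t, h0]
      rw [Polynomial.map_comp, Polynomial.map_add, map_X, map_C, ht]
    have h3 := aeval_mul_mu p k hp2 a ((((a : k) + 1) / 2) ^ 2)
      ((psi p ε (j : ZMod p)).map (ofPrime p k))
    rw [B₁, if_neg hp2, h3, ← h2, hc, Polynomial.map_sum, map_sum, Finset.sum_mul, Finset.mul_sum]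
    have h4 : Finset.Ico (lowIdx p ε a j) p = Finset.Icc (lowIdx p ε a j) (p - 1) := by
      ext m; simp only [Finset.mem_Ico, Finset.mem_Icc]; omega
    rw [h4]
    refine Finset.sum_congr rfl fun m _ => ?_
    have h5 : Commute (mu k p a) (aeval (hypYX k) ((phi p a m).map (ofPrime p k))) :=
      semiconj_aeval (commute_mu_hypYX p k a) _
    rw [Polynomial.map_mul, map_mul (aeval (hypYX k)), Polynomial.map_C, aeval_C, mul_assoc,
      ← hypY_pow_mul_hypX_pow_mul_mu, ← Algebra.smul_def, mul_smul_comm]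
    congr 1
    exact (commute_mu_pow p k a m).eq.symm

end Newton

/-! ### The elements `B` for a tuple of pairs -/

section Main

variable (p : ℕ) [Fact p.Prime] (k : Type*) [Field k] [CharP k p]

/-- The coefficients `c_m^{(ε)}` in the expansion
`B^{(ε)}(a, j) = μ_a ∑_m c_m^{(ε)} Y ^ m X ^ m`, where `n^{(ε)}(a, j) ≤ m ≤ p - 1`. They are
determined by the expansion, since the elements `μ_a Y ^ m X ^ m` with `m ≤ p - 1` are linearly
independent. -/
def coeffB (ε a : ℕ) (j : ℚ) : ℕ → ZMod p := Classical.choose (exists_expansion p k ε a j)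

theorem B₁_eq_sum (ε a : ℕ) (j : ℚ) :
    B₁ p k ε a j = mu k p a * ∑ m ∈ Finset.Icc (lowIdx p ε a j) (p - 1),
      ofPrime p k (coeffB p k ε a j m) • (hypY k 1 ^ m * hypX k 1 ^ m) :=
  Classical.choose_spec (exists_expansion p k ε a j)

/-- Condition (A): `a` is even and `(p - a + 1) / 2 ≤ j ≤ (p - 1) / 2`. -/
def CondA (p a : ℕ) (j : ℚ) : Prop :=
  Even a ∧ ((p : ℚ) - a + 1) / 2 ≤ j ∧ j ≤ ((p : ℚ) - 1) / 2

/-- Condition (C): `a` is odd and `0 ≤ j ≤ (a - 1) / 2`. -/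
def CondC (a : ℕ) (j : ℚ) : Prop := Odd a ∧ 0 ≤ j ∧ j ≤ ((a : ℚ) - 1) / 2

/-- The integer `s(a, j)`, which is used under (A) or (C). -/
def shiftExp (p a : ℕ) : ℕ :=
  if p = 2 then 1 else if Even a then (p - a + 1) / 2 else (p - a) / 2

open Classical in
/-- The element `Z^{(ε)}(z; (a, j))`. For odd `p`, the pairs in `𝒫` that satisfy neither (A) nor (C)
are those with `a` even and `0 ≤ j ≤ (p - a - 1) / 2`, or `a` odd and `(a + 1) / 2 ≤ j`. The exponents
`m - s(a, j)` are nonnegative for the pairs in `𝒫`. -/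
def Z (ε a : ℕ) (j : ℚ) (z : U k) : U k :=
  if CondA p a j ∨ CondC a j then
    mu k p a * ∑ m ∈ Finset.Icc (lowIdx p ε a j) (p - 1),
      ofPrime p k (coeffB p k ε a j m) •
        (hypY k 1 ^ m * hypX k 1 ^ (m - shiftExp p a) * frobSplit k p z *
          hypX k 1 ^ shiftExp p a)
  else frobSplit k p z * B₁ p k ε a j

/-- The element `B^{(ε)}(a, j)` for an `r`-tuple `ε` and an `r`-tuple `l` of pairs `(a_i, j_i)`,
where `r ≥ 1`; the value for `r = 0` is a convention that is not used. -/
def B : (r : ℕ) → (Fin r → ℕ) → (Fin r → ℕ × ℚ) → U k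
  | 0, _, _ => 1
  | 1, ε, l => B₁ p k (ε 0) (l 0).1 (l 0).2
  | r + 2, ε, l => Z p k (ε 0) (l 0).1 (l 0).2 (B (r + 1) (Fin.tail ε) (Fin.tail l))

/-- The subset `𝒳_r(a, j)` of `{0, 1}^r`. -/
def XSet (p : ℕ) {r : ℕ} (l : Fin r → ℕ × ℚ) : Set (Fin r → ℕ) :=
  {ε | (∀ i, ε i = 0 ∨ ε i = 1) ∧
    ∀ i, (if p = 2 then (l i).1 = 1 else (l i).2 = 0) → ε i = 0}

end Main

end Hyperalgebra

end

noncomputable section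

namespace Hyperalgebra

/-! ### Integer-valued polynomials in `H` -/

/-! Everything is reduced to polynomials in the single element `YX`. An element `f(H)` of the
hyperalgebra, with `f` integer-valued, depends only on the values of `f` modulo `p`
(`hypPoly_congr`). By Lucas' theorem `μ_a` therefore behaves as the indicator function of the
weights congruent to `a` modulo `p`; it is idempotent, and `H` acts as `a` next to it. Hence `Y^m
X^m μ_a = φ_{a,m}(YX) μ_a`, and since `X^p = 0` the element `f(YX) μ_a` depends only on `f` modulo
`φ_{a,p}`; in degree below `p` it determines `f`.

One pair. Here `B^{(ε)}(a, j) = f(YX) μ_a`, where for odd `p` the polynomial `f` is `ψ_j^{(ε)}`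
translated by `((a+1)/2)²`. Completing the square shows that `φ_{a,p}` is the same translate of `ψ =
x (x^{(p-1)/2} - 1)²`. In `𝔽_p[x]/ψ` the polynomial `ψ_j^{(0)}` is the idempotent that belongs to
the root `j²`, and for `j ≠ 0` the polynomial `ψ_j^{(1)}` is a multiple of that idempotent with
square zero. This gives the product rule for one pair; for `p = 2` it is a direct check.

The maps `Z`. With `s = s(a, j)` under (A) or (C), and `s = 0` otherwise, `Z^{(ε)}(z; (a, j)) = Y^s
Fr'(z) Q(YX) μ_{a+2s} X^s` (`exists_Z_eq_twist`). The elements `Fr'(z)` commute with `YX` and with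
every `μ_b`, and `X^s Y^s μ_{a+2s}` is again a polynomial in `YX` times `μ_{a+2s}`. So the product
of two such elements has the same shape, with `Fr'(z) Fr'(z')` in the middle (`twist_mul_twist`).

The map `Fr'` is not multiplicative in general. It is multiplicative in front of `G = g(YX) μ_b` if
`Y^{(v)} X^{(v)} G = 0` whenever `p - (b mod p) ≤ v < p` (`frobSplit_mul`): in Kostant's formula for
`X^{(rp)} Y^{(tp)}` the terms whose index is not divisible by `p` then vanish on `G`, either by this
condition or by Lucas' theorem. The exponent `s(a, j)` is what makes the condition hold, since it
moves the weight `a` to `a + 2s`, which is `0` or `1` modulo `p` for odd `p`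
(`phi_dvd_phi_mul_redPoly`).

Together these give `Z^{(ε)}(z) Z^{(ε')}(z') = Z^{(ε+ε')}(z z')`, or `0` if `ε = ε' = 1`, and the
theorem follows by induction on `r`. -/

/-- The ring of integer-valued polynomials. -/
def intPoly : Subring ℂ[X] where
  carrier := {f | IntValued f}
  mul_mem' hf hg := IntValued.mul hf hg
  one_mem' z := ⟨1, by simp⟩
  zero_mem' z := ⟨0, by simp⟩
  add_mem' {f g} hf hg z := by
    obtain ⟨u, hu⟩ := hf z
    obtain ⟨v, hv⟩ := hg z
    exact ⟨u + v, by simp [hu, hv]⟩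
  neg_mem' {f} hf z := by
    obtain ⟨u, hu⟩ := hf z
    exact ⟨-u, by simp [hu]⟩

namespace intPoly

/-- The value of an integer-valued polynomial at an integer. -/
def val (f : intPoly) (z : ℤ) : ℤ := Classical.choose (f.2 z)

theorem cast_val (f : intPoly) (z : ℤ) : ((val f z : ℤ) : ℂ) = (f : ℂ[X]).eval (z : ℂ) :=
  (Classical.choose_spec (f.2 z)).symm

theorem val_eq {f : intPoly} {z w : ℤ} (h : (f : ℂ[X]).eval (z : ℂ) = (w : ℂ)) :
    val f z = w := by
  have := cast_val f z
  rw [h] at this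
  exact_mod_cast this

theorem val_mul (f g : intPoly) (z : ℤ) : val (f * g) z = val f z * val g z :=
  val_eq (by simp [cast_val])

theorem val_add (f g : intPoly) (z : ℤ) : val (f + g) z = val f z + val g z :=
  val_eq (by simp [cast_val])

theorem val_sub (f g : intPoly) (z : ℤ) : val (f - g) z = val f z - val g z :=
  val_eq (by simp [cast_val])

theorem val_zero (z : ℤ) : val 0 z = 0 := val_eq (by simp)

theorem val_intCast (n z : ℤ) : val n z = n := val_eq (by simp)

theorem val_sum {ι : Type*} (s : Finset ι) (f : ι → intPoly) (z : ℤ) :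
    val (∑ i ∈ s, f i) z = ∑ i ∈ s, val (f i) z := by
  classical
  induction s using Finset.induction_on with
  | empty => simp [val_zero]
  | insert i s hi ih => rw [Finset.sum_insert hi, Finset.sum_insert hi, val_add, ih]

/-- The integer-valued polynomial `binom(T + c, m)`. -/
def binom (c : ℤ) (m : ℕ) : intPoly := ⟨binomPoly c m, intValued_binomPoly c m⟩

theorem val_binom (c : ℤ) (m : ℕ) (z : ℤ) : val (binom c m) z = Ring.choose (z + c) m :=
  val_eq (binomPoly_eval_int c m z)

/-- The integer-valued polynomial `f(T + c)`. -/
def shift (c : ℤ) (f : intPoly) : intPoly :=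
  ⟨(f : ℂ[X]).comp (X + C (c : ℂ)), IntValued.shift f.2 c⟩

theorem val_shift (c : ℤ) (f : intPoly) (z : ℤ) : val (shift c f) z = val f (z + c) :=
  val_eq (by simp [shift, cast_val])

theorem exists_eq_sum (f : intPoly) : ∃ (d : ℕ) (c : ℕ → ℤ),
    f = ∑ n ∈ Finset.range (d + 1), (c n : intPoly) * binom 0 n := by
  obtain ⟨c, hc⟩ := IntValued.exists_sum f.2 le_rfl
  refine ⟨(f : ℂ[X]).natDegree, c, Subtype.ext (hc.trans ?_)⟩
  push_cast
  exact Finset.sum_congr rfl fun n _ => by simp [binom]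

/-- The values at the natural numbers and the coefficients in the binomial basis are related by a
unitriangular integral matrix, so divisibility passes from the values to the coefficients. Testing
only large arguments is enough because translation is invertible; this keeps later arguments
nonnegative, where Lucas' theorem is available. -/
theorem exists_eq_mul {p : ℤ} (f : intPoly) (N : ℕ)
    (h : ∀ n : ℕ, N ≤ n → p ∣ val f n) : ∃ g : intPoly, f = (p : intPoly) * g := by
  obtain ⟨d, c, hc⟩ := exists_eq_sum (shift N f)
  have h1 : ∀ n : ℕ, p ∣ ∑ i ∈ Finset.range (d + 1), c i * (n.choose i : ℤ) := by
    intro n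
    have h2 := congrArg (fun f => val f n) hc
    simp only [val_sum, val_shift, val_mul, val_intCast, val_binom, add_zero,
      Ring.choose_natCast] at h2
    rw [← h2]
    exact_mod_cast h (n + N) (Nat.le_add_left _ _)
  have h3 : ∀ n, n < d + 1 → p ∣ c n := by
    intro n
    induction n using Nat.strong_induction_on with
    | _ n ih =>
      intro hn
      have h4 := h1 n
      -- In the value at `n` the terms with `i < n` are divisible by induction, those with `i > n`
      -- vanish, and the term `i = n` is `c n` itself.
      rw [← Finset.add_sum_erase _ _ (Finset.mem_range.2 hn), Nat.choose_self] at h4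
      rw [Nat.cast_one, mul_one] at h4
      refine (dvd_add_left (Finset.dvd_sum fun i hi => ?_)).1 h4
      obtain ⟨hi1, hi2⟩ := Finset.mem_erase.1 hi
      rcases lt_or_gt_of_ne hi1 with h5 | h5
      · exact (ih i h5 (Finset.mem_range.1 hi2)).mul_right _
      · simp [Nat.choose_eq_zero_of_lt h5]
  choose! e he using h3
  refine ⟨shift (-N) (∑ n ∈ Finset.range (d + 1), (e n : intPoly) * binom 0 n), ?_⟩
  have h6 : shift N f = (p : intPoly) * ∑ n ∈ Finset.range (d + 1), (e n : intPoly) * binom 0 n := by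
    rw [hc, Finset.mul_sum]
    refine Finset.sum_congr rfl fun n hn => ?_
    rw [he n (Finset.mem_range.1 hn)]
    push_cast
    ring
  have h7 := congrArg (fun g : intPoly => ((shift (-N) g : intPoly) : ℂ[X])) h6
  apply Subtype.ext
  simpa [shift, comp_assoc] using h7

theorem choose_modEq (p : ℕ) [Fact p.Prime] {z : ℤ} (hz : 0 ≤ z) (m : ℕ) :
    ((Ring.choose z m : ℤ) : ZMod p) =
      (Ring.choose (z % p) (m % p) : ℤ) * (Ring.choose (z / p) (m / p) : ℤ) := by
  lift z to ℕ using hz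
  have h := Choose.choose_modEq_choose_mod_mul_choose_div (n := z) (k := m) (p := p)
  rw [← ZMod.intCast_eq_intCast_iff] at h
  rw [Ring.choose_natCast, ← Int.natCast_mod, ← Int.natCast_ediv, Ring.choose_natCast,
    Ring.choose_natCast]
  exact_mod_cast h

end intPoly

/-! ### Divided powers and functions of `H` in the hyperalgebra -/

section

variable (k : Type*) [Field k]

/-- The map from integer-valued polynomials `f` to the elements `f(H)` of the hyperalgebra. -/
def hypPoly : intPoly →+* U k :=
  (toU k : UZ →+* U k).comp
    (((aeval genH : ℂ[X] →ₐ[ℂ] UC) : ℂ[X] →+* UC).comp intPoly.subtype |>.codRestrict UZ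
      fun f => aeval_genH_mem f.2)

theorem hypPoly_binom (c : ℤ) (m : ℕ) : hypPoly k (intPoly.binom c m) = hypH k c m := rfl

theorem hypX_zero : hypX k 0 = 1 := by
  have : intX 0 = 1 := Subtype.ext (divPow_zero _)
  rw [hypX, this, map_one]

theorem hypY_zero : hypY k 0 = 1 := by
  have : intY 0 = 1 := Subtype.ext (divPow_zero _)
  rw [hypY, this, map_one]

theorem hypX_mul (m n : ℕ) : hypX k m * hypX k n = ((m + n).choose m : U k) * hypX k (m + n) := by
  have : intX m * intX n = ((m + n).choose m : UZ) * intX (m + n) := by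
    apply Subtype.ext
    have := divPow_mul genX m n
    simpa [intX] using this
  rw [hypX, hypX, ← map_mul, this, map_mul, map_natCast, hypX]

theorem hypY_mul (m n : ℕ) : hypY k m * hypY k n = ((m + n).choose m : U k) * hypY k (m + n) := by
  have : intY m * intY n = ((m + n).choose m : UZ) * intY (m + n) := by
    apply Subtype.ext
    have := divPow_mul genY m n
    simpa [intY] using this
  rw [hypY, hypY, ← map_mul, this, map_mul, map_natCast, hypY]

theorem hypX_one_pow (m : ℕ) : hypX k 1 ^ m = (m.factorial : U k) * hypX k m := by
  induction m with
  | zero => simp [hypX_zero]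
  | succ m ih =>
    rw [pow_succ, ih, mul_assoc, hypX_mul, Nat.choose_symm_add, Nat.choose_one_right, ← mul_assoc,
      Nat.factorial_succ, mul_comm (m + 1), Nat.cast_mul]

theorem hypY_one_pow (m : ℕ) : hypY k 1 ^ m = (m.factorial : U k) * hypY k m := by
  induction m with
  | zero => simp [hypY_zero]
  | succ m ih =>
    rw [pow_succ, ih, mul_assoc, hypY_mul, Nat.choose_symm_add, Nat.choose_one_right, ← mul_assoc,
      Nat.factorial_succ, mul_comm (m + 1), Nat.cast_mul]

theorem hypX_mul_hypPoly (m : ℕ) (f : intPoly) :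
    hypX k m * hypPoly k f = hypPoly k (intPoly.shift (-2 * m) f) * hypX k m := by
  simp only [hypX, hypPoly, RingHom.comp_apply, RingHom.coe_coe]
  rw [← map_mul, ← map_mul]
  congr 1
  apply Subtype.ext
  change divPow genX m * aeval genH (f : ℂ[X]) =
    aeval genH ((f : ℂ[X]).comp (X + C ((-2 * m : ℤ) : ℂ))) * divPow genX m
  have := divPowInt_mul_aeval genX_mul_genH m (f : ℂ[X])
  rw [divPowInt_natCast] at this
  push_cast at this ⊢
  exact this

theorem hypY_mul_hypPoly (m : ℕ) (f : intPoly) :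
    hypY k m * hypPoly k f = hypPoly k (intPoly.shift (2 * m) f) * hypY k m := by
  simp only [hypY, hypPoly, RingHom.comp_apply, RingHom.coe_coe]
  rw [← map_mul, ← map_mul]
  congr 1
  apply Subtype.ext
  change divPow genY m * aeval genH (f : ℂ[X]) =
    aeval genH ((f : ℂ[X]).comp (X + C ((2 * m : ℤ) : ℂ))) * divPow genY m
  have := divPowInt_mul_aeval genY_mul_genH m (f : ℂ[X])
  rw [divPowInt_natCast] at this
  push_cast at this ⊢
  exact this

/-- Kostant's formula after base change. The test `i ≤ s` replaces the convention that divided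
powers with negative exponent are zero. -/
theorem hypX_mul_hypY (r s : ℕ) : hypX k r * hypY k s =
    ∑ i ∈ Finset.range (r + 1), if i ≤ s then
      hypY k (s - i) * hypPoly k (intPoly.binom (2 * i - r - s) i) * hypX k (r - i) else 0 := by
  have h : intX r * intY s = ∑ i ∈ Finset.range (r + 1), if i ≤ s then
      intY (s - i) * intH (2 * i - r - s) i * intX (r - i) else 0 := by
    apply Subtype.ext
    have := divPow_mul_divPow genX_mul_genH genY_mul_genH genX_mul_genY r s
    rw [divPowInt_natCast, divPowInt_natCast] at this
    push_cast
    refine this.trans (Finset.sum_congr rfl fun i hi => ?_)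
    have hi' : i ≤ r := by simpa [Nat.lt_succ_iff] using hi
    split_ifs with his
    · rw [← Nat.cast_sub his, ← Nat.cast_sub hi', divPowInt_natCast, divPowInt_natCast]
      rfl
    · rw [divPowInt_of_neg _ (by omega), zero_mul, zero_mul]
      rfl
  rw [hypX, hypY, ← map_mul, h, map_sum]
  refine Finset.sum_congr rfl fun i _ => ?_
  split_ifs
  · rw [map_mul, map_mul]; rfl
  · exact map_zero _

variable (p : ℕ) [Fact p.Prime] [CharP k p]

theorem natCast_U_eq_one {n : ℕ} (h : (n : ZMod p) = 1) : (n : U k) = 1 := by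
  rw [← map_natCast (algebraMap k (U k)), ← map_natCast (ofPrime p k), h, map_one, map_one]

theorem natCast_U_congr {m n : ℕ} (h : (m : ZMod p) = n) : (m : U k) = n := by
  rw [← map_natCast (algebraMap k (U k)), ← map_natCast (algebraMap k (U k)),
    ← map_natCast (ofPrime p k), ← map_natCast (ofPrime p k), h]

/-- The element `f(H)` only depends on the values of `f` modulo `p` at large natural numbers. -/
theorem hypPoly_congr {f g : intPoly} (N : ℕ)
    (h : ∀ n : ℕ, N ≤ n → (intPoly.val f n : ZMod p) = intPoly.val g n) : hypPoly k f = hypPoly k g := by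
  rw [← sub_eq_zero, ← map_sub]
  obtain ⟨e, he⟩ := intPoly.exists_eq_mul (p := (p : ℤ)) (f - g) N fun n hn => by
    rw [← ZMod.intCast_zmod_eq_zero_iff_dvd, intPoly.val_sub, Int.cast_sub, h n hn, sub_self]
  rw [he, map_mul, map_intCast, Int.cast_natCast, natCast_U_eq_zero, zero_mul]

/-- By Lucas' theorem `binom(n, ip)` and `binom(⌊n/p⌋, i)` agree modulo `p`. So on functions of `H`
the map `Fr'` is the substitution of `⌊H/p⌋` for `H`, which frees its definition from the choice of
basis elements `binom(H, n)`. -/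
theorem frobSplit_hypPoly (f F : intPoly) (N m l : ℕ)
    (h : ∀ n : ℕ, N ≤ n → (intPoly.val F n : ZMod p) = intPoly.val f ((n : ℤ) / p)) :
    frobSplit k p (hypY k m * hypPoly k f * hypX k l) =
      hypY k (m * p) * hypPoly k F * hypX k (l * p) := by
  have hp := (Fact.out : p.Prime)
  obtain ⟨d, c, hc⟩ := intPoly.exists_eq_sum f
  have h1 : hypPoly k F = hypPoly k (∑ n ∈ Finset.range (d + 1),
      (c n : intPoly) * intPoly.binom 0 (n * p)) := by
    refine hypPoly_congr k p N fun n hn => ?_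
    rw [h n hn, hc]
    simp only [intPoly.val_sum, intPoly.val_mul, intPoly.val_intCast, intPoly.val_binom, add_zero,
      Int.cast_sum, Int.cast_mul]
    refine Finset.sum_congr rfl fun i _ => ?_
    rw [intPoly.choose_modEq p (Int.natCast_nonneg n)]
    simp [hp.pos]
  rw [h1, hc]
  simp only [map_sum, map_mul, map_intCast, hypPoly_binom, Finset.mul_sum, Finset.sum_mul]
  refine Finset.sum_congr rfl fun i _ => ?_
  have h2 : ∀ u v w : U k, u * ((c i : U k) * v) * w = (c i : k) • (u * v * w) := fun u v w => by
    rw [← map_intCast (algebraMap k (U k)), ← Algebra.smul_def, mul_smul_comm, smul_mul_assoc]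
  rw [h2, h2, map_smul]
  exact congrArg _ (frobSplit_hypMono k p m i l)

end

end Hyperalgebra

end

/-! ### Weights, the idempotents `μ_a`, and what commutes with the image of `Fr'` -/

noncomputable section

namespace Hyperalgebra

namespace intPoly

theorem shift_shift (c d : ℤ) (f : intPoly) : shift c (shift d f) = shift (c + d) f := by
  apply Subtype.ext
  simp only [shift, comp_assoc]
  congr 1
  simp only [add_comp, X_comp, C_comp]
  push_cast
  simp only [C_add]
  ring

theorem shift_zero (f : intPoly) : shift 0 f = f := by
  apply Subtype.ext
  simp [shift]

theorem shift_binom (c d : ℤ) (m : ℕ) : shift c (binom d m) = binom (d + c) m :=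
  Subtype.ext (binomPoly_comp d c m)

end intPoly

open intPoly

section

variable (k : Type*) [Field k]

theorem hypPoly_commute (f g : intPoly) : Commute (hypPoly k f) (hypPoly k g) := by
  rw [Commute, SemiconjBy, ← map_mul, ← map_mul, mul_comm]

theorem hypYX_commute_hypPoly (f : intPoly) : Commute (hypYX k) (hypPoly k f) := by
  rw [Commute, SemiconjBy, hypYX, mul_assoc, hypX_mul_hypPoly, ← mul_assoc, hypY_mul_hypPoly,
    shift_shift, mul_assoc]
  simp [shift_zero]

/-- The factor `n` in the error term is the point: it vanishes for multiples of `p`, so `X^{(mp)}`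
commutes with `YX`. -/
theorem hypX_mul_hypYX (n : ℕ) : hypX k n * hypYX k =
    hypYX k * hypX k n + (n : U k) * hypPoly k (binom (1 - n) 1) * hypX k n := by
  rcases n with _ | n
  · simp [hypX_zero]
  · have h := hypX_mul_hypY k (n + 1) 1
    -- Only the terms `i = 0, 1` of Kostant's formula survive, since the exponent of `Y` is `1`.
    rw [← Finset.sum_subset (Finset.range_mono (show 2 ≤ n + 1 + 1 by omega))
      (fun i _ hi => if_neg fun h => hi (Finset.mem_range.2 (by omega)))] at h
    rw [Finset.sum_range_succ, Finset.sum_range_one] at h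
    have h0 : ∀ c, binom c 0 = 1 := fun c => Subtype.ext (binomPoly_zero c)
    simp only [h0, map_one, mul_one, hypY_zero, one_mul, if_pos, Nat.zero_le, le_refl,
      Nat.sub_zero, Nat.sub_self, Nat.add_sub_cancel] at h
    have h1 : hypX k n * hypX k 1 = ((n + 1 : ℕ) : U k) * hypX k (n + 1) := by
      rw [hypX_mul, Nat.choose_symm_add, Nat.choose_one_right]
    have h2 : hypX k 1 * hypX k (n + 1) = hypX k (n + 1) * hypX k 1 := by
      rw [hypX_mul, hypX_mul, Nat.choose_symm_add, add_comm 1]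
    rw [hypYX, ← mul_assoc, h, add_mul, mul_assoc, mul_assoc, mul_assoc, h1, h2, ← mul_assoc,
      ← mul_assoc, (Nat.cast_commute (n + 1) (hypPoly k _)).eq]
    congr 5
    push_cast; ring

theorem hypYX_mul_hypY (n : ℕ) : hypYX k * hypY k n =
    hypY k n * hypYX k + (n : U k) * hypY k n * hypPoly k (binom (1 - n) 1) := by
  rcases n with _ | n
  · simp [hypY_zero]
  · have h := hypX_mul_hypY k 1 (n + 1)
    rw [Finset.sum_range_succ, Finset.sum_range_one] at h
    have h0 : ∀ c, binom c 0 = 1 := fun c => Subtype.ext (binomPoly_zero c)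
    simp only [h0, map_one, mul_one, hypX_zero, if_pos, Nat.zero_le, le_add_iff_nonneg_left,
      Nat.sub_zero, Nat.sub_self, Nat.add_sub_cancel] at h
    have h1 : hypY k 1 * hypY k n = ((n + 1 : ℕ) : U k) * hypY k (n + 1) := by
      rw [hypY_mul, add_comm 1, Nat.choose_one_right]
    have h2 : hypY k 1 * hypY k (n + 1) = hypY k (n + 1) * hypY k 1 := by
      rw [hypY_mul, hypY_mul, Nat.choose_symm_add, add_comm 1]
    rw [hypYX, mul_assoc, h, mul_add, ← mul_assoc, ← mul_assoc, ← mul_assoc, h1, h2]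
    congr 5

theorem natCast_smul_U (n : ℕ) (u : U k) : (n : k) • u = (n : U k) * u := by
  rw [Nat.cast_smul_eq_nsmul, nsmul_eq_mul]

/-- The hyperalgebra is generated by the divided powers of `X` and of `Y`. -/
theorem U_induction {P : U k → Prop} (one : P 1) (add : ∀ u v, P u → P v → P (u + v))
    (smul : ∀ (c : k) u, P u → P (c • u)) (mul : ∀ u v, P u → P v → P (u * v))
    (hypX : ∀ m, P (hypX k m)) (hypY : ∀ m, P (hypY k m)) (u : U k) : P u := by
  have zero : P 0 := by simpa using smul 0 1 one
  have key : ∀ (w : UC) (hw : w ∈ UZ), P (toU k ⟨w, hw⟩) := by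
    intro w hw
    induction hw using Subring.closure_induction with
    | mem w h =>
      rcases h with ⟨m, rfl⟩ | ⟨m, rfl⟩
      · exact hypX m
      · exact hypY m
    | zero => exact (map_zero (toU k)).symm ▸ zero
    | one => exact (map_one (toU k)).symm ▸ one
    | add a b ha hb iha ihb => exact (map_add (toU k) ⟨a, ha⟩ ⟨b, hb⟩).symm ▸ add _ _ iha ihb
    | neg a ha iha =>
      have : toU k ⟨-a, neg_mem ha⟩ = (-1 : k) • toU k ⟨a, ha⟩ := by
        rw [neg_one_smul, ← map_neg]; rfl
      exact this ▸ smul _ _ iha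
    | mul a b ha hb iha ihb => exact (map_mul (toU k) ⟨a, ha⟩ ⟨b, hb⟩).symm ▸ mul _ _ iha ihb
  induction u using TensorProduct.induction_on with
  | zero => exact zero
  | tmul c w =>
    have : c ⊗ₜ[ℤ] w = c • toU k w := by
      rw [toU, Algebra.TensorProduct.includeRight_apply, TensorProduct.smul_tmul', smul_eq_mul,
        mul_one]
    exact this ▸ smul c _ (key w.1 w.2)
  | add u v hu hv => exact add u v hu hv

variable (p : ℕ)

theorem mu_eq_hypPoly (a : ℤ) : mu k p a = hypPoly k (binom (-a - 1) (p - 1)) := rfl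

theorem mu_commute_hypPoly (a : ℤ) (f : intPoly) : Commute (mu k p a) (hypPoly k f) := by
  rw [mu_eq_hypPoly]
  exact hypPoly_commute k _ f

theorem hypX_mul_mu (m : ℕ) (a : ℤ) : hypX k m * mu k p a = mu k p (a + 2 * m) * hypX k m := by
  rw [mu_eq_hypPoly, hypX_mul_hypPoly, shift_binom, mu_eq_hypPoly]
  congr 3
  ring

theorem hypY_mul_mu (m : ℕ) (a : ℤ) : hypY k m * mu k p (a + 2 * m) = mu k p a * hypY k m := by
  rw [mu_eq_hypPoly, hypY_mul_hypPoly, shift_binom, mu_eq_hypPoly]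
  congr 3
  ring

theorem frobSplit_commute {u : U k} (hX : ∀ m, Commute (hypX k (m * p)) u)
    (hY : ∀ m, Commute (hypY k (m * p)) u) (hH : ∀ f, Commute (hypPoly k f) u) (z : U k) :
    Commute (frobSplit k p z) u := by
  have h : (LinearMap.mulRight k u).comp (frobSplit k p) =
      (LinearMap.mulLeft k u).comp (frobSplit k p) := by
    refine (hypBasis k).ext fun ⟨m, n, l⟩ => ?_
    rw [LinearMap.comp_apply, LinearMap.comp_apply, hypBasis_apply, frobSplit_hypMono]
    exact ((hY m).mul_left (hH (binom 0 (n * p)))).mul_left (hX l)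
  exact LinearMap.congr_fun h z

theorem frobSplit_hypX (m : ℕ) : frobSplit k p (hypX k m) = hypX k (m * p) := by
  have h0 : ∀ c, hypH k c 0 = 1 := fun c => by
    rw [← hypPoly_binom, show binom c 0 = 1 from Subtype.ext (binomPoly_zero c), map_one]
  simpa [hypMono, hypY_zero, h0] using frobSplit_hypMono k p 0 0 m

theorem frobSplit_hypY (m : ℕ) : frobSplit k p (hypY k m) = hypY k (m * p) := by
  have h0 : ∀ c, hypH k c 0 = 1 := fun c => by
    rw [← hypPoly_binom, show binom c 0 = 1 from Subtype.ext (binomPoly_zero c), map_one]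
  simpa [hypMono, hypX_zero, h0] using frobSplit_hypMono k p m 0 0

theorem frobSplit_one : frobSplit k p 1 = 1 := by
  simpa [hypX_zero] using frobSplit_hypX k p 0

variable [CharP k p]

theorem hypX_commute_hypYX (m : ℕ) : Commute (hypX k (m * p)) (hypYX k) := by
  rw [Commute, SemiconjBy, hypX_mul_hypYX, Nat.cast_mul, natCast_U_eq_zero p, mul_zero, zero_mul,
    zero_mul, add_zero]

theorem hypY_commute_hypYX (m : ℕ) : Commute (hypY k (m * p)) (hypYX k) := by
  rw [Commute, SemiconjBy, hypYX_mul_hypY, Nat.cast_mul, natCast_U_eq_zero p, mul_zero, zero_mul,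
    zero_mul, add_zero]

theorem frobSplit_commute_hypYX (z : U k) : Commute (frobSplit k p z) (hypYX k) :=
  frobSplit_commute k p (fun m => hypX_commute_hypYX k p m) (fun m => hypY_commute_hypYX k p m)
    (fun f => (hypYX_commute_hypPoly k f).symm) z

variable [Fact p.Prime]

/-- Since `p - 1` is a single base-`p` digit, Lucas' theorem leaves `binom(t, p - 1)` with `t` the
residue of `n - a - 1`; this is nonzero only for `t = p - 1`, that is for `n ≡ a`. The bound `a < n`
makes the upper argument nonnegative. -/
theorem val_mu_binom (a : ℤ) {n : ℕ} (hn : a < n) :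
    (val (binom (-a - 1) (p - 1)) n : ZMod p) = if (n : ZMod p) = a then 1 else 0 := by
  have hp := (Fact.out : p.Prime)
  rw [val_binom, choose_modEq p (by omega), Nat.mod_eq_of_lt (Nat.sub_lt hp.pos one_pos),
    Nat.div_eq_of_lt (Nat.sub_lt hp.pos one_pos), Ring.choose_zero_right, Int.cast_one, mul_one]
  have h1 : ((n : ZMod p) = a) ↔ ((n : ℤ) + (-a - 1)) % p = p - 1 := by
    have h2 : ((n : ZMod p) = a) ↔ (p : ℤ) ∣ (n + (-a - 1)) - (p - 1) := by
      rw [← ZMod.intCast_zmod_eq_zero_iff_dvd]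
      push_cast
      rw [CharP.cast_eq_zero (ZMod p) p, ← sub_eq_zero]
      ring_nf
    rw [h2, ← Int.emod_emod_of_dvd _ (dvd_refl (p : ℤ)), ← Int.emod_eq_emod_iff_emod_sub_eq_zero.trans
      (Int.dvd_iff_emod_eq_zero).symm]
    rw [Int.emod_emod_of_dvd _ (dvd_refl (p : ℤ)), Int.emod_eq_of_lt (a := (p : ℤ) - 1)]
    · have := hp.pos; omega
    · omega
  have h3 := Int.emod_nonneg ((n : ℤ) + (-a - 1)) (b := p) (by exact_mod_cast hp.ne_zero)
  have h4 := Int.emod_lt_of_pos ((n : ℤ) + (-a - 1)) (b := p) (by exact_mod_cast hp.pos)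
  split_ifs with h
  · rw [h1.1 h, ← Nat.cast_pred hp.pos, Ring.choose_natCast, Nat.choose_self]
    simp
  · have h5 := mt h1.2 h
    lift ((n : ℤ) + (-a - 1)) % p to ℕ using h3 with t
    rw [Ring.choose_natCast, Nat.choose_eq_zero_of_lt (by omega)]
    simp

/-- Multiplication by `μ_a` kills all values outside the residue class of `a`, so only that class
has to be compared. -/
theorem hypPoly_mul_mu_congr {f g : intPoly} (a : ℤ) (N : ℕ)
    (h : ∀ n : ℕ, N ≤ n → (n : ZMod p) = a → (val f n : ZMod p) = val g n) :
    hypPoly k f * mu k p a = hypPoly k g * mu k p a := by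
  rw [mu_eq_hypPoly, ← map_mul, ← map_mul]
  refine hypPoly_congr k p (max N (a.toNat + 1)) fun n hn => ?_
  rw [val_mul, val_mul, Int.cast_mul, Int.cast_mul, val_mu_binom p a (by omega)]
  split_ifs with h1
  · rw [h n (by omega) h1]
  · simp

theorem mu_congr {a b : ℤ} (h : (a : ZMod p) = b) : mu k p a = mu k p b := by
  rw [mu_eq_hypPoly, mu_eq_hypPoly]
  refine hypPoly_congr k p (max (a.toNat + 1) (b.toNat + 1)) fun n hn => ?_
  rw [val_mu_binom p a (by omega), val_mu_binom p b (by omega), h]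

theorem mu_mul_self (a : ℤ) : mu k p a * mu k p a = mu k p a := by
  have := hypPoly_mul_mu_congr k p (f := binom (-a - 1) (p - 1)) (g := 1) a (a.toNat + 1)
    fun n hn h => by
      rw [val_mu_binom p a (by omega), if_pos h]
      have := val_intCast 1 n
      rw [Int.cast_one] at this
      rw [this, Int.cast_one]
  rwa [map_one, one_mul] at this

theorem hypX_commute_mu (m : ℕ) (a : ℤ) : Commute (hypX k (m * p)) (mu k p a) := by
  rw [Commute, SemiconjBy, hypX_mul_mu, mu_congr k p (b := a)]
  simp

theorem hypY_commute_mu (m : ℕ) (a : ℤ) : Commute (hypY k (m * p)) (mu k p a) := by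
  rw [Commute, SemiconjBy, ← hypY_mul_mu, mu_congr k p (a := a + _) (b := a)]
  simp

theorem frobSplit_commute_mu (a : ℤ) (z : U k) : Commute (frobSplit k p z) (mu k p a) :=
  frobSplit_commute k p (fun m => hypX_commute_mu k p m a) (fun m => hypY_commute_mu k p m a)
    (fun f => (mu_commute_hypPoly k p a f).symm) z

/-! ### Lucas' theorem and the multiplicativity of `Fr'` -/

theorem choose_mul_add (u v : ℕ) (hv : v < p) : ((u * p + v).choose v : U k) = 1 := by
  refine natCast_U_eq_one k p ?_
  have h := Choose.choose_modEq_choose_mod_mul_choose_div_nat (n := u * p + v) (k := v) (p := p)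
  rw [← ZMod.natCast_eq_natCast_iff] at h
  rw [h]
  simp [Nat.mod_eq_of_lt hv, Nat.div_eq_of_lt hv, Nat.add_mod]

theorem choose_mul_mul (m n : ℕ) : ((m * p).choose (n * p) : U k) = (m.choose n : U k) := by
  refine natCast_U_congr k p ?_
  have h := Choose.choose_modEq_choose_mod_mul_choose_div_nat (n := m * p) (k := n * p) (p := p)
  rw [← ZMod.natCast_eq_natCast_iff] at h
  rw [h]
  simp [(Fact.out : p.Prime).pos]

theorem hypX_mul_of_lt (u v : ℕ) (hv : v < p) :
    hypX k v * hypX k (u * p) = hypX k (u * p + v) := by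
  rw [hypX_mul, add_comm, choose_mul_add k p u v hv, one_mul]

theorem hypY_mul_of_lt (u v : ℕ) (hv : v < p) :
    hypY k (u * p) * hypY k v = hypY k (u * p + v) := by
  rw [hypY_mul, Nat.choose_symm_add, choose_mul_add k p u v hv, one_mul]

theorem hypX_mul_mul (m n : ℕ) :
    hypX k (m * p) * hypX k (n * p) = ((m + n).choose m : U k) * hypX k ((m + n) * p) := by
  rw [hypX_mul, ← add_mul, choose_mul_mul]

theorem hypY_mul_mul (m n : ℕ) :
    hypY k (m * p) * hypY k (n * p) = ((m + n).choose m : U k) * hypY k ((m + n) * p) := by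
  rw [hypY_mul, ← add_mul, choose_mul_mul]

/-- Next to `μ_b` the last digit of `H + c` is `b % p`, which is smaller than the last digit of `j`,
so Lucas' theorem gives a zero factor. -/
theorem hypPoly_binom_mul_mu_eq_zero (b : ℕ) (c : ℤ) (j : ℕ) (hj : b % p < j % p)
    (hc : (c : ZMod p) = 0) : hypPoly k (binom c j) * mu k p b = 0 := by
  have := hypPoly_mul_mu_congr k p (f := binom c j) (g := 0) b (c.natAbs)
    fun n hn h => by
      rw [val_zero, val_binom, choose_modEq p (by omega)]
      have h1 : ((n : ℤ) + c) % p = ((b % p : ℕ) : ℤ) := by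
        rw [Int.natCast_mod]
        refine (ZMod.intCast_eq_intCast_iff' _ _ p).1 ?_
        push_cast at h ⊢
        rw [h, hc, add_zero]
      rw [h1, Ring.choose_natCast, Nat.choose_eq_zero_of_lt hj]
      simp
  rwa [map_zero, zero_mul] at this

/-- This is the vanishing of the terms of Kostant's formula whose index `j` is prime to `p`. With `v
= p - j % p`, each of them contains `Y^{(v)} binom(H + c, j) X^{(v)} G`. For `v ≥ p - b % p` this is
zero by the assumption on `G`; for smaller `v` one has `j % p > b % p`, and the binomial factor
vanishes on the weights congruent to `b`. -/
theorem hypY_mul_hypPoly_mul_hypX_mul_eq_zero {G : U k} (b : ℕ) (hμ : mu k p b * G = G)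
    (hG : ∀ v, p - b % p ≤ v → v < p → hypY k v * hypX k v * G = 0)
    (hX : ∀ m, Commute (hypX k (m * p)) G) (c : ℤ) (j u u' v : ℕ) (hvp : v < p)
    (hj : j % p + v = p) (hc : (c : ZMod p) = 2 * j) :
    hypY k (u * p + v) * hypPoly k (binom c j) * hypX k (u' * p + v) * G = 0 := by
  -- The parts `Y^{(up)}` and `X^{(u'p)}` split off on the outside; the second one has to be moved
  -- past `G`.
  suffices h : hypY k v * hypPoly k (binom c j) * hypX k v * G = 0 by
    rw [← hypY_mul_of_lt k p u v hvp, ← hypX_mul_of_lt k p u' v hvp]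
    calc _ = hypY k (u * p) * (hypY k v * hypPoly k (binom c j) * hypX k v *
          (hypX k (u' * p) * G)) := by simp only [mul_assoc]
      _ = hypY k (u * p) * (hypY k v * hypPoly k (binom c j) * hypX k v * G *
          hypX k (u' * p)) := by rw [(hX u').eq]; simp only [mul_assoc]
      _ = 0 := by rw [h, zero_mul, mul_zero]
  rw [hypY_mul_hypPoly, shift_binom, mul_assoc, mul_assoc, ← mul_assoc (hypY k v)]
  rcases le_or_gt (p - b % p) v with h | h
  · rw [hG v h hvp, mul_zero]
  -- The element `Y^{(v)} X^{(v)}` preserves weights, so the weight `b` of `G` can be read off in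
  -- front. The binomial, moved to the left of `Y^{(v)}`, has the shift `c + 2v`, which is `2j - 2j
  -- = 0` modulo `p`.
  · have h1 : hypY k v * hypX k v * G = mu k p b * (hypY k v * hypX k v * G) := by
      conv_lhs => rw [← hμ]
      rw [← mul_assoc, mul_assoc (hypY k v), hypX_mul_mu, ← mul_assoc, hypY_mul_mu, mul_assoc,
        mul_assoc]
      simp only [mul_assoc]
    rw [h1, ← mul_assoc, hypPoly_binom_mul_mu_eq_zero k p, zero_mul]
    · omega
    · have h2 : ((v : ℕ) : ZMod p) = -j := by
        have := congrArg (Nat.cast : ℕ → ZMod p) hj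
        rw [Nat.cast_add, ZMod.natCast_mod, CharP.cast_eq_zero (ZMod p) p] at this
        linear_combination this
      push_cast
      rw [hc, h2]
      ring

theorem exists_mul_sub_eq {p j s : ℕ} (hj : j ≤ s * p) (h : 0 < j % p) :
    ∃ u, s * p - j = u * p + (p - j % p) := by
  have hp : 0 < p := Nat.pos_of_ne_zero fun h0 => by subst h0; simp at hj; simp [hj] at h
  have h1 := Nat.mod_lt j hp
  have h2 := Nat.div_add_mod' j p
  have h3 : j / p < s := by
    by_contra h4
    have := Nat.mul_le_mul_right p (not_lt.1 h4)
    omega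
  obtain ⟨d, rfl⟩ := Nat.exists_eq_add_of_lt h3
  refine ⟨d, ?_⟩
  have : (j / p + d + 1) * p = j / p * p + d * p + p := by ring
  omega

/-- On `G` only the terms of Kostant's formula with index divisible by `p` remain, and these match,
term by term, the image under `Fr'` of the formula for `X^{(r)} Y^{(s)}`. -/
theorem hypX_mul_hypY_mul {G : U k} (b : ℕ) (hμ : mu k p b * G = G)
    (hG : ∀ v, p - b % p ≤ v → v < p → hypY k v * hypX k v * G = 0)
    (hX : ∀ m, Commute (hypX k (m * p)) G) (r s : ℕ) :
    hypX k (r * p) * hypY k (s * p) * G = (∑ i ∈ Finset.range (r + 1), if i ≤ s then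
      hypY k ((s - i) * p) * hypPoly k (binom (2 * ((i * p : ℕ) : ℤ) - (r * p : ℕ) - (s * p : ℕ))
        (i * p)) * hypX k ((r - i) * p) else 0) * G := by
  have hp := (Fact.out : p.Prime)
  rw [hypX_mul_hypY, Finset.sum_mul, Finset.sum_mul]
  refine (Finset.sum_of_injOn (fun i => i * p) ?_ ?_ ?_ ?_).symm
  · exact fun i _ j _ h => Nat.eq_of_mul_eq_mul_right hp.pos h
  · intro i hi
    simp only [Finset.coe_range, Set.mem_Iio] at hi ⊢
    have := Nat.mul_le_mul_right p (Nat.lt_succ_iff.1 hi)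
    omega
  · intro j hj hj'
    split_ifs with hjs
    · have hjr : j ≤ r * p := by simpa [Nat.lt_succ_iff] using hj
      have h1 : 0 < j % p := by
        refine Nat.pos_of_ne_zero fun h0 => hj' ?_
        obtain ⟨i, rfl⟩ := Nat.dvd_of_mod_eq_zero h0
        refine ⟨i, ?_, mul_comm _ _⟩
        rw [mul_comm] at hjr
        simpa [Nat.lt_succ_iff] using Nat.le_of_mul_le_mul_right hjr hp.pos
      have h2 := Nat.mod_lt j hp.pos
      obtain ⟨u, hu⟩ := exists_mul_sub_eq hjs h1
      obtain ⟨u', hu'⟩ := exists_mul_sub_eq hjr h1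
      rw [hu, hu']
      refine hypY_mul_hypPoly_mul_hypX_mul_eq_zero k p b hμ hG hX _ _ _ _ _ (by omega) (by omega) ?_
      simp
    · rw [zero_mul]
  · intro i _
    simp only [Nat.mul_le_mul_right_iff hp.pos, Nat.sub_mul]

theorem frobSplit_hypX_mul_hypMono (r s n l : ℕ) :
    frobSplit k p (hypX k r * hypMono k (s, n, l)) = (∑ i ∈ Finset.range (r + 1), if i ≤ s then
      hypY k ((s - i) * p) * hypPoly k (binom (2 * ((i * p : ℕ) : ℤ) - (r * p : ℕ) - (s * p : ℕ))
        (i * p)) * hypX k ((r - i) * p) else 0) *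
      (hypPoly k (binom 0 (n * p)) * hypX k (l * p)) := by
  have hp := (Fact.out : p.Prime)
  have h1 : hypX k r * hypMono k (s, n, l) = hypX k r * hypY k s *
      (hypPoly k (binom 0 n) * hypX k l) := by
    simp only [hypMono, hypPoly_binom, mul_assoc]
  rw [h1, hypX_mul_hypY, Finset.sum_mul, Finset.sum_mul, map_sum]
  refine Finset.sum_congr rfl fun i hi => ?_
  split_ifs with his
  swap
  · rw [zero_mul, zero_mul, map_zero]
  have hir : i ≤ r := by simpa [Nat.lt_succ_iff] using hi
  -- Both sides are brought to the form `Y^{(·)} f(H) X^{(·)}`, so that the description of `Fr'` on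
  -- functions of `H` applies to each term.
  have h2 : ∀ (y x x' : U k) (f g : intPoly) (m : ℕ), x = hypX k m →
      y * hypPoly k f * x * (hypPoly k g * x') =
        y * hypPoly k (f * shift (-2 * m) g) * (x * x') := by
    rintro y _ x' f g m rfl
    rw [← mul_assoc, mul_assoc _ (hypX k m), hypX_mul_hypPoly, map_mul]
    simp only [mul_assoc]
  rw [h2 _ _ _ _ _ _ rfl, h2 _ _ _ _ _ _ rfl, hypX_mul, hypX_mul_mul,
    ← natCast_smul_U, ← natCast_smul_U, mul_smul_comm, mul_smul_comm, map_smul]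
  congr 1
  -- From this threshold on, both shifted arguments are nonnegative. All shifts are multiples of
  -- `p`, so `⌊·/p⌋` turns them into the shifts of the original formula.
  refine frobSplit_hypPoly k p _ _ (2 * (r * p) + s * p) _ _ fun t ht => ?_
  have h3 : (0 : ℤ) ≤ t + -2 * ((r - i : ℕ) * p : ℕ) := by
    have := Nat.mul_le_mul_right p (Nat.sub_le r i)
    push_cast at this ⊢
    omega
  have h4 : (0 : ℤ) ≤ t + (2 * ((i * p : ℕ) : ℤ) - (r * p : ℕ) - (s * p : ℕ)) := by
    omega
  simp only [val_mul, val_shift, val_binom, add_zero]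
  rw [Int.cast_mul, choose_modEq p h3, choose_modEq p h4, Nat.mul_mod_left, Nat.mul_mod_left,
    Ring.choose_zero_right, Ring.choose_zero_right, Nat.mul_div_cancel _ hp.pos,
    Nat.mul_div_cancel _ hp.pos]
  have h5 : ((t : ℤ) + -2 * ((r - i : ℕ) * p : ℕ)) / p = t / p + -2 * (r - i : ℕ) := by
    rw [show ((t : ℤ) + -2 * ((r - i : ℕ) * p : ℕ)) = t + (-2 * (r - i : ℕ)) * p by push_cast; ring,
      Int.add_mul_ediv_right _ _ (by exact_mod_cast hp.ne_zero)]
  have h6 : ((t : ℤ) + (2 * ((i * p : ℕ) : ℤ) - (r * p : ℕ) - (s * p : ℕ))) / p =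
      t / p + (2 * i - r - s) := by
    rw [show ((t : ℤ) + (2 * ((i * p : ℕ) : ℤ) - (r * p : ℕ) - (s * p : ℕ))) =
      t + (2 * i - r - s) * p by push_cast; ring,
      Int.add_mul_ediv_right _ _ (by exact_mod_cast hp.ne_zero)]
  rw [h5, h6]
  push_cast
  ring

/-- On suitable elements, `Fr'` is multiplicative. -/
theorem frobSplit_mul {G : U k} (b : ℕ) (hμ : mu k p b * G = G)
    (hG : ∀ v, p - b % p ≤ v → v < p → hypY k v * hypX k v * G = 0)
    (hz : ∀ z, Commute (frobSplit k p z) G) (z z' : U k) :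
    frobSplit k p z * frobSplit k p z' * G = frobSplit k p (z * z') * G := by
  revert z'
  refine U_induction k (P := fun z => ∀ z', frobSplit k p z * frobSplit k p z' * G =
    frobSplit k p (z * z') * G) ?_ ?_ ?_ ?_ ?_ ?_ z
  · intro z'
    rw [frobSplit_one, one_mul, one_mul]
  · intro u v hu hv z'
    rw [map_add, add_mul, add_mul, hu, hv, add_mul, map_add, add_mul]
  · intro c u hu z'
    rw [map_smul, smul_mul_assoc, smul_mul_assoc, hu, smul_mul_assoc, map_smul, smul_mul_assoc]
  -- Commuting `G` past `Fr'(z')` lets the statement for `u` be used twice, with `v` and with `v z'`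
  -- as second factor; this is why `z'` stays quantified in the induction.
  · intro u v hu hv z'
    rw [mul_assoc, (hz z').eq, ← mul_assoc, ← hu, mul_assoc u, ← hu, mul_assoc _ _ G,
      mul_assoc _ _ G, ← hv, mul_assoc, mul_assoc, ← (hz z').eq]
    simp only [mul_assoc]
  -- On a basis element the factor to the right of `Y^{(s)}` is itself an image under `Fr'`, so it
  -- commutes with `G`, and `G` can be brought next to `X^{(rp)} Y^{(sp)}`.
  · intro r z'
    have h : (LinearMap.mulRight k G).comp ((LinearMap.mulLeft k (frobSplit k p (hypX k r))).comp
        (frobSplit k p)) = (LinearMap.mulRight k G).comp ((frobSplit k p).comp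
          (LinearMap.mulLeft k (hypX k r))) := by
      refine (hypBasis k).ext fun ⟨s, n, l⟩ => ?_
      simp only [LinearMap.comp_apply, LinearMap.mulLeft_apply, LinearMap.mulRight_apply,
        hypBasis_apply, frobSplit_hypMono, frobSplit_hypX]
      have h1 : Commute (hypPoly k (binom 0 (n * p)) * hypX k (l * p)) G := by
        have := hz (hypMono k (0, n, l))
        rwa [frobSplit_hypMono, hypMono, zero_mul, hypY_zero, one_mul] at this
      rw [frobSplit_hypX_mul_hypMono, mul_assoc (Finset.sum _ _) _ G, h1.eq, ← mul_assoc (Finset.sum _ _),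
        ← hypX_mul_hypY_mul k p b hμ hG fun m => frobSplit_hypX k p m ▸ hz (hypX k m),
        mul_assoc _ G, ← h1.eq]
      simp only [hypMono, hypPoly_binom, mul_assoc]
    exact LinearMap.congr_fun h z'
  -- Left multiplication by `Y^{(m)}` only rescales basis elements, and `binom((m+s)p, mp) ≡
  -- binom(m+s, m)`; no factor `G` is needed.
  · intro m z'
    have h : (LinearMap.mulLeft k (frobSplit k p (hypY k m))).comp (frobSplit k p) =
        (frobSplit k p).comp (LinearMap.mulLeft k (hypY k m)) := by
      refine (hypBasis k).ext fun ⟨s, n, l⟩ => ?_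
      simp only [LinearMap.comp_apply, LinearMap.mulLeft_apply, hypBasis_apply, frobSplit_hypMono,
        frobSplit_hypY]
      have h1 : hypY k m * hypMono k (s, n, l) = ((m + s).choose m : k) • hypMono k (m + s, n, l) := by
        simp only [hypMono]
        rw [← mul_assoc, ← mul_assoc, hypY_mul, natCast_smul_U]
        simp only [mul_assoc]
      rw [h1, map_smul, frobSplit_hypMono]
      simp only [hypMono]
      rw [← mul_assoc, ← mul_assoc, hypY_mul_mul, natCast_smul_U]
      simp only [mul_assoc]
    exact congrArg (· * G) (LinearMap.congr_fun h z')

end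

end Hyperalgebra

end

noncomputable section

namespace Hyperalgebra

open intPoly

/-! ### Polynomials in `Y X` -/

section

variable (k : Type*) [Field k]

theorem intPoly.ext_val {f g : intPoly} (h : ∀ n : ℕ, val f n = val g n) : f = g := by
  refine Subtype.ext (Polynomial.eq_of_infinite_eval_eq _ _ (Set.infinite_of_injective_forall_mem
    (f := fun n : ℕ => ((n : ℤ) : ℂ)) (fun a b h => by simpa using h) fun n => ?_))
  rw [Set.mem_ofPred_eq, ← cast_val, ← cast_val, h]

theorem repr_hypMono (i j : ℕ × ℕ × ℕ) :
    (hypBasis k).repr (hypMono k i) j = if i = j then 1 else 0 := by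
  rw [← hypBasis_apply, Module.Basis.repr_self, Finsupp.single_apply]

theorem hypH_eq_sum (c : ℤ) (m : ℕ) : hypH k c m =
    ∑ i ∈ Finset.HasAntidiagonal.antidiagonal m, ((Ring.choose c i.2 : ℤ) : U k) * hypH k 0 i.1 := by
  have : binom c m = (∑ i ∈ Finset.HasAntidiagonal.antidiagonal m,
      ((Ring.choose c i.2 : ℤ) : intPoly) * binom 0 i.1) := by
    refine intPoly.ext_val fun n => ?_
    simp only [val_sum, val_mul, val_intCast, val_binom, add_zero]
    rw [Ring.add_choose_eq _ (Commute.all _ _)]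
    exact (Finset.sum_congr rfl fun i _ => mul_comm _ _)
  rw [← hypPoly_binom, this]
  simp [hypPoly_binom]

/-- By Vandermonde's identity `binom(H + c, q)` is `binom(H, q)` plus terms of lower degree. The
coordinate with middle index `q` therefore separates different `m`. -/
theorem repr_hypY_mul_hypH_mul_hypX (c : ℤ) (m m' q : ℕ) :
    (hypBasis k).repr (hypY k m * hypH k c q * hypX k m) (m', q, m') =
      if m = m' then 1 else 0 := by
  have h2 : ∀ (n : ℤ) (u v w : U k), u * ((n : U k) * v) * w = (n : k) • (u * v * w) :=
    fun n u v w => by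
    rw [← map_intCast (algebraMap k (U k)), ← Algebra.smul_def, mul_smul_comm, smul_mul_assoc]
  have h3 : ∀ n, hypY k m * hypH k 0 n * hypX k m = hypMono k (m, n, m) := fun _ => rfl
  rw [hypH_eq_sum, Finset.mul_sum, Finset.sum_mul]
  simp only [h2, h3, map_sum, map_smul, Finsupp.finsetSum_apply, Finsupp.smul_apply, repr_hypMono]
  -- The pair `(q, 0)` is the leading term, with coefficient `binom(c, 0) = 1`.
  rw [Finset.sum_eq_single_of_mem (q, 0) (by simp)]
  · simp
  · rintro ⟨i, j⟩ hi hij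
    rw [if_neg, smul_zero]
    simp only [Prod.mk.injEq]
    rintro ⟨-, rfl, -⟩
    have := Finset.HasAntidiagonal.mem_antidiagonal.1 hi
    exact hij (by simpa using this)

variable (p : ℕ)

theorem hypX_pow_mul_mu (m : ℕ) (a : ℤ) :
    hypX k 1 ^ m * mu k p a = mu k p (a + 2 * m) * hypX k 1 ^ m := by
  rw [hypX_one_pow, mul_assoc, hypX_mul_mu, ← mul_assoc, (Nat.cast_commute _ _).eq, mul_assoc]

theorem hypY_pow_mul_mu (m : ℕ) (a : ℤ) :
    hypY k 1 ^ m * mu k p (a + 2 * m) = mu k p a * hypY k 1 ^ m := by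
  rw [hypY_one_pow, mul_assoc, hypY_mul_mu, ← mul_assoc, (Nat.cast_commute _ _).eq, mul_assoc]

variable [Fact p.Prime] [CharP k p]

/-- The value of a polynomial over the prime field at `Y X`. -/
def evalYX : (ZMod p)[X] →+* U k :=
  ((aeval (hypYX k) : k[X] →ₐ[k] U k) : k[X] →+* U k).comp (mapRingHom (ofPrime p k))

theorem evalYX_apply (f : (ZMod p)[X]) : evalYX k p f = aeval (hypYX k) (f.map (ofPrime p k)) := rfl

theorem evalYX_X : evalYX k p X = hypYX k := by simp [evalYX_apply]

theorem evalYX_C (c : ZMod p) : evalYX k p (C c) = algebraMap k (U k) (ofPrime p k c) := by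
  simp [evalYX_apply]

theorem evalYX_intCast (n : ℤ) : evalYX k p (C (n : ZMod p)) = (n : U k) := by
  rw [evalYX_C, map_intCast, map_intCast]

theorem commute_evalYX {u : U k} (h : Commute u (hypYX k)) (f : (ZMod p)[X]) :
    Commute u (evalYX k p f) := by
  rw [evalYX_apply]
  exact semiconj_aeval h _

theorem hypPoly_binom_mul_mu (b : ℤ) : hypPoly k (binom 0 1) * mu k p b = (b : U k) * mu k p b := by
  have := hypPoly_mul_mu_congr k p (f := binom 0 1) (g := (b : intPoly)) b 0 fun n _ h => by
    rw [val_intCast, val_binom, add_zero, Ring.choose_one_right, ← h, Int.cast_natCast]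
  rwa [map_intCast] at this

theorem hypX_one_mul_hypYX_mul_mu (a : ℤ) :
    hypX k 1 * hypYX k * mu k p a =
      evalYX k p (X + C ((a + 2 : ℤ) : ZMod p)) * hypX k 1 * mu k p a := by
  rw [hypX_mul_hypYX, map_add, evalYX_X, evalYX_intCast, add_mul, add_mul, add_mul]
  congr 1
  simp only [Nat.cast_one, sub_self, one_mul]
  rw [mul_assoc, hypX_mul_mu, ← mul_assoc, hypPoly_binom_mul_mu, mul_assoc _ (hypX k 1),
    hypX_mul_mu, ← mul_assoc]
  simp

/-- In weight `a`, moving `X` past `YX` adds the scalar `a + 2`, the weight of `X μ_a`; so `X` acts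
on polynomials in `YX` by a translation. -/
theorem hypX_one_mul_evalYX_mul_mu (f : (ZMod p)[X]) (a : ℤ) :
    hypX k 1 * evalYX k p f * mu k p a =
      evalYX k p (f.comp (X + C ((a + 2 : ℤ) : ZMod p))) * hypX k 1 * mu k p a := by
  have h : SemiconjBy (hypX k 1 * mu k p a) (hypYX k)
      (evalYX k p (X + C ((a + 2 : ℤ) : ZMod p))) := by
    rw [SemiconjBy, mul_assoc, (commute_mu_hypYX p k a).eq, ← mul_assoc, hypX_one_mul_hypYX_mul_mu,
      mul_assoc]
  have h2 := semiconj_aeval h (f.map (ofPrime p k))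
  have h3 : aeval (evalYX k p (X + C ((a + 2 : ℤ) : ZMod p))) (f.map (ofPrime p k)) =
      evalYX k p (f.comp (X + C ((a + 2 : ℤ) : ZMod p))) := by
    rw [evalYX_apply, evalYX_apply, Polynomial.map_comp, aeval_comp]
  rw [h3, ← evalYX_apply, SemiconjBy] at h2
  rw [mul_assoc, ← (commute_evalYX k p (commute_mu_hypYX p k a) f).eq, ← mul_assoc, h2, mul_assoc]

theorem hypX_mul_hypY_one : hypX k 1 * hypY k 1 = hypYX k + hypPoly k (binom 0 1) := by
  rw [hypX_mul_hypY, Finset.sum_range_succ, Finset.sum_range_one]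
  have h0 : ∀ c, binom c 0 = 1 := fun c => Subtype.ext (binomPoly_zero c)
  simp [h0, hypYX, hypX_zero, hypY_zero]

/-- The counterpart of `Y^s X^s μ_a = φ_{a,s}(YX) μ_a` for the opposite order: moving `X^s` from the
right to the left of a polynomial in `YX` in weight `a` translates the variable by `s(s + a + 1)`.
-/
theorem hypX_pow_mul_hypY_pow_mul_mu (s : ℕ) (a : ℤ) :
    hypX k 1 ^ s * hypY k 1 ^ s * mu k p (a + 2 * s) =
      evalYX k p ((phi p a s).comp (X + C ((s : ZMod p) * (s + a + 1)))) * mu k p (a + 2 * s) := by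
  induction s generalizing a with
  | zero => simp [phi]
  | succ s ih =>
    have e1 : a + 2 * ((s + 1 : ℕ) : ℤ) = a + 2 * s + 2 * (1 : ℕ) := by push_cast; ring
    have h1 : hypY k 1 * mu k p (a + 2 * ((s + 1 : ℕ) : ℤ)) = mu k p (a + 2 * s) * hypY k 1 := by
      rw [e1, hypY_mul_mu]
    have h2 : hypX k 1 * hypY k 1 * mu k p (a + 2 * ((s + 1 : ℕ) : ℤ)) =
        evalYX k p (X + C (((a + 2 * s + 2 : ℤ)) : ZMod p)) * mu k p (a + 2 * ((s + 1 : ℕ) : ℤ)) := by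
      rw [hypX_mul_hypY_one, map_add, evalYX_X, evalYX_intCast, add_mul, add_mul,
        hypPoly_binom_mul_mu, e1]
      simp
    rw [pow_succ', pow_succ, mul_assoc, mul_assoc, mul_assoc, h1, ← mul_assoc (_ ^ s),
      ← mul_assoc (_ * _ ^ s), ih, ← mul_assoc, ← mul_assoc, hypX_one_mul_evalYX_mul_mu,
      mul_assoc, ← h1, mul_assoc, ← mul_assoc (hypX k 1), h2, ← mul_assoc, ← map_mul]
    congr 2
    simp only [phi, Finset.prod_range_succ, mul_comp, prod_comp, sub_comp, X_comp, C_comp, add_comp]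
    rw [mul_comm, mul_comm (Finset.prod _ _)]
    congr 1
    · rw [add_sub_assoc, ← C_sub]
      congr 2
      push_cast
      ring
    · refine Finset.prod_congr rfl fun i _ => ?_
      rw [add_assoc, ← C_add]
      congr 3
      push_cast
      ring

theorem evalYX_phi_mul_mu (a : ℤ) (m : ℕ) :
    evalYX k p (phi p a m) * mu k p a = hypY k 1 ^ m * hypX k 1 ^ m * mu k p a :=
  (hypY_pow_mul_hypX_pow_mul_mu p k a m).symm

theorem hypX_one_pow_eq_zero : hypX k 1 ^ p = 0 := by
  rw [hypX_one_pow]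
  obtain ⟨c, hc⟩ := Nat.dvd_factorial (Fact.out : p.Prime).pos le_rfl
  rw [hc, Nat.cast_mul, natCast_U_eq_zero p, zero_mul, zero_mul]

theorem evalYX_mul_mu_eq_zero {f : (ZMod p)[X]} {a : ℤ} (h : phi p a p ∣ f) :
    evalYX k p f * mu k p a = 0 := by
  obtain ⟨g, rfl⟩ := h
  rw [mul_comm, map_mul, mul_assoc, evalYX_phi_mul_mu, hypX_one_pow_eq_zero, mul_zero, zero_mul,
    mul_zero]

/-- In the basis `φ_{a,m}`, `m < p`, the element becomes a combination of `Y^m X^m μ_a`. These are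
`m!²` times elements that the basis coordinates `(m, p - 1, m)` separate, and `m!` is invertible.
This gives the uniqueness of the coefficients `c_m`. -/
theorem eq_zero_of_evalYX_mul_mu {f : (ZMod p)[X]} {a : ℤ} (hf : f.natDegree < p)
    (h : evalYX k p f * mu k p a = 0) : f = 0 := by
  have hp := (Fact.out : p.Prime)
  obtain ⟨d, hd⟩ := exists_newton p a p 0 f (by omega) hf (by simp [phi])
  have h1 : ∀ m, evalYX k p (C (d m) * phi p a m) * mu k p a =
      (ofPrime p k (d m) * ((m.factorial : k) * m.factorial)) •
        (hypY k m * hypH k (-(a + 2 * m) - 1) (p - 1) * hypX k m) := by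
    intro m
    have h2 : hypY k m * hypH k (-(a + 2 * m) - 1) (p - 1) * hypX k m =
        hypY k m * hypX k m * mu k p a := by
      rw [mul_assoc _ (hypX k m), hypX_mul_mu, mul_assoc]
      rfl
    rw [h2, map_mul, evalYX_C, mul_assoc, evalYX_phi_mul_mu, hypX_one_pow, hypY_one_pow,
      ← Algebra.smul_def, mul_smul, mul_smul, natCast_smul_U, natCast_smul_U]
    congr 1
    rw [mul_assoc _ (hypY k m), ← mul_assoc (hypY k m), ← (Nat.cast_commute _ (hypY k m)).eq]
    simp only [mul_assoc]
  rw [hd] at h ⊢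
  rw [map_sum, Finset.sum_mul] at h
  refine Finset.sum_eq_zero fun m hm => ?_
  have h3 := congrArg (fun u => (hypBasis k).repr u (m, p - 1, m)) h
  simp only [h1, map_sum, map_smul, Finsupp.finsetSum_apply, Finsupp.smul_apply,
    repr_hypY_mul_hypH_mul_hypX k, map_zero, Finsupp.zero_apply] at h3
  rw [Finset.sum_eq_single_of_mem m hm (fun i _ hi => by rw [if_neg hi, smul_zero]), if_pos rfl,
    smul_eq_mul, mul_one] at h3
  have h4 : (m.factorial : k) ≠ 0 := by
    rw [Ne, CharP.cast_eq_zero_iff k p, hp.dvd_factorial, not_le]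
    exact (Finset.mem_Ico.1 hm).2
  have h5 : ofPrime p k (d m) = 0 := by simpa [h4] using h3
  rw [(map_eq_zero _).1 h5, C_0, zero_mul]

/-- The vanishing required for the multiplicativity of `Fr'` becomes one divisibility: `Y^v X^v μ_b`
is `φ_{b,v}(YX) μ_b`, and `φ_{b,p - b % p}` divides `φ_{b,v}` for all larger `v`. -/
theorem frobSplit_mul_evalYX (b : ℕ) {g : (ZMod p)[X]} (hg : phi p b p ∣ phi p b (p - b % p) * g)
    (z z' : U k) : frobSplit k p z * frobSplit k p z' * (evalYX k p g * mu k p b) =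
      frobSplit k p (z * z') * (evalYX k p g * mu k p b) := by
  have hc : ∀ (u : U k) (f : (ZMod p)[X]), Commute u (hypYX k) → Commute u (mu k p b) →
      Commute u (evalYX k p f * mu k p b) :=
    fun u f h1 h2 => (commute_evalYX k p h1 f).mul_right h2
  refine frobSplit_mul k p b ?_ ?_ ?_ z z'
  · rw [(hc _ g (commute_mu_hypYX p k b) (Commute.refl _)).eq, mul_assoc, mu_mul_self]
  · intro v hv hvp
    have h1 : phi p b p ∣ phi p b v * g := by
      refine hg.trans (mul_dvd_mul_right ?_ g)
      exact Finset.prod_dvd_prod_of_subset _ _ _ (Finset.range_mono hv)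
    have h2 := evalYX_mul_mu_eq_zero k p h1
    have h4 : hypY k 1 ^ v * hypX k 1 ^ v * (evalYX k p g * mu k p b) = 0 := by
      rw [← (commute_evalYX k p (commute_mu_hypYX p k b) g).eq, ← mul_assoc, ← evalYX_phi_mul_mu,
        mul_assoc, (commute_evalYX k p (commute_mu_hypYX p k b) g).eq, ← mul_assoc, ← map_mul, h2]
    -- Ordinary and divided powers differ by the scalar `v!²`, which is invertible as `v < p`.
    have h5 : ((v.factorial : k) * v.factorial) • (hypY k v * hypX k v *
        (evalYX k p g * mu k p b)) = 0 := by
      rw [← h4, hypX_one_pow, hypY_one_pow, mul_smul, natCast_smul_U, natCast_smul_U,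
        mul_assoc _ (hypY k v), ← mul_assoc (hypY k v), ← (Nat.cast_commute _ (hypY k v)).eq]
      simp only [mul_assoc]
    have h6 : (v.factorial : k) ≠ 0 := by
      rw [Ne, CharP.cast_eq_zero_iff k p, (Fact.out : p.Prime).dvd_factorial, not_le]
      exact hvp
    have h7 := congrArg (fun u => ((v.factorial : k) * v.factorial)⁻¹ • u) h5
    simpa only [smul_smul, inv_mul_cancel₀ (mul_ne_zero h6 h6), one_smul, smul_zero] using h7
  · exact fun z => hc _ g (frobSplit_commute_hypYX k p z) (frobSplit_commute_mu k p b z)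

/-! ### Products of the elements `Y^s Fr'(z) Q(YX) μ_b X^s` -/

/-- The element `Y ^ s Fr'(z) Q(Y X) μ_b X ^ s`, to which `Z` specializes. -/
def twist (s b : ℕ) (Q : (ZMod p)[X]) (z : U k) : U k :=
  hypY k 1 ^ s * (frobSplit k p z * (evalYX k p Q * mu k p b)) * hypX k 1 ^ s

/-- With `b = a + 2s`, the factor `φ_{b,p-s}(YX) μ_b = Y^{p-s} X^{p-s} μ_b` meets `X^s` on its right
and produces `X^p = 0`. -/
theorem twist_congr (a s : ℕ) (hs : s ≤ p) {Q R : (ZMod p)[X]}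
    (h : phi p ((a + 2 * s : ℕ) : ℤ) (p - s) ∣ Q - R) (z : U k) :
    twist k p s (a + 2 * s) Q z = twist k p s (a + 2 * s) R z := by
  have h1 : evalYX k p (Q - R) * mu k p ((a + 2 * s : ℕ) : ℤ) * hypX k 1 ^ s = 0 := by
    obtain ⟨g, hg⟩ := h
    rw [hg, mul_comm, map_mul, mul_assoc (evalYX k p g), evalYX_phi_mul_mu, mul_assoc, mul_assoc,
      Nat.cast_add, Nat.cast_mul, Nat.cast_ofNat, ← hypX_pow_mul_mu, mul_assoc (_ ^ (p - s)),
      ← mul_assoc (_ ^ (p - s)) (_ ^ s), ← pow_add, Nat.sub_add_cancel hs, hypX_one_pow_eq_zero,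
      zero_mul, mul_zero, mul_zero]
  rw [map_sub, sub_mul, sub_mul, sub_eq_zero] at h1
  simp only [twist, mul_assoc] at h1 ⊢
  rw [h1]

/-- The inner `X^s Y^s` turns into a polynomial in `YX`, everything except the two images under
`Fr'` commutes into one polynomial, and the divisibility is what merges `Fr'(z) Fr'(z')` into `Fr'(z
z')`. -/
theorem twist_mul_twist (a s : ℕ) {Q R : (ZMod p)[X]}
    (h : phi p ((a + 2 * s : ℕ) : ℤ) p ∣ phi p ((a + 2 * s : ℕ) : ℤ) (p - (a + 2 * s) % p) *
      ((phi p a s).comp (X + C ((s : ZMod p) * (s + a + 1))) * Q)) (z z' : U k) :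
    twist k p s (a + 2 * s) Q z * twist k p s (a + 2 * s) R z' =
      twist k p s (a + 2 * s) ((phi p a s).comp (X + C ((s : ZMod p) * (s + a + 1))) * Q * R)
        (z * z') := by
  have hμ : mu k p ((a + 2 * s : ℕ) : ℤ) = mu k p ((a : ℤ) + 2 * s) := by push_cast; rfl
  have hT := fun f => (commute_evalYX k p (commute_mu_hypYX p k ((a + 2 * s : ℕ) : ℤ)) f).eq
  have h1 : evalYX k p Q * mu k p ((a + 2 * s : ℕ) : ℤ) * (hypX k 1 ^ s * hypY k 1 ^ s) =
      evalYX k p ((phi p a s).comp (X + C ((s : ZMod p) * (s + a + 1))) * Q) *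
        mu k p ((a + 2 * s : ℕ) : ℤ) := by
    have h2 : mu k p ((a + 2 * s : ℕ) : ℤ) * (hypX k 1 ^ s * hypY k 1 ^ s) =
        hypX k 1 ^ s * hypY k 1 ^ s * mu k p ((a + 2 * s : ℕ) : ℤ) := by
      rw [hμ, ← mul_assoc, ← hypX_pow_mul_mu, mul_assoc, ← hypY_pow_mul_mu, mul_assoc]
    have h3 := hypX_pow_mul_hypY_pow_mul_mu k p s a
    rw [mul_assoc, h2, hμ, h3, ← mul_assoc, ← map_mul, mul_comm]
    simp
  have h4 : ∀ f, Commute (frobSplit k p z') (evalYX k p f * mu k p ((a + 2 * s : ℕ) : ℤ)) :=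
    fun f => (commute_evalYX k p (frobSplit_commute_hypYX k p z') f).mul_right
      (frobSplit_commute_mu k p _ z')
  set P := (phi p a s).comp (X + C ((s : ZMod p) * (s + a + 1))) * Q with hP
  set μ := mu k p ((a + 2 * s : ℕ) : ℤ) with hμ'
  have h5 : evalYX k p P * μ * (evalYX k p R * μ) = evalYX k p (P * R) * μ := by
    rw [mul_assoc, ← mul_assoc μ, hT, mul_assoc, mu_mul_self, map_mul (evalYX k p) P R, mul_assoc]
  calc twist k p s (a + 2 * s) Q z * twist k p s (a + 2 * s) R z'
      = hypY k 1 ^ s * (frobSplit k p z * (evalYX k p Q * μ * (hypX k 1 ^ s * hypY k 1 ^ s)) *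
          (frobSplit k p z' * (evalYX k p R * μ))) * hypX k 1 ^ s := by
        simp only [twist, mul_assoc]; rfl
    _ = hypY k 1 ^ s * (frobSplit k p z * frobSplit k p z' * (evalYX k p P * μ) *
          (evalYX k p R * μ)) * hypX k 1 ^ s := by
        rw [h1, mul_assoc (frobSplit k p z) (frobSplit k p z'), (h4 P).eq]
        simp only [mul_assoc]
    _ = hypY k 1 ^ s * (frobSplit k p (z * z') * (evalYX k p (P * R) * μ)) * hypX k 1 ^ s := by
        rw [frobSplit_mul_evalYX k p _ h, mul_assoc (frobSplit k p (z * z')), h5]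

end

end Hyperalgebra

end

noncomputable section

namespace Hyperalgebra

/-! ### The polynomials `ψ` -/

section

variable (p : ℕ) [hp : Fact p.Prime]

/-- The polynomial `f` with `B^{(ε)}(a, j) = f(Y X) μ_a`. -/
def redPoly (ε a : ℕ) (j : ℚ) : (ZMod p)[X] :=
  if p = 2 then
    if a = 0 then (if ε = 0 then 1 else X) else (if j = 0 then X else X + 1)
  else (psi p ε (j : ZMod p)).comp (X + C ((((a : ZMod p) + 1) / 2) ^ 2))

/-- The product of the `x - i²` over all `i ≠ ± s`. -/
def psiAway (s : ZMod p) : (ZMod p)[X] := ∏ i ∈ Finset.univ \ {s, -s}, (X - C (i ^ 2))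

theorem psiAway_mul_prod (s : ZMod p) :
    psiAway p s * ∏ i ∈ {s, -s}, (X - C (i ^ 2)) = psiFull p :=
  Finset.prod_sdiff (Finset.subset_univ _)

theorem two_ne_zero_of_ne_two (hp2 : p ≠ 2) : (2 : ZMod p) ≠ 0 := by
  intro h
  have : ((2 : ℕ) : ZMod p) = 0 := by exact_mod_cast h
  rw [ZMod.natCast_eq_zero_iff] at this
  exact hp2 ((Nat.prime_dvd_prime_iff_eq hp.out Nat.prime_two).1 this)

theorem ne_neg_of_ne_two (hp2 : p ≠ 2) {s : ZMod p} (hs : s ≠ 0) : s ≠ -s := by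
  intro h
  have : (2 : ZMod p) * s = 0 := by linear_combination h
  exact mul_ne_zero (two_ne_zero_of_ne_two p hp2) hs this

theorem psiAway_mul_sq (hp2 : p ≠ 2) {s : ZMod p} (hs : s ≠ 0) :
    psiAway p s * (X - C (s ^ 2)) ^ 2 = psiFull p := by
  rw [← psiAway_mul_prod p s, Finset.prod_pair (ne_neg_of_ne_two p hp2 hs), neg_sq, sq]

theorem psi_one (hp2 : p ≠ 2) {ε : ℕ} (hε : ε ≠ 0) {s : ZMod p} (hs : s ≠ 0) :
    psi p ε s = psiAway p s * (X - C (s ^ 2)) := by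
  rw [psi, if_neg hε, ← psiAway_mul_sq p hp2 hs, sq, ← mul_assoc,
    mul_comm, mul_divByMonic_cancel_left _ (monic_X_sub_C _)]

theorem psi_zero {s : ZMod p} (hs : s ≠ 0) :
    psi p 0 s = 2 * (X + C (s ^ 2)) * psiAway p s := by
  have h : (Finset.univ \ {s, -s} : Finset (ZMod p)) = insert 0 (Finset.univ \ {0, s, -s}) := by
    ext i
    simp only [Finset.mem_sdiff, Finset.mem_univ, true_and, Finset.mem_insert, Finset.mem_singleton]
    by_cases hi : i = 0
    · subst hi; simpa [eq_comm] using hs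
    · simp [hi]
  rw [psi, if_pos rfl, if_neg hs, psiAway, h, Finset.prod_insert (by simp)]
  simp
  ring

theorem psi_zero_zero : psi p 0 0 = psiAway p 0 := by
  rw [psi, if_pos rfl, if_pos rfl, psiAway]
  congr 1
  ext i
  simp

/-- The only property of `ψ_s^{(ε)}` that the divisibilities by `φ` in the choice of `s(a, j)` need.
-/
theorem psiAway_dvd_psi (hp2 : p ≠ 2) {ε : ℕ} {s : ZMod p} (h : s = 0 → ε = 0) :
    psiAway p s ∣ psi p ε s := by
  by_cases hs : s = 0
  · rw [h hs, hs, psi_zero_zero]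
  · by_cases hε : ε = 0
    · rw [hε, psi_zero p hs]; exact Dvd.intro_left _ rfl
    · rw [psi_one p hp2 hε hs]; exact Dvd.intro _ rfl

theorem psiFull_eq (hp2 : p ≠ 2) : psiFull p = X * (X ^ ((p - 1) / 2) - 1) ^ 2 := by
  have hodd := hp.out.eq_two_or_odd'.resolve_left hp2
  obtain ⟨n, hn⟩ := hodd
  have hn' : (p - 1) / 2 = n := by omega
  -- After substituting `x²` for `x`, each factor `x² - i²` splits, and the product over all
  -- residues becomes `(x^p - x)²`.
  apply expand_injective (n := 2) two_pos
  have h1 : ∏ i : ZMod p, (X - C i) = X ^ p - X := by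
    have h0 := FiniteField.roots_X_pow_card_sub_X (ZMod p)
    rw [ZMod.card] at h0
    have h1 : (X ^ p - X : (ZMod p)[X]).Monic := by
      refine monic_X_pow_sub (degree_X_le.trans_lt ?_)
      exact_mod_cast hp.out.one_lt
    have h2 := prod_multiset_X_sub_C_of_monic_of_roots_card_eq h1 (by
      rw [h0, FiniteField.X_pow_card_sub_X_natDegree_eq _ hp.out.one_lt]
      exact ZMod.card p)
    rw [h0] at h2
    exact h2
  have h2 : ∏ i : ZMod p, (X + C i) = X ^ p - X := by
    rw [← h1]
    exact Fintype.prod_equiv (Equiv.neg _) _ _ fun i => by simp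
  rw [psiFull, map_prod]
  have h3 : ∀ i : ZMod p, expand (ZMod p) 2 (X - C (i ^ 2)) = (X - C i) * (X + C i) := by
    intro i
    simp
    ring
  simp only [h3, Finset.prod_mul_distrib, h1, h2, hn']
  simp only [map_mul, map_pow, map_sub, expand_X, map_one]
  have h4 : (X ^ p : (ZMod p)[X]) = X ^ (2 * n + 1) := congrArg _ hn
  rw [h4]
  ring

/-- The factor `2(x + s²)` is the inverse modulo `(x - s²)²` of the product over the other roots;
this explains the shape of `ψ_s^{(0)}`. With `c = s²`, `n = (p-1)/2` and `x^n - 1 = (x - c) v`, that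
product is `x v²`. It remains to see that value and derivative of the difference vanish at `c`. -/
theorem sq_dvd_psiAway (hp2 : p ≠ 2) {s : ZMod p} (hs : s ≠ 0) :
    (X - C (s ^ 2)) ^ 2 ∣ 2 * (X + C (s ^ 2)) * psiAway p s - 1 := by
  obtain ⟨n, hn⟩ := hp.out.eq_two_or_odd'.resolve_left hp2
  have hn' : (p - 1) / 2 = n := by omega
  have h2 := two_ne_zero_of_ne_two p hp2
  have hn2 : (2 : ZMod p) * n = -1 := by
    have := congrArg (Nat.cast : ℕ → ZMod p) hn
    push_cast at this
    rw [CharP.cast_eq_zero (ZMod p) p] at this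
    linear_combination -this
  have hs2 : (s ^ 2) ^ n = 1 := by
    rw [← pow_mul, ← ZMod.pow_card_sub_one_eq_one hs]
    congr 1
    omega
  set c := s ^ 2 with hc
  have hc0 : c ≠ 0 := pow_ne_zero 2 hs
  obtain ⟨v, hv⟩ : X - C c ∣ (X ^ n - 1 : (ZMod p)[X]) := by
    rw [dvd_iff_isRoot]
    simp [IsRoot, hs2]
  have h3 : psiAway p s = X * v ^ 2 := by
    have h4 := psiAway_mul_sq p hp2 hs
    rw [psiFull_eq p hp2, hn', hv] at h4
    have h5 : (X - C c) ^ 2 ≠ 0 := pow_ne_zero 2 (X_sub_C_ne_zero c)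
    refine mul_right_cancel₀ h5 (h4.trans ?_)
    ring
  -- This differential equation for `x^n - 1 = (x - c) v` and its derivative, both evaluated at `c`,
  -- give `c v(c) = n` and `v(c) + 2c v'(c) = n v(c)`. Together with `2n = -1` that is all the data
  -- needed.
  have e0 : X * derivative (X ^ n - 1 : (ZMod p)[X]) = C (n : ZMod p) * X ^ n := by
    rcases n with _ | n
    · simp
    · simp; ring
  have e0' : X * derivative (X ^ n - 1 : (ZMod p)[X]) = C (n : ZMod p) * (X ^ n - 1) + C (n : ZMod p) := by
    rw [e0]; ring
  rw [hv, derivative_mul] at e0'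
  have e1 := congrArg (eval c) e0'
  have e2 := congrArg (fun f => eval c (derivative f)) e0'
  simp at e1 e2
  rw [h3]
  by_cases hF : 2 * (X + C c) * (X * v ^ 2) - 1 = 0
  · rw [hF]; exact dvd_zero _
  refine (le_rootMultiplicity_iff hF).1 ((one_lt_rootMultiplicity_iff_isRoot hF).2 ⟨?_, ?_⟩)
  · simp only [IsRoot, eval_sub, eval_mul, eval_add, eval_X, eval_C, eval_pow, eval_ofNat, eval_one]
    linear_combination (4 * c * eval c v + 4 * n) * e1 + (2 * n - 1) * hn2
  · simp only [IsRoot, derivative_mul, derivative_sub, derivative_add, derivative_X, derivative_C,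
      derivative_pow, derivative_ofNat, derivative_one, eval_sub, eval_mul, eval_add, eval_X, eval_C,
      eval_pow, eval_ofNat, eval_one, eval_zero]
    norm_num
    linear_combination 4 * c * eval c v * e2 + 2 * c * eval c v ^ 2 * hn2

/-- By symmetry one factor is `ψ_s^{(0)}`. It is `1` modulo the part of `ψ` at the root `s²`, and
the other factor vanishes modulo the remaining part, so multiplication by `ψ_s^{(0)}` changes
nothing modulo `ψ`. -/
theorem psiFull_dvd_psi_mul_psi (hp2 : p ≠ 2) {ε ε' : ℕ} {s : ZMod p} (hε : s = 0 → ε = 0)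
    (hε' : s = 0 → ε' = 0) (h : ε = 0 ∨ ε' = 0) :
    psiFull p ∣ psi p ε s * psi p ε' s - psi p (ε + ε') s := by
  wlog h0 : ε = 0 generalizing ε ε'
  · have := this hε' hε h.symm (h.resolve_left h0)
    rwa [mul_comm, add_comm]
  subst h0
  rw [zero_add]
  by_cases hs : s = 0
  · rw [hε' hs, hs, psi_zero_zero]
    have h1 : psiFull p = psiAway p 0 * X := by
      rw [← psiAway_mul_prod p 0]
      simp
    have h2 : psiAway p 0 = (X ^ ((p - 1) / 2) - 1) ^ 2 := by
      rw [psiFull_eq p hp2, mul_comm] at h1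
      exact (mul_right_cancel₀ X_ne_zero h1).symm
    have h3 : X ∣ (X ^ ((p - 1) / 2) - 1 : (ZMod p)[X]) ^ 2 - 1 := by
      have h4 : (p - 1) / 2 ≠ 0 := by
        have := hp.out.two_le
        omega
      refine (dvd_pow_self X h4).trans ⟨X ^ ((p - 1) / 2) - 2, ?_⟩
      ring
    rw [h1, ← mul_sub_one]
    refine mul_dvd_mul_left _ ?_
    rwa [h2]
  · have h1 := sq_dvd_psiAway p hp2 hs
    by_cases hε0 : ε' = 0
    · rw [hε0, psi_zero p hs, ← psiAway_mul_sq p hp2 hs, ← mul_sub_one]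
      obtain ⟨q, hq⟩ := h1
      exact ⟨2 * (X + C (s ^ 2)) * q, by rw [hq]; ring⟩
    · rw [psi_one p hp2 hε0 hs, psi_zero p hs, ← psiAway_mul_sq p hp2 hs, ← sub_one_mul]
      obtain ⟨q, hq⟩ := h1
      exact ⟨(X - C (s ^ 2)) * q, by rw [hq]; ring⟩

theorem psiFull_dvd_psi_mul_psi_of_ne_zero (hp2 : p ≠ 2) {ε ε' : ℕ} {s : ZMod p} (hs : s ≠ 0)
    (hε : ε ≠ 0) (hε' : ε' ≠ 0) : psiFull p ∣ psi p ε s * psi p ε' s := by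
  rw [psi_one p hp2 hε hs, psi_one p hp2 hε' hs, ← psiAway_mul_sq p hp2 hs]
  exact ⟨psiAway p s, by ring⟩

/-! ### The polynomials `φ` -/

theorem injOn_natCast {m : ℕ} (hm : m ≤ p) (c : ZMod p) :
    Set.InjOn (fun i : ℕ => (i : ZMod p) + c) (Finset.range m) := by
  intro i hi j hj h
  have h1 : (i : ZMod p) = j := add_right_cancel h
  rw [ZMod.natCast_eq_natCast_iff'] at h1
  simp only [Finset.coe_range, Set.mem_Iio] at hi hj
  rwa [Nat.mod_eq_of_lt (by omega), Nat.mod_eq_of_lt (by omega)] at h1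

/-- Completing the square: `i(i + a + 1) = (i + (a+1)/2)² - ((a+1)/2)²`. After the translation `φ`
becomes a subproduct of `ψ`, and divisibility questions turn into inclusions of index sets in `𝔽_p`.
-/
theorem phi_eq_comp (hp2 : p ≠ 2) (a m : ℕ) (hm : m ≤ p) :
    phi p a m = (∏ w ∈ (Finset.range m).image (fun i : ℕ => (i : ZMod p) + ((a : ZMod p) + 1) / 2),
      (X - C (w ^ 2))).comp (X + C ((((a : ZMod p) + 1) / 2) ^ 2)) := by
  have h2 := two_ne_zero_of_ne_two p hp2
  rw [Finset.prod_image (injOn_natCast p hm _), prod_comp, phi]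
  refine Finset.prod_congr rfl fun i _ => ?_
  rw [sub_comp, X_comp, C_comp, add_sub_assoc, ← C_sub, sub_eq_add_neg, ← C_neg]
  congr 2
  push_cast
  field_simp
  ring

theorem phi_self_eq_comp (hp2 : p ≠ 2) (a : ℕ) :
    phi p a p = (psiFull p).comp (X + C ((((a : ZMod p) + 1) / 2) ^ 2)) := by
  rw [phi_eq_comp p hp2 a p le_rfl, psiFull]
  congr 2
  refine Finset.eq_univ_of_card _ ?_
  rw [Finset.card_image_of_injOn (injOn_natCast p le_rfl _), Finset.card_range, ZMod.card]

/-- The polynomial form of `Y^{s+m} X^{s+m} = Y^s (Y^m X^m) X^s`, the inner part being evaluated in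
weight `a + 2s`. -/
theorem phi_mul_comp (a s m : ℕ) :
    phi p a s * (phi p ((a + 2 * s : ℕ) : ℤ) m).comp (X - C ((s : ZMod p) * (s + a + 1))) =
      phi p a (s + m) := by
  simp only [phi]
  rw [Finset.prod_range_add, prod_comp]
  congr 1
  refine Finset.prod_congr rfl fun i _ => ?_
  rw [sub_comp, X_comp, C_comp, sub_sub, ← C_add]
  congr 2
  push_cast
  ring

theorem phi_dvd_of_forall_ne (hp2 : p ≠ 2) {a s : ℕ} (hs : s ≤ p) {f : (ZMod p)[X]} {j : ZMod p}
    (hf : psiAway p j ∣ f)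
    (h : ∀ i < s, (i : ZMod p) + ((a : ZMod p) + 1) / 2 ≠ j ∧
      (i : ZMod p) + ((a : ZMod p) + 1) / 2 ≠ -j) :
    phi p a s ∣ f.comp (X + C ((((a : ZMod p) + 1) / 2) ^ 2)) := by
  rw [phi_eq_comp p hp2 a s hs]
  refine (compRingHom (X + C ((((a : ZMod p) + 1) / 2) ^ 2))).map_dvd (dvd_trans ?_ hf)
  refine Finset.prod_dvd_prod_of_subset _ _ _ fun w hw => ?_
  obtain ⟨i, hi, rfl⟩ := Finset.mem_image.1 hw
  have := h i (Finset.mem_range.1 hi)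
  simpa using this

/-- The only factors of `ψ` that `f` may lack are those with index `j` and `-j`; the hypotheses say
that `φ_{a,m}` supplies them. -/
theorem phi_dvd_mul_of_mem (hp2 : p ≠ 2) {a m : ℕ} (hm : m ≤ p) {f : (ZMod p)[X]} {j : ZMod p}
    (hf : psiAway p j ∣ f) (h : ∃ i < m, (i : ZMod p) + ((a : ZMod p) + 1) / 2 = j)
    (h' : ∃ i < m, (i : ZMod p) + ((a : ZMod p) + 1) / 2 = -j) :
    phi p a p ∣ phi p a m * f.comp (X + C ((((a : ZMod p) + 1) / 2) ^ 2)) := by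
  rw [phi_eq_comp p hp2 a m hm, phi_self_eq_comp p hp2 a, ← mul_comp]
  refine (compRingHom (X + C ((((a : ZMod p) + 1) / 2) ^ 2))).map_dvd ?_
  rw [← psiAway_mul_prod p j, mul_comm]
  refine mul_dvd_mul (Finset.prod_dvd_prod_of_subset _ _ _ fun w hw => ?_) hf
  obtain ⟨i, hi, hij⟩ := h
  obtain ⟨i', hi', hij'⟩ := h'
  rcases Finset.mem_insert.1 hw with rfl | hw
  · exact Finset.mem_image.2 ⟨i, Finset.mem_range.2 hi, hij⟩
  · rw [Finset.mem_singleton.1 hw]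
    exact Finset.mem_image.2 ⟨i', Finset.mem_range.2 hi', hij'⟩

end

end Hyperalgebra

end

/-! ### The exponent `s(a, j)` for odd `p`: congruences modulo `p` -/

noncomputable section

namespace Hyperalgebra

section

theorem condA_natCast (p a j : ℕ) :
    CondA p a (j : ℚ) ↔ Even a ∧ p + 1 ≤ 2 * j + a ∧ 2 * j + 1 ≤ p := by
  have h1 : ((p : ℚ) - a + 1) / 2 ≤ j ↔ p + 1 ≤ 2 * j + a := by
    rw [div_le_iff₀ two_pos, ← Nat.cast_le (α := ℚ)]
    push_cast
    constructor <;> intro h <;> linarith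
  have h2 : (j : ℚ) ≤ ((p : ℚ) - 1) / 2 ↔ 2 * j + 1 ≤ p := by
    rw [le_div_iff₀ two_pos, ← Nat.cast_le (α := ℚ)]
    push_cast
    constructor <;> intro h <;> linarith
  rw [CondA, h1, h2]

theorem condC_natCast (a j : ℕ) : CondC a (j : ℚ) ↔ Odd a ∧ 2 * j + 1 ≤ a := by
  have h2 : (j : ℚ) ≤ ((a : ℚ) - 1) / 2 ↔ 2 * j + 1 ≤ a := by
    rw [le_div_iff₀ two_pos, ← Nat.cast_le (α := ℚ)]
    push_cast
    constructor <;> intro h <;> linarith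
  rw [CondC, h2]
  simp

variable (p : ℕ) [hp : Fact p.Prime]

open Classical in
/-- The exponent `s(a, j)` under (A) or (C), and zero otherwise. -/
def twistExp (p a : ℕ) (j : ℚ) : ℕ := if CondA p a j ∨ CondC a j then shiftExp p a else 0

theorem exists_natCast_of_mem_labels (hp2 : p ≠ 2) {a : ℕ} {j : ℚ} (h : (a, j) ∈ labels p) :
    a < p ∧ ∃ i : ℕ, 2 * i + 1 ≤ p ∧ j = i := by
  rw [labels, if_neg hp2] at h
  obtain ⟨h1, i, hi, h2⟩ := h
  have := hp.out.two_le
  exact ⟨h1, i, by omega, h2⟩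

theorem add_half_eq_iff (hp2 : p ≠ 2) (i a : ℕ) (j : ℤ) :
    (i : ZMod p) + ((a : ZMod p) + 1) / 2 = j ↔ (p : ℤ) ∣ 2 * i + a + 1 - 2 * j := by
  have h2 := two_ne_zero_of_ne_two p hp2
  rw [← ZMod.intCast_zmod_eq_zero_iff_dvd]
  push_cast
  constructor
  · intro h
    rw [← h]
    field_simp
    ring
  · intro h
    field_simp
    linear_combination h

theorem natCast_eq_zero_of_lt {j : ℕ} (hj : j < p) (h : (j : ZMod p) = 0) : j = 0 := by
  rw [ZMod.natCast_eq_zero_iff] at h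
  exact Nat.eq_zero_of_dvd_of_lt h hj

theorem redPoly_of_ne_two (hp2 : p ≠ 2) (ε a j : ℕ) : redPoly p ε a (j : ℚ) =
    (psi p ε (j : ZMod p)).comp (X + C ((((a : ZMod p) + 1) / 2) ^ 2)) := by
  rw [redPoly, if_neg hp2, Rat.cast_natCast]

theorem not_dvd_of_lt {p : ℕ} {x : ℤ} (h0 : 0 < x) (h : x < p) : ¬ (p : ℤ) ∣ x :=
  fun h1 => absurd (Int.le_of_dvd h0 h1) (not_le.2 h)

/-- The first `s(a, j)` factors of `φ_a` avoid the indices `±j`: for `i < s` the number `2i + a + 1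
- 2j` lies strictly between `-p` and `p`, and `2i + a + 1 + 2j` strictly between `0` and `2p`. The
remaining cases `0` and `p` are excluded by parity or by the inequalities of (A) and (C). -/
theorem twistExp_le_and_phi_dvd_of_ne_two (hp2 : p ≠ 2) {ε a j : ℕ} (ha : a < p)
    (hj : 2 * j + 1 ≤ p) (hε : j = 0 → ε = 0) :
    twistExp p a j ≤ p ∧ phi p a (twistExp p a j) ∣ redPoly p ε a (j : ℚ) := by
  have hodd := Nat.odd_iff.1 (hp.out.eq_two_or_odd'.resolve_left hp2)
  rw [twistExp]
  split_ifs with h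
  swap
  · simp [phi]
  rw [condA_natCast, condC_natCast, Nat.even_iff, Nat.odd_iff] at h
  have hs : shiftExp p a = if a % 2 = 0 then (p - a + 1) / 2 else (p - a) / 2 := by
    rw [shiftExp, if_neg hp2]
    simp only [Nat.even_iff]
  have hs1 : 2 * shiftExp p a ≤ p - a + 1 := by
    rw [hs]; split_ifs <;> omega
  have hs2 : shiftExp p a ≤ p := by omega
  refine ⟨hs2, ?_⟩
  rw [redPoly_of_ne_two p hp2]
  refine phi_dvd_of_forall_ne p hp2 hs2 (j := (j : ZMod p)) (psiAway_dvd_psi p hp2 fun h0 =>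
    hε (natCast_eq_zero_of_lt p (by omega) h0)) fun i hi => ?_
  have e1 := add_half_eq_iff p hp2 i a j
  have e2 := add_half_eq_iff p hp2 i a (-j)
  push_cast at e1 e2
  rw [Ne, Ne, e1, e2]
  have hi2 : (a % 2 = 0 ∧ 2 * i + a + 1 ≤ p) ∨ (a % 2 = 1 ∧ 2 * i + a + 2 ≤ p) := by
    rw [hs] at hi
    split_ifs at hi <;> omega
  constructor
  · intro hd
    rcases lt_trichotomy (2 * (i : ℤ) + a + 1 - 2 * j) 0 with h0 | h0 | h0
    · exact not_dvd_of_lt (x := -(2 * (i : ℤ) + a + 1 - 2 * j)) (by omega) (by omega)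
        ((dvd_neg).2 hd)
    · omega
    · exact not_dvd_of_lt h0 (by omega) hd
  · intro hd
    rcases lt_trichotomy (2 * (i : ℤ) + a + 1 - 2 * -j) p with h0 | h0 | h0
    · exact not_dvd_of_lt (by omega) h0 hd
    · omega
    · exact not_dvd_of_lt (x := 2 * (i : ℤ) + a + 1 - 2 * -j - p) (by omega) (by omega)
        (dvd_sub hd (dvd_refl _))

/-- This is the condition for `Fr'` to be multiplicative in weight `b = a + 2s`, and the reason for
the case distinction by (A) and (C): both `j` and `-j` must have the form `i + (b+1)/2` with `i < p
- b % p`. -/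
theorem phi_dvd_phi_mul_redPoly_of_ne_two (hp2 : p ≠ 2) {ε a j : ℕ} (ha : a < p)
    (hj : 2 * j + 1 ≤ p) (hε : j = 0 → ε = 0) {s : ℕ} (hs : s = twistExp p a j) :
    phi p ((a + 2 * s : ℕ) : ℤ) p ∣ phi p ((a + 2 * s : ℕ) : ℤ) (p - (a + 2 * s) % p) *
      (redPoly p ε a (j : ℚ)).comp (X + C ((s : ZMod p) * (s + a + 1))) := by
  have hodd := Nat.odd_iff.1 (hp.out.eq_two_or_odd'.resolve_left hp2)
  have h2 := two_ne_zero_of_ne_two p hp2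
  -- The two translations combine, since `((a+1)/2)² + s(s + a + 1) = ((a + 2s + 1)/2)²`.
  have hcomp : (redPoly p ε a (j : ℚ)).comp (X + C ((s : ZMod p) * (s + a + 1))) =
      (psi p ε (j : ZMod p)).comp (X + C (((((a + 2 * s : ℕ) : ZMod p) + 1) / 2) ^ 2)) := by
    rw [redPoly_of_ne_two p hp2, comp_assoc]
    congr 1
    simp only [add_comp, X_comp, C_comp, add_assoc, ← C_add]
    congr 2
    push_cast
    field_simp
    ring
  rw [hcomp]
  have key : ∀ b, (∃ i < p - b % p, (p : ℤ) ∣ 2 * (i : ℤ) + b + 1 - 2 * j) →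
      (∃ i < p - b % p, (p : ℤ) ∣ 2 * (i : ℤ) + b + 1 - 2 * (-j)) →
      phi p ((b : ℕ) : ℤ) p ∣ phi p ((b : ℕ) : ℤ) (p - b % p) *
      (psi p ε (j : ZMod p)).comp (X + C ((((b : ZMod p) + 1) / 2) ^ 2)) := by
    rintro b ⟨i, hi, h⟩ ⟨i', hi', h'⟩
    rw [← add_half_eq_iff p hp2] at h h'
    refine phi_dvd_mul_of_mem p hp2 (Nat.sub_le _ _) (j := (j : ZMod p))
      (psiAway_dvd_psi p hp2 fun h0 =>
        hε (natCast_eq_zero_of_lt p (by omega) h0)) ⟨i, hi, ?_⟩ ⟨i', hi', ?_⟩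
    · simpa using h
    · simpa using h'
  rw [twistExp] at hs
  split_ifs at hs with h
  · rw [condA_natCast, condC_natCast, Nat.even_iff, Nat.odd_iff] at h
    have hs' : s = if a % 2 = 0 then (p - a + 1) / 2 else (p - a) / 2 := by
      rw [hs, shiftExp, if_neg hp2]
      simp only [Nat.even_iff]
    rcases h with h | h
    -- Case (A): the weight becomes `1` modulo `p`, so the available indices are all nonzero
    -- residues, and (A) forces `j ≠ 0`.
    · have hb : a + 2 * s = p + 1 := by
        rw [hs', if_pos h.1]; omega
      rw [hb]
      have hb1 : (p + 1) % p = 1 := by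
        rw [Nat.add_mod_left, Nat.mod_eq_of_lt hp.out.one_lt]
      refine key (p + 1) ⟨j - 1, by omega, ⟨1, ?_⟩⟩ ⟨p - 1 - j, by omega, ⟨3, ?_⟩⟩ <;> omega
    -- Case (C): the weight becomes `0` modulo `p`, so `p - b % p = p` and the divisibility is
    -- trivial.
    · have hb : a + 2 * s = p := by
        rw [hs', if_neg (by omega)]; omega
      rw [hb, Nat.mod_self, Nat.sub_zero]
      exact Dvd.intro _ rfl
  · rw [condA_natCast, condC_natCast, Nat.even_iff, Nat.odd_iff] at h
    rw [hs, Nat.mul_zero, Nat.add_zero]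
    have hb1 : a % p = a := Nat.mod_eq_of_lt ha
    -- Without shift, the negations of (A) and (C) are precisely the bounds that put the witnesses
    -- below `p - a`. They solve `2i + a + 1 ∓ 2j = p` for even `a`, and `= 0`, `= 2p` for odd `a`.
    rcases Nat.mod_two_eq_zero_or_one a with h0 | h0
    · refine key a ⟨(2 * j + p - a - 1) / 2, by omega, ⟨1, ?_⟩⟩
        ⟨(p - a - 1 - 2 * j) / 2, by omega, ⟨1, ?_⟩⟩ <;> omega
    · refine key a ⟨(2 * j - a - 1) / 2, by omega, ⟨0, ?_⟩⟩
        ⟨(2 * p - 2 * j - a - 1) / 2, by omega, ⟨2, ?_⟩⟩ <;> omega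

end

end Hyperalgebra

end

/-! ### The divisibility statements for all primes -/

noncomputable section

namespace Hyperalgebra

section

theorem mem_labels_two {a : ℕ} {j : ℚ} (h : (a, j) ∈ labels 2) :
    (a = 0 ∧ j = 1 / 2) ∨ (a = 1 ∧ j = 0) ∨ (a = 1 ∧ j = 1) := by
  simpa [labels] using h

theorem twistExp_two_zero : twistExp 2 0 (1 / 2) = 0 := by
  rw [twistExp, if_neg]
  rintro (⟨-, h, -⟩ | ⟨h, -⟩)
  · norm_num at h
  · simp at h

theorem twistExp_two_one_zero : twistExp 2 1 0 = 1 := by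
  rw [twistExp, if_pos, shiftExp, if_pos rfl]
  right
  refine ⟨odd_one, le_rfl, ?_⟩
  norm_num

theorem twistExp_two_one_one : twistExp 2 1 1 = 0 := by
  rw [twistExp, if_neg]
  rintro (⟨h, -⟩ | ⟨-, -, h⟩)
  · simp at h
  · norm_num at h

theorem tail_mem_XSet (p : ℕ) {r : ℕ} {ε : Fin (r + 1) → ℕ} {l : Fin (r + 1) → ℕ × ℚ}
    (hε : ε ∈ XSet p l) : Fin.tail ε ∈ XSet p (Fin.tail l) :=
  ⟨fun i => hε.1 i.succ, fun i => hε.2 i.succ⟩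

theorem add_mem_XSet (p : ℕ) {r : ℕ} {ε ε' : Fin r → ℕ} {l : Fin r → ℕ × ℚ} (hε : ε ∈ XSet p l)
    (hε' : ε' ∈ XSet p l) (h : ¬ ∃ s, ε s = 1 ∧ ε' s = 1) : ε + ε' ∈ XSet p l := by
  refine ⟨fun i => ?_, fun i hi => by rw [Pi.add_apply, hε.2 i hi, hε'.2 i hi]⟩
  have h1 := hε.1 i
  have h2 := hε'.1 i
  have h3 : ¬ (ε i = 1 ∧ ε' i = 1) := fun h4 => h ⟨i, h4⟩
  rw [Pi.add_apply]
  omega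

variable (p : ℕ) [hp : Fact p.Prime]

theorem phi_one (a : ℤ) : phi p a 1 = X := by simp [phi]

theorem phi_two (a : ℤ) : phi p a 2 = X * (X - C ((a : ZMod p) + 2)) := by
  rw [phi, Finset.prod_range_succ, Finset.prod_range_one]
  push_cast
  rw [zero_mul, C_0, sub_zero, one_mul, show (1 : ZMod p) + a + 1 = a + 2 by ring]

theorem natDegree_redPoly_lt (ε a : ℕ) (j : ℚ) : (redPoly p ε a j).natDegree < p := by
  have hp2 := hp.out.two_le
  rw [redPoly]
  split_ifs
  · rw [natDegree_one]; omega
  · rw [natDegree_X]; omega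
  · rw [natDegree_X]; omega
  · rw [← C_1, natDegree_X_add_C]; omega
  · rw [natDegree_comp, natDegree_X_add_C, mul_one]
    exact (psi_ne_zero_and_natDegree_lt p ‹_› _ _).2

theorem twistExp_le_and_phi_dvd {ε a : ℕ} {j : ℚ} (h : (a, j) ∈ labels p)
    (hε : (if p = 2 then a = 1 else j = 0) → ε = 0) :
    twistExp p a j ≤ p ∧ phi p a (twistExp p a j) ∣ redPoly p ε a j := by
  by_cases hp2 : p = 2
  · subst hp2
    obtain ⟨rfl, rfl⟩ | ⟨rfl, rfl⟩ | ⟨rfl, rfl⟩ := mem_labels_two h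
    · rw [twistExp_two_zero]; simp [phi]
    · rw [twistExp_two_one_zero, phi_one 2]; simp [redPoly]
    · rw [twistExp_two_one_one]; simp [phi]
  · obtain ⟨ha, i, hi, rfl⟩ := exists_natCast_of_mem_labels p hp2 h
    rw [if_neg hp2, Nat.cast_eq_zero] at hε
    exact twistExp_le_and_phi_dvd_of_ne_two p hp2 ha hi hε

/-- This ensures that the exponents `m - s(a, j)` in `Z` are honest differences and not truncated
ones. -/
theorem twistExp_le_lowIdx {ε a : ℕ} {j : ℚ} (h : (a, j) ∈ labels p)
    (hε : (if p = 2 then a = 1 else j = 0) → ε = 0) : twistExp p a j ≤ lowIdx p ε a j := by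
  have h1 := (twistExp_le_and_phi_dvd p h hε).2
  by_cases hp2 : p = 2
  · subst hp2
    obtain ⟨rfl, rfl⟩ | ⟨rfl, rfl⟩ | ⟨rfl, rfl⟩ := mem_labels_two h
    · rw [twistExp_two_zero]; simp
    · rw [twistExp_two_one_zero]; simp [lowIdx]
    · rw [twistExp_two_one_one]; simp
  · rw [lowIdx, if_neg hp2]
    -- The supremum needs a bound: a divisor `φ_{a,n}` of a nonzero polynomial of degree below `p`
    -- has `n < p`.
    refine le_csSup ⟨p, fun n hn => ?_⟩ (by simpa [redPoly, hp2] using h1)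
    obtain ⟨hne, hdeg⟩ := psi_ne_zero_and_natDegree_lt p hp2 ε (j : ZMod p)
    have h2 := natDegree_le_of_dvd hn fun h0 => hne (by
      have := congrArg (fun f => f.comp (X - C ((((a : ZMod p) + 1) / 2) ^ 2))) h0
      simpa [comp_assoc] using this)
    rw [natDegree_phi, natDegree_comp, natDegree_X_add_C, mul_one] at h2
    omega

theorem two_eq_zero_poly : (2 : (ZMod 2)[X]) = 0 := by
  have : (2 : ZMod 2) = 0 := rfl
  rw [← C_ofNat, this, C_0]

theorem phi_dvd_phi_mul_redPoly {ε a : ℕ} {j : ℚ} (h : (a, j) ∈ labels p)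
    (hε : (if p = 2 then a = 1 else j = 0) → ε = 0) {s : ℕ} (hs : s = twistExp p a j) :
    phi p ((a + 2 * s : ℕ) : ℤ) p ∣ phi p ((a + 2 * s : ℕ) : ℤ) (p - (a + 2 * s) % p) *
      (redPoly p ε a j).comp (X + C ((s : ZMod p) * (s + a + 1))) := by
  by_cases hp2 : p = 2
  · subst hp2
    obtain ⟨rfl, rfl⟩ | ⟨rfl, rfl⟩ | ⟨rfl, rfl⟩ := mem_labels_two h
    · rw [twistExp_two_zero] at hs
      subst hs
      exact Dvd.intro _ rfl
    · rw [twistExp_two_one_zero] at hs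
      subst hs
      rw [phi_two 2]
      norm_num
      rw [phi_one 2]
      refine mul_dvd_mul_left _ (dvd_of_eq ?_)
      simp [redPoly]
      simp only [C_ofNat]
      linear_combination (-4 : (ZMod 2)[X]) * two_eq_zero_poly
    · rw [twistExp_two_one_one] at hs
      subst hs
      rw [phi_two 2]
      norm_num
      rw [phi_one 2]
      refine mul_dvd_mul_left _ (dvd_of_eq ?_)
      simp [redPoly]
      simp only [C_ofNat]
      linear_combination (-2 : (ZMod 2)[X]) * two_eq_zero_poly
  · obtain ⟨ha, i, hi, rfl⟩ := exists_natCast_of_mem_labels p hp2 h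
    rw [if_neg hp2, Nat.cast_eq_zero] at hε
    exact phi_dvd_phi_mul_redPoly_of_ne_two p hp2 ha hi hε hs

theorem phi_dvd_redPoly_mul_redPoly {ε ε' a : ℕ} {j : ℚ} (h : (a, j) ∈ labels p)
    (hε : (if p = 2 then a = 1 else j = 0) → ε = 0)
    (hε' : (if p = 2 then a = 1 else j = 0) → ε' = 0) (h0 : ε = 0 ∨ ε' = 0) :
    phi p a p ∣ redPoly p ε a j * redPoly p ε' a j - redPoly p (ε + ε') a j := by
  by_cases hp2 : p = 2
  · subst hp2
    obtain ⟨rfl, rfl⟩ | ⟨rfl, rfl⟩ | ⟨rfl, rfl⟩ := mem_labels_two h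
    · refine Dvd.dvd.trans ?_ (dvd_refl (0 : (ZMod 2)[X])) |>.trans (dvd_of_eq ?_)
      · exact dvd_zero _
      · rcases h0 with rfl | rfl <;> simp [redPoly]
    · rw [phi_two 2]
      refine ⟨1, ?_⟩
      simp [redPoly]
      simp only [C_ofNat]
      linear_combination (X : (ZMod 2)[X]) * two_eq_zero_poly
    · rw [phi_two 2]
      refine ⟨1, ?_⟩
      simp [redPoly]
      simp only [C_ofNat]
      linear_combination (2 * X : (ZMod 2)[X]) * two_eq_zero_poly
  · obtain ⟨ha, i, hi, rfl⟩ := exists_natCast_of_mem_labels p hp2 h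
    rw [if_neg hp2, Nat.cast_eq_zero] at hε hε'
    simp only [redPoly_of_ne_two p hp2, ← mul_comp, ← sub_comp]
    rw [phi_self_eq_comp p hp2]
    refine (compRingHom (X + C ((((a : ZMod p) + 1) / 2) ^ 2))).map_dvd
      (psiFull_dvd_psi_mul_psi p hp2 (fun h => hε ?_) (fun h => hε' ?_) h0) <;>
    exact natCast_eq_zero_of_lt p (by omega) h

theorem phi_dvd_redPoly_mul_redPoly_of_ne_zero {ε ε' a : ℕ} {j : ℚ} (h : (a, j) ∈ labels p)
    (hε : (if p = 2 then a = 1 else j = 0) → ε = 0) (h0 : ε ≠ 0) (h0' : ε' ≠ 0) :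
    phi p a p ∣ redPoly p ε a j * redPoly p ε' a j := by
  by_cases hp2 : p = 2
  · subst hp2
    obtain ⟨rfl, rfl⟩ | ⟨rfl, rfl⟩ | ⟨rfl, rfl⟩ := mem_labels_two h
    · rw [phi_two 2]
      refine ⟨1, ?_⟩
      simp [redPoly, h0, h0']
      simp only [C_ofNat]
      linear_combination two_eq_zero_poly
    · exact absurd (hε (by simp)) h0
    · exact absurd (hε (by simp)) h0
  · obtain ⟨ha, i, hi, rfl⟩ := exists_natCast_of_mem_labels p hp2 h
    rw [if_neg hp2, Nat.cast_eq_zero] at hε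
    simp only [redPoly_of_ne_two p hp2, ← mul_comp]
    rw [phi_self_eq_comp p hp2]
    refine (compRingHom (X + C ((((a : ZMod p) + 1) / 2) ^ 2))).map_dvd
      (psiFull_dvd_psi_mul_psi_of_ne_zero p hp2 (fun h => h0 (hε ?_)) h0 h0')
    exact natCast_eq_zero_of_lt p (by omega) h

/-! ### The product rule for `Z`, and the induction over tuples -/

variable (k : Type*) [Field k] [CharP k p]

theorem B₁_eq_evalYX (ε a : ℕ) (j : ℚ) :
    B₁ p k ε a j = evalYX k p (redPoly p ε a j) * mu k p a := by
  rw [B₁, redPoly]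
  by_cases hp2 : p = 2
  · rw [if_pos hp2, if_pos hp2]
    have h1 := (commute_mu_hypYX p k a).eq
    rw [hypYX, ← mul_assoc] at h1
    split_ifs
    · simp
    · rw [evalYX_X, h1, hypYX]
    · rw [evalYX_X, h1, hypYX]
    · rw [map_add, map_one, evalYX_X, h1, hypYX, add_mul, one_mul]
  · rw [if_neg hp2, if_neg hp2]
    have h0 : ofPrime p k 2 = 2 := map_ofNat (ofPrime p k) 2
    have h3 := aeval_mul_mu p k hp2 a ((((a : k) + 1) / 2) ^ 2)
      ((psi p ε (j : ZMod p)).map (ofPrime p k))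
    rw [h3, evalYX_apply, Polynomial.map_comp]
    simp [h0]

/-- The coefficients are only known through an identity in the hyperalgebra; as all degrees are
below `p`, that identity can be lifted to polynomials. -/
theorem sum_coeffB_mul_phi (ε a : ℕ) (j : ℚ) :
    ∑ m ∈ Finset.Icc (lowIdx p ε a j) (p - 1), C (coeffB p k ε a j m) * phi p a m =
      redPoly p ε a j := by
  have hpos := hp.out.pos
  rw [← sub_eq_zero]
  refine eq_zero_of_evalYX_mul_mu k p (a := (a : ℤ)) ?_ ?_
  · refine lt_of_le_of_lt (natDegree_sub_le _ _) (max_lt ?_ (natDegree_redPoly_lt p ε a j))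
    refine lt_of_le_of_lt (natDegree_sum_le_of_forall_le (n := p - 1) _ _ fun m hm => ?_) (by omega)
    refine (natDegree_C_mul_le _ _).trans ?_
    rw [natDegree_phi]
    exact (Finset.mem_Icc.1 hm).2
  · rw [map_sub, sub_mul, ← B₁_eq_evalYX, B₁_eq_sum, map_sum, Finset.sum_mul, Finset.mul_sum,
      sub_eq_zero]
    refine Finset.sum_congr rfl fun m _ => ?_
    rw [map_mul, evalYX_C, mul_assoc, evalYX_phi_mul_mu, ← (commute_mu_pow p k a m).eq,
      mul_smul_comm, ← Algebra.smul_def]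

theorem Z_one {ε a : ℕ} {j : ℚ} (h : (a, j) ∈ labels p)
    (hε : (if p = 2 then a = 1 else j = 0) → ε = 0) : Z p k ε a j 1 = B₁ p k ε a j := by
  have h1 := twistExp_le_lowIdx p h hε
  rw [twistExp] at h1
  rw [Z, frobSplit_one]
  split_ifs at h1 ⊢ with hc
  · rw [B₁_eq_sum]
    congr 1
    refine Finset.sum_congr rfl fun m hm => ?_
    have := (Finset.mem_Icc.1 hm).1
    rw [mul_one, mul_assoc, ← pow_add, Nat.sub_add_cancel (h1.trans this)]
  · rw [one_mul]

/-- Moving `μ_a` past `Y^s` gives `μ_{a+2s}`, and `Y^{m-s} X^{m-s} μ_{a+2s}` is a polynomial in `YX`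
that commutes with `Fr'(z)`. With exponent `0` the second case of `Z` has the same form. The
equation for `Q` says that `Q` is the translated polynomial of `B^{(ε)}(a, j)` divided by the
translated `φ_{a,s}`. -/
theorem exists_Z_eq_twist {ε a : ℕ} {j : ℚ} (h : (a, j) ∈ labels p)
    (hε : (if p = 2 then a = 1 else j = 0) → ε = 0) {s : ℕ} (hs : s = twistExp p a j) :
    ∃ Q : (ZMod p)[X], (∀ z, Z p k ε a j z = twist k p s (a + 2 * s) Q z) ∧
      (phi p a s).comp (X + C ((s : ZMod p) * (s + a + 1))) * Q =
        (redPoly p ε a j).comp (X + C ((s : ZMod p) * (s + a + 1))) := by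
  have h1 := twistExp_le_lowIdx p h hε
  rw [← hs] at h1
  refine ⟨∑ m ∈ Finset.Icc (lowIdx p ε a j) (p - 1),
    C (coeffB p k ε a j m) * phi p ((a + 2 * s : ℕ) : ℤ) (m - s), fun z => ?_, ?_⟩
  · rw [twistExp] at hs
    rw [Z]
    split_ifs at hs ⊢ with hc
    · rw [← hs, twist, map_sum, Finset.sum_mul, Finset.mul_sum, Finset.mul_sum, Finset.mul_sum,
        Finset.sum_mul]
      refine Finset.sum_congr rfl fun m hm => ?_
      have hm' := h1.trans (Finset.mem_Icc.1 hm).1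
      have hμ : mu k p ((a + 2 * s : ℕ) : ℤ) = mu k p ((a : ℤ) + 2 * s) := by push_cast; rfl
      obtain ⟨d, rfl⟩ := Nat.exists_eq_add_of_le hm'
      rw [Nat.add_sub_cancel_left, map_mul, evalYX_C, mul_assoc (algebraMap k (U k) _),
        evalYX_phi_mul_mu, ← Algebra.smul_def]
      simp only [mul_smul_comm, smul_mul_assoc]
      congr 1
      have h2 := (commute_mu_pow p k ((a + 2 * s : ℕ) : ℤ) d).eq
      have h4 : Commute (frobSplit k p z)
          (hypY k 1 ^ d * hypX k 1 ^ d * mu k p ((a + 2 * s : ℕ) : ℤ)) := by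
        rw [← evalYX_phi_mul_mu]
        exact (commute_evalYX k p (frobSplit_commute_hypYX k p z) _).mul_right
          (frobSplit_commute_mu k p _ z)
      calc _ = mu k p a * hypY k 1 ^ s *
            (hypY k 1 ^ d * hypX k 1 ^ d * frobSplit k p z * hypX k 1 ^ s) := by
            rw [pow_add]; simp only [mul_assoc]
        _ = _ := by
            rw [← hypY_pow_mul_mu k p s a, h4.eq, ← h2, hμ]
            simp only [mul_assoc]
    · subst hs
      have h2 := sum_coeffB_mul_phi p k ε a j
      simp only [Nat.mul_zero, Nat.add_zero, Nat.sub_zero, twist, pow_zero, one_mul, mul_one]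
      rw [h2, B₁_eq_evalYX]
  · rw [← sum_coeffB_mul_phi p k, sum_comp, Finset.mul_sum]
    refine Finset.sum_congr rfl fun m hm => ?_
    have hm' := h1.trans (Finset.mem_Icc.1 hm).1
    obtain ⟨d, rfl⟩ := Nat.exists_eq_add_of_le hm'
    rw [Nat.add_sub_cancel_left, ← phi_mul_comp, mul_comp, mul_comp, C_comp, comp_assoc]
    simp
    ring

/-- Common source of both product rules: `f` is any polynomial congruent to the product for one pair
modulo `φ_{a,p}`. It will be the polynomial of `B^{(ε+ε')}(a, j)`, or zero. -/
theorem exists_Z_mul_Z {a : ℕ} {j : ℚ} (h : (a, j) ∈ labels p) {s : ℕ} (hs : s = twistExp p a j)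
    {ε ε' : ℕ} (hε : (if p = 2 then a = 1 else j = 0) → ε = 0)
    (hε' : (if p = 2 then a = 1 else j = 0) → ε' = 0) {f : (ZMod p)[X]}
    (hf : phi p a p ∣ redPoly p ε a j * redPoly p ε' a j - f) {R : (ZMod p)[X]}
    (hR : (phi p a s).comp (X + C ((s : ZMod p) * (s + a + 1))) * R =
      f.comp (X + C ((s : ZMod p) * (s + a + 1)))) (z z' : U k) :
    Z p k ε a j z * Z p k ε' a j z' = twist k p s (a + 2 * s) R (z * z') := by
  obtain ⟨Q, hQ, hQ'⟩ := exists_Z_eq_twist p k h hε hs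
  obtain ⟨Q₁, hQ₁, hQ₁'⟩ := exists_Z_eq_twist p k h hε' hs
  have hsp : s ≤ p := hs ▸ (twistExp_le_and_phi_dvd p h hε).1
  have hP := phi_dvd_phi_mul_redPoly p h hε hs
  rw [← hQ'] at hP
  rw [hQ, hQ₁, twist_mul_twist k p a s hP]
  refine twist_congr k p a s hsp ?_ _
  set φ := (phi p a s).comp (X + C ((s : ZMod p) * (s + a + 1))) with hφ
  have hφ0 : φ ≠ 0 := by
    rw [hφ]
    exact ((monic_phi p a s).comp (monic_X_add_C _) (by simp only [natDegree_X_add_C, ne_eq,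
      one_ne_zero, not_false_eq_true])).ne_zero
  -- The translated `φ_{a,p}` is `φ` times `φ_{a+2s,p-s}`. Cancelling `φ` from the translated
  -- congruence leaves a congruence modulo `φ_{a+2s,p-s}`, which is the precision to which `Q`
  -- matters.
  have h1 : (phi p a p).comp (X + C ((s : ZMod p) * (s + a + 1))) =
      φ * phi p ((a + 2 * s : ℕ) : ℤ) (p - s) := by
    have h2 := phi_mul_comp p a s (p - s)
    rw [Nat.add_sub_cancel' hsp] at h2
    rw [← h2, mul_comp, comp_assoc]
    simp [hφ]
  have h3 := (compRingHom (X + C ((s : ZMod p) * (s + a + 1)))).map_dvd hf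
  change Polynomial.comp _ _ ∣ Polynomial.comp _ _ at h3
  rw [sub_comp, mul_comp] at h3
  rw [h1, ← hQ', ← hQ₁', ← hR] at h3
  refine (mul_dvd_mul_iff_left hφ0).1 (h3.trans (dvd_of_eq ?_))
  ring

theorem Z_mul_Z {a : ℕ} {j : ℚ} (h : (a, j) ∈ labels p) {ε ε' : ℕ}
    (hε : (if p = 2 then a = 1 else j = 0) → ε = 0)
    (hε' : (if p = 2 then a = 1 else j = 0) → ε' = 0) (h0 : ε = 0 ∨ ε' = 0) (z z' : U k) :
    Z p k ε a j z * Z p k ε' a j z' = Z p k (ε + ε') a j (z * z') := by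
  obtain ⟨R, hR, hR'⟩ := exists_Z_eq_twist p k h (ε := ε + ε')
    (fun h1 => by rw [hε h1, hε' h1]) rfl
  rw [hR]
  exact exists_Z_mul_Z p k h rfl hε hε' (phi_dvd_redPoly_mul_redPoly p h hε hε' h0) hR' z z'

theorem Z_mul_Z_eq_zero {a : ℕ} {j : ℚ} (h : (a, j) ∈ labels p) {ε ε' : ℕ}
    (hε : (if p = 2 then a = 1 else j = 0) → ε = 0)
    (hε' : (if p = 2 then a = 1 else j = 0) → ε' = 0) (h0 : ε ≠ 0) (h0' : ε' ≠ 0) (z z' : U k) :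
    Z p k ε a j z * Z p k ε' a j z' = 0 := by
  have h1 := phi_dvd_redPoly_mul_redPoly_of_ne_zero p h hε h0 h0'
  rw [← sub_zero (_ * _)] at h1
  rw [exists_Z_mul_Z p k h rfl hε hε' h1 (R := 0) (by simp)]
  simp [twist]

theorem Z_zero (ε a : ℕ) (j : ℚ) : Z p k ε a j 0 = 0 := by simp [Z]

/-- Because `Fr'(1) = 1`, the value `1` for the empty tuple extends the recursion down to length
one, so the induction can start at `r = 0`. -/
theorem B_succ (r : ℕ) (ε : Fin (r + 1) → ℕ) (l : Fin (r + 1) → ℕ × ℚ)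
    (hl : ∀ i, l i ∈ labels p) (hε : ε ∈ XSet p l) :
    B p k (r + 1) ε l = Z p k (ε 0) (l 0).1 (l 0).2 (B p k r (Fin.tail ε) (Fin.tail l)) := by
  rcases r with _ | r
  · exact (Z_one p k (hl 0) (hε.2 0)).symm
  · rfl

theorem B_mul_B {r : ℕ} {l : Fin r → ℕ × ℚ} (hl : ∀ i, l i ∈ labels p) {ε ε' : Fin r → ℕ}
    (hε : ε ∈ XSet p l) (hε' : ε' ∈ XSet p l) :
    ((∃ s, ε s = 1 ∧ ε' s = 1) → B p k r ε l * B p k r ε' l = 0) ∧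
    ((¬ ∃ s, ε s = 1 ∧ ε' s = 1) → B p k r ε l * B p k r ε' l = B p k r (ε + ε') l) := by
  induction r with
  | zero => exact ⟨fun ⟨s, _⟩ => s.elim0, fun _ => mul_one _⟩
  | succ r ih =>
    obtain ⟨ih1, ih2⟩ := ih (l := Fin.tail l) (fun i => hl i.succ) (tail_mem_XSet p hε) (tail_mem_XSet p hε')
    constructor
    · rintro ⟨s, hs, hs'⟩
      rw [B_succ p k r ε l hl hε, B_succ p k r ε' l hl hε']
      -- If the common index `s` is not `0`, the inner product vanishes by induction and `Z` maps it
      -- to zero; if both first entries are nonzero, the outer product of `Z`s already vanishes.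
      by_cases h0 : ε 0 = 0 ∨ ε' 0 = 0
      · rw [Z_mul_Z p k (hl 0) (hε.2 0) (hε'.2 0) h0]
        rcases Fin.eq_zero_or_eq_succ s with rfl | ⟨t, rfl⟩
        · omega
        · rw [ih1 ⟨t, hs, hs'⟩, Z_zero]
      · rw [not_or] at h0
        exact Z_mul_Z_eq_zero p k (hl 0) (hε.2 0) (hε'.2 0) h0.1 h0.2 _ _
    · intro h
      have h0 : ε 0 = 0 ∨ ε' 0 = 0 := by
        have h1 := hε.1 0
        have h2 := hε'.1 0
        have h3 : ¬ (ε 0 = 1 ∧ ε' 0 = 1) := fun h4 => h ⟨0, h4⟩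
        omega
      rw [B_succ p k r ε l hl hε, B_succ p k r ε' l hl hε',
        B_succ p k r _ l hl (add_mem_XSet p hε hε' h), Z_mul_Z p k (hl 0) (hε.2 0) (hε'.2 0) h0,
        ih2 fun ⟨t, ht⟩ => h ⟨t.succ, ht⟩]
      rfl

end

end Hyperalgebra

end

theorem lemma3p9 (p : ℕ) [Fact p.Prime] (k : Type*) [Field k] [IsAlgClosed k] [CharP k p]
    (r : ℕ) (hr : 0 < r) (l : Fin r → ℕ × ℚ) (hl : ∀ i, l i ∈ Hyperalgebra.labels p)
    (ε ε' : Fin r → ℕ) (hε : ε ∈ Hyperalgebra.XSet p l) (hε' : ε' ∈ Hyperalgebra.XSet p l) :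
    ((∃ s, ε s = 1 ∧ ε' s = 1) →
      Hyperalgebra.B p k r ε l * Hyperalgebra.B p k r ε' l = 0) ∧
    ((¬ ∃ s, ε s = 1 ∧ ε' s = 1) →
      Hyperalgebra.B p k r ε l * Hyperalgebra.B p k r ε' l = Hyperalgebra.B p k r (ε + ε') l ∧
      ε + ε' ∈ Hyperalgebra.XSet p l) := by
  obtain ⟨h1, h2⟩ := Hyperalgebra.B_mul_B p k hl hε hε'
  exact ⟨h1, fun h => ⟨h2 h, Hyperalgebra.add_mem_XSet p hε hε' h⟩⟩
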